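/- Let $V$ be a simple (finite-dimensional) Euclidean Jordan algebra with unit $e$, multiplication operators $L(x)$ and symmetric cone $\Omega$ (the set of invertible squares). Let $G$ be the identity component of $GL(\Omega)=\{g\in GL(V)\mid g\Omega=\Omega\}$ and $K=G_e$. Let $(c_1,\dots,c_r)$ be a Jordan frame, $V_{ij}$ ($i<j$) the Peirce spaces, $d=\dim V_{ij}$, $\Delta$ and $\mathrm{tr}$ the determinant and trace of $V$, $\Delta(g):=\Delta(ge)$ for $g\in G$, and $x\square y=L(xy)+[L(x),L(y)]$. Put $\mathfrak g^+_{ij}=\{a\square c_i\mid a\in V_{ij}\}$ and $\mathfrak g^-_{ij}=\{a\square c_j\mid a\in V_{ij}\}$ for $i<j$. Fix $1\le l\le r-1$ and put $e_l=c_1+\dots+c_l$. Let $\mathfrak a_l=\langle L(c_j)\mid j\le l\rangle$, $\overline{\mathfrak n}_l=\bigoplus_{i\le l,\,i<j}\mathfrak g^-_{ij}$, $A_l=\exp\mathfrak a_l$, $\overline N_l=\exp\overline{\mathfrak n}_l$, $Q_l=Z_G(\mathfrak a_l)\overline N_l$ and $M_l=\{m\in Z_G(\mathfrak a_l)\mid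 mc_j=c_j,\ j\le l\}$, so that $Q_l=M_lA_l\overline N_l$. For $\nu\in(\mathfrak a_l)_{\mathbb C}^*$ put $\nu_j=\nu(L(c_j))$, let $(1\otimes e^{\nu}\otimes1)(q)=e^{\nu(\log a_l(q))}$, where $a_l(q)$ is the $A_l$-component of $q\in Q_l$, and let $\mathrm{Ind}_{Q_l}^G(1\otimes e^\nu\otimes1)$ be the left regular representation of $G$ on the Fréchet space of continuous $f:G\to\mathbb C$ with $f(gq)=e^{-\nu(\log a_l(q))}f(g)$ for all $g\in G$, $q\in Q_l$ (with uniform convergence on compact sets). Let $G'=\{g\in G\mid\Delta(g)=1\}$, $h_j=L(c_j)-\frac{L(e-e_l)}{r-l}$, $\mathfrak a'_l=\langle h_j\mid j\le l\rangle$, $\mathfrak m'_l=\mathfrak z_{\mathfrak k}(\{L(c_1),\dots,L(c_r)\})\oplus\bigoplus_{j=l+1}^{r-1}\mathbb R h_j\oplus\bigoplus_{l<i<j}(\mathfrak g^+_{ij}\oplus\mathfrak g^-_{ij})$ with $\mathfrak k=\mathrm{Lie}(K)$, and let $Q'_l$ be the parabolic subgroup of $G'$ associated with $\mathfrak q'_l=\mathfrak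 m'_l\oplus\mathfrak a'_l\oplus\overline{\mathfrak n}_l$, i.e. the normaliser of $\mathfrak q'_l$ in $G'$, with Langlands decomposition $Q'_l=M'_lA'_l\overline N_l$, where $A'_l=\exp\mathfrak a'_l$, $M'_l=Z_K(\mathfrak a'_l)\exp(\mathfrak m'_l\cap\mathfrak p')$ and $\mathfrak p'=\{L(x)\mid \mathrm{tr}\,x=0\}$. For $\mu\in(\mathfrak a'_l)_{\mathbb C}^*$ define $\mathrm{Ind}_{Q'_l}^{G'}(1\otimes e^\mu\otimes1)$ in the same way as above. Then $g\mapsto\Delta(g)$ is a continuous character of $G$ with positive values, with kernel $G'$; the map $(g',\zeta)\mapsto\zeta g'$ is an isomorphism of topological groups $G'\times\mathbb R_+\to G$; there is a linear isomorphism $\nu\mapsto\tilde\nu$ from $(\mathfrak a_l)^*_{\mathbb C}$ to $(\mathfrak a'_l)^*_{\mathbb C}$ with $\tilde\nu(h_j)=\nu_j$ for $j\le l$; and for every $\nu\in(\mathfrak a_l)^*_{\mathbb C}$ there is an isomorphism of representations of $G= G'\times\mathbb R_+$ (a linear homeomorphism that intertwines the actions) $$\mathrm{Ind}_{Q_l}^{G}(1\otimes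 e^{\nu}\otimes1)\otimes\Delta^{-\frac{ld}{4}}\;\simeq\;\mathrm{Ind}_{Q'_l}^{G'}(1\otimes e^{\tilde\nu}\otimes1)\otimes m_\nu,\qquad m_\nu(\zeta)=\zeta^{-\frac{rld}{4}+\sum_{j=1}^l\nu_j}\quad(\zeta\in\mathbb R_+).$$ -/

import Mathlib

open scoped InnerProductSpace

/-- A Euclidean Jordan algebra structure on a (finite-dimensional) real inner product space:
a commutative bilinear product with unit, satisfying the Jordan identity
`[L(x), L(x²)] = 0`, for which every multiplication operator is symmetric. -/
class EuclideanJordanAlgebra (V : Type*) [NormedAddCommGroup V] [InnerProductSpace ℝ V] where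
  /-- the Jordan product -/
  jmul : V →ₗ[ℝ] V →ₗ[ℝ] V
  /-- the unit element -/
  e : V
  jmul_comm : ∀ x y, jmul x y = jmul y x
  e_jmul : ∀ x, jmul e x = x
  jordan : ∀ x y, jmul x (jmul (jmul x x) y) = jmul (jmul x x) (jmul x y)
  symm : ∀ x y z, ⟪jmul x y, z⟫_ℝ = ⟪y, jmul x z⟫_ℝ

namespace EuclideanJordanAlgebra

noncomputable section

/-! ### Induced representations and characters, for groups of invertible linear maps -/

/-- The multiplicative group `ℝ₊`. -/
abbrev PosReal := {x : ℝ // 0 < x}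

/-- The character `ζ ↦ ζ ^ s` of `ℝ₊`. -/
def powChar (s : ℂ) : PosReal →* ℂ where
  toFun ζ := ((ζ : ℝ) : ℂ) ^ s
  map_one' := by simp
  map_mul' a b := by
    have := Complex.mul_cpow_ofReal_nonneg a.2.le b.2.le s
    simpa using this

/-- The tensor product of a representation with a one-dimensional character, realised on the
space of the representation. -/
def twist {Γ W : Type*} [Monoid Γ] [AddCommGroup W] [Module ℂ W]
    (ρ : Representation ℂ Γ W) (χ : Γ →* ℂ) : Representation ℂ Γ W where
  toFun g := χ g • ρ g
  map_one' := by simp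
  map_mul' a b := by
    ext w
    simp [mul_smul, smul_comm (χ a) (χ b)]

variable (V : Type*) [NormedAddCommGroup V] [InnerProductSpace ℝ V]

/-- `GL(V)`, with its usual topology. -/
abbrev GLV := (V →L[ℝ] V)ˣ

variable {V}

/-- `C(H, Q, χ)`: the continuous functions `f` on `H` such that `f (g q) = χ(q)⁻¹ f(g)` for all
`q` in `Q`, with the topology of uniform convergence on compact sets. -/
def equivFun (H : Subgroup (GLV V)) (Q : Set (GLV V)) (χ : GLV V → ℂ) :
    Submodule ℂ C(H, ℂ) where
  carrier := {f | ∀ g q : H, (q : GLV V) ∈ Q → f (g * q) = (χ q)⁻¹ * f g}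
  add_mem' {f₁ f₂} h₁ h₂ g q hq := by
    simp [h₁ g q hq, h₂ g q hq, mul_add]
  zero_mem' g q hq := by simp
  smul_mem' z f h g q hq := by
    simp [h g q hq, mul_left_comm]

/-- The induced representation `Ind_Q^H χ`: the left regular representation of `H` on
`C(H, Q, χ)`. -/
def indRep (H : Subgroup (GLV V)) (Q : Set (GLV V)) (χ : GLV V → ℂ) :
    Representation ℂ H (equivFun H Q χ) where
  toFun h :=
    { toFun := fun f => ⟨f.1.comp ⟨fun x => h⁻¹ * x, by fun_prop⟩, fun g q hq => by
        simpa [mul_assoc] using f.2 (h⁻¹ * g) q hq⟩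
      map_add' := fun f₁ f₂ => by ext x; simp
      map_smul' := fun z f => by ext x; simp }
  map_one' := by ext f x; simp
  map_mul' a b := by ext f x; simp [mul_assoc]

open Classical in
/-- For an element `q` of a product `M · exp(𝔞) · N`, the element `log a(q)` of `𝔞`, where `a(q)`
is the `exp(𝔞)`-component of `q`. -/
def logA (M : Set (GLV V)) (𝔞 : Submodule ℝ (V →L[ℝ] V)) (N : Set (GLV V)) (q : GLV V) : 𝔞 :=
  if h : ∃ X : 𝔞, ∃ m ∈ M, ∃ n ∈ N,
      (q : V →L[ℝ] V) = m * NormedSpace.exp (X : V →L[ℝ] V) * n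
  then h.choose else 0

/-- The character `1 ⊗ e^ν ⊗ 1` of a group `M · exp(𝔞) · N`, for `ν` in the complexified dual of
`𝔞`, that is, a real-linear map from `𝔞` to `ℂ`. -/
def expChar (M : Set (GLV V)) (𝔞 : Submodule ℝ (V →L[ℝ] V)) (N : Set (GLV V))
    (ν : 𝔞 →ₗ[ℝ] ℂ) (q : GLV V) : ℂ :=
  Complex.exp (ν (logA M 𝔞 N q))

/-- The Lie algebra of a closed subgroup of `GL(V)`. -/
def lieAlg (H : Set (GLV V)) : Set (V →L[ℝ] V) :=
  {X | ∀ t : ℝ, ∃ g ∈ H, (g : V →L[ℝ] V) = NormedSpace.exp (t • X)}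

/-- The exponentials of the elements of a subset of `𝔤𝔩(V)`. -/
def expSet (S : Set (V →L[ℝ] V)) : Set (GLV V) :=
  {g | ∃ X ∈ S, (g : V →L[ℝ] V) = NormedSpace.exp X}

/-- The elements of `H` that centralise all elements of `S ⊆ 𝔤𝔩(V)`. -/
def centr (H : Set (GLV V)) (S : Set (V →L[ℝ] V)) : Set (GLV V) :=
  {g | g ∈ H ∧ ∀ X ∈ S, (g : V →L[ℝ] V) * X * (g⁻¹ : GLV V) = X}

/-- The elements of `H` that normalise the subspace `𝔮` of `𝔤𝔩(V)`. -/
def normalis (H : Set (GLV V)) (𝔮 : Submodule ℝ (V →L[ℝ] V)) : Set (GLV V) :=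
  {g | g ∈ H ∧ ∀ X, X ∈ 𝔮 ↔ (g : V →L[ℝ] V) * X * (g⁻¹ : GLV V) ∈ 𝔮}

/-! ### Jordan algebras -/

variable [FiniteDimensional ℝ V] [EuclideanJordanAlgebra V]

/-- The multiplication operator `L(x)`. -/
def L : V →ₗ[ℝ] (V →L[ℝ] V) :=
  (LinearMap.toContinuousLinearMap (𝕜 := ℝ) (E := V) (F' := V)).toLinearMap ∘ₗ jmul

/-- The quadratic representation `P(x) = 2 L(x)² - L(x²)`. -/
def P (x : V) : V →L[ℝ] V := (2 : ℝ) • (L x * L x) - L (jmul x x)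

/-- The operator `x □ y = L(xy) + [L(x), L(y)]`. -/
def box (x y : V) : V →L[ℝ] V := L (jmul x y) + (L x * L y - L y * L x)

variable (V) in
/-- `V` is simple: it is nonzero and has no ideals other than `0` and `V`. -/
def IsSimple : Prop :=
  Nontrivial V ∧ ∀ I : Submodule ℝ V, (∀ x, ∀ y ∈ I, jmul x y ∈ I) → I = ⊥ ∨ I = ⊤

variable (V) in
/-- The symmetric cone `Ω`: the set of invertible squares. -/
def cone : Set V := {y | (∃ x, y = jmul x x) ∧ IsUnit (P y)}

variable (V) in
/-- `GL(Ω) = {g ∈ GL(V) | g Ω = Ω}`. -/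
def GLcone : Subgroup (GLV V) where
  carrier := {g | (fun x => (g : V →L[ℝ] V) x) '' cone V = cone V}
  one_mem' := by simp
  mul_mem' {a b} ha hb := by
    simp only [Set.mem_ofPred_eq] at *
    conv_rhs => rw [← ha, ← hb]
    rw [Set.image_image]
    rfl
  inv_mem' {a} ha := by
    simp only [Set.mem_ofPred_eq] at *
    conv_lhs => rw [← ha]
    rw [Set.image_image]
    have h : ∀ x, ((a⁻¹ : GLV V) : V →L[ℝ] V) ((a : V →L[ℝ] V) x) = x := fun x => by
      rw [← mul_apply_eq_comp, Units.inv_mul, one_apply_eq_self]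
    simp [h]

variable (V) in
/-- The group `G`: the identity component of `GL(Ω)`. -/
def G : Subgroup (GLV V) :=
  (Subgroup.connectedComponentOfOne (GLcone V)).map (GLcone V).subtype

variable (V) in
/-- The stabiliser `K` of the unit element in `G`. -/
def K : Set (GLV V) := {g | g ∈ G V ∧ (g : V →L[ℝ] V) e = e}

/-- Primitive (minimal) idempotents: nonzero idempotents that are not the sum of two nonzero
orthogonal idempotents. -/
def IsPrimitive (c : V) : Prop :=
  c ≠ 0 ∧ jmul c c = c ∧
    ¬ ∃ a b : V, a ≠ 0 ∧ b ≠ 0 ∧ jmul a a = a ∧ jmul b b = b ∧ jmul a b = 0 ∧ c = a + b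

/-- Jordan frames: complete families of mutually orthogonal minimal idempotents. -/
def IsJordanFrame {r : ℕ} (c : Fin r → V) : Prop :=
  (∀ i, IsPrimitive (c i)) ∧ (∀ i j, i ≠ j → jmul (c i) (c j) = 0) ∧ ∑ i, c i = e

open Classical in
/-- The eigenvalues of `x`, with multiplicities: the coefficients of `x` in its spectral
decomposition `x = ∑ λ_j u_j` along some Jordan frame `(u_j)`. -/
def eigenvalues (x : V) : Multiset ℝ :=
  if h : ∃ s : Multiset ℝ, ∃ (n : ℕ) (u : Fin n → V) (ev : Fin n → ℝ),
      IsJordanFrame u ∧ x = ∑ j, ev j • u j ∧ s = Finset.univ.val.map ev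
  then h.choose else 0

/-- The determinant `Δ` of the Jordan algebra. -/
def jdet (x : V) : ℝ := (eigenvalues x).prod

/-- The trace of the Jordan algebra. -/
def jtr (x : V) : ℝ := (eigenvalues x).sum

/-- The kernel of a character `δ` of `G`, as a subgroup of `GL(V)`. -/
def kerG (δ : G V →ₜ* PosReal) : Subgroup (GLV V) :=
  (δ : G V →* PosReal).ker.map (G V).subtype

/-! ### Objects attached to a Jordan frame `c₁, …, c_r`

The frame is indexed by `Fin r`, so that the condition `j ≤ l` on an index `j ∈ {1, …, r}` becomes
`(j : ℕ) < l`. -/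

variable {r : ℕ} (c : Fin r → V) (l : ℕ)

/-- The Peirce space `V_{ij}`, for `i ≠ j`. -/
def peirce (i j : Fin r) : Submodule ℝ V :=
  Module.End.eigenspace (jmul (c i)) (1 / 2 : ℝ) ⊓ Module.End.eigenspace (jmul (c j)) (1 / 2 : ℝ) ⊓
    ⨅ k : {k : Fin r // k ≠ i ∧ k ≠ j}, Module.End.eigenspace (jmul (c k)) (0 : ℝ)

/-- The degree `d` of the Jordan algebra: the common dimension of the Peirce spaces `V_{ij}`,
`i ≠ j` (for rank at least two). -/
def degree : ℕ :=
  if h : 2 ≤ r then Module.finrank ℝ (peirce c ⟨0, by omega⟩ ⟨1, by omega⟩) else 0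

/-- The root space `𝔤⁺_{ij} = {a □ c_i | a ∈ V_{ij}}`. -/
def gPlus (i j : Fin r) : Submodule ℝ (V →L[ℝ] V) :=
  Submodule.span ℝ ((fun a => box a (c i)) '' peirce c i j)

/-- The root space `𝔤⁻_{ij} = {a □ c_j | a ∈ V_{ij}}`. -/
def gMinus (i j : Fin r) : Submodule ℝ (V →L[ℝ] V) :=
  Submodule.span ℝ ((fun a => box a (c j)) '' peirce c i j)

/-- The idempotent `e_l = c_1 + ⋯ + c_l`. -/
def eSum : V := ∑ k : {k : Fin r // (k : ℕ) < l}, c k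

/-- `𝔫̄_l`, the sum of the `𝔤⁻_{ij}` with `i ≤ l`, `i < j`. -/
def nBar : Submodule ℝ (V →L[ℝ] V) :=
  ⨆ p : {p : Fin r × Fin r // (p.1 : ℕ) < l ∧ p.1 < p.2}, gMinus c p.1.1 p.1.2

/-- `N̄_l = exp 𝔫̄_l`. -/
def NBar : Set (GLV V) := expSet (nBar c l)

/-- `𝔞_l`, spanned by `L(c_1), …, L(c_l)`. -/
def aSub : Submodule ℝ (V →L[ℝ] V) :=
  Submodule.span ℝ (Set.range fun j : {j : Fin r // (j : ℕ) < l} => L (c j))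

/-- The basis vector `L(c_j)` of `𝔞_l`, `j ≤ l`. -/
def aVec (j : {j : Fin r // (j : ℕ) < l}) : aSub c l :=
  ⟨L (c j), Submodule.subset_span ⟨j, rfl⟩⟩

/-- `Z_G(𝔞_l)`. -/
def ZA : Set (GLV V) := centr (G V) (aSub c l)

/-- `Q_l = Z_G(𝔞_l) N̄_l`. -/
def Q : Set (GLV V) := {q | ∃ z ∈ ZA c l, ∃ n ∈ NBar c l, q = z * n}

/-- `M_l`, the elements of `Z_G(𝔞_l)` that fix `c_1, …, c_l`. -/
def M : Set (GLV V) :=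
  {g | g ∈ ZA c l ∧ ∀ j : Fin r, (j : ℕ) < l → (g : V →L[ℝ] V) (c j) = c j}

/-- `L(c_j) - L(e - e_l) / (r - l)`. -/
def hVec (j : Fin r) : V →L[ℝ] V := L (c j) - ((r : ℝ) - l)⁻¹ • L (e - eSum c l)

/-- `𝔞'_l`, spanned by the `L(c_j) - L(e - e_l) / (r - l)`, `j ≤ l`. -/
def aSub' : Submodule ℝ (V →L[ℝ] V) :=
  Submodule.span ℝ (Set.range fun j : {j : Fin r // (j : ℕ) < l} => hVec c l j)

/-- The basis vector `L(c_j) - L(e - e_l) / (r - l)` of `𝔞'_l`, `j ≤ l`. -/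
def aVec' (j : {j : Fin r // (j : ℕ) < l}) : aSub' c l :=
  ⟨hVec c l j, Submodule.subset_span ⟨j, rfl⟩⟩

/-- `𝔪 = 𝔷_𝔨(𝔞)`, where `𝔨` is the Lie algebra of `K` and `𝔞` is spanned by all the `L(c_j)`. -/
def mSub : Submodule ℝ (V →L[ℝ] V) :=
  Submodule.span ℝ {X | X ∈ lieAlg (K V) ∧ ∀ j, X * L (c j) = L (c j) * X}

/-- `𝔪'_l`, the sum of `𝔪`, of the lines spanned by `L(c_j) - L(e - e_l) / (r - l)` for
`l < j ≤ r - 1`, and of the `𝔤^±_{ij}` for `l < i < j`. -/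
def mSub' : Submodule ℝ (V →L[ℝ] V) :=
  mSub c ⊔ Submodule.span ℝ {X | ∃ j : Fin r, l ≤ (j : ℕ) ∧ (j : ℕ) + 1 < r ∧ X = hVec c l j} ⊔
    ⨆ p : {p : Fin r × Fin r // l ≤ (p.1 : ℕ) ∧ p.1 < p.2},
      (gPlus c p.1.1 p.1.2 ⊔ gMinus c p.1.1 p.1.2)

/-- `𝔮'_l = 𝔪'_l ⊕ 𝔞'_l ⊕ 𝔫̄_l`. -/
def qSub' : Submodule ℝ (V →L[ℝ] V) := mSub' c l ⊔ aSub' c l ⊔ nBar c l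

variable (V) in
/-- `𝔭' = {L(x) | tr x = 0}`. -/
def pSub' : Set (V →L[ℝ] V) := {X | ∃ x : V, jtr x = 0 ∧ X = L x}

/-- `M'_l = Z_K(𝔞'_l) exp(𝔪'_l ∩ 𝔭')`. -/
def M' : Set (GLV V) :=
  {g | ∃ k ∈ centr (K V) (aSub' c l), ∃ m ∈ expSet (mSub' c l ∩ pSub' V), g = k * m}

variable (V) in
/-- `G' = {g ∈ G | Δ(g e) = 1}`, as a set. -/
def G' : Set (GLV V) := {g | g ∈ G V ∧ jdet ((g : V →L[ℝ] V) e) = 1}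

/-- The parabolic subgroup `Q'_l` of `G'` associated with `𝔮'_l`: the normaliser of `𝔮'_l` in
`G'`. -/
def Q' : Set (GLV V) := normalis (G' V) (qSub' c l)

/-- `Ind_{Q_l}^G (1 ⊗ e^ν ⊗ 1)`. -/
abbrev indG (ν : aSub c l →ₗ[ℝ] ℂ) :=
  indRep (G V) (Q c l) (expChar (M c l) (aSub c l) (NBar c l) ν)

/-- `Ind_{Q'_l}^{G'} (1 ⊗ e^μ ⊗ 1)`, where `H` is the group `G'`. -/
abbrev indG' (H : Subgroup (GLV V)) (μ : aSub' c l →ₗ[ℝ] ℂ) :=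
  indRep H (Q' c l) (expChar (M' c l) (aSub' c l) (NBar c l) μ)

/-- The character `m_ν(ζ) = ζ ^ (-rld/4 + ∑ ν_j)` of `ℝ₊`. -/
def mChar (ν : aSub c l →ₗ[ℝ] ℂ) : PosReal →* ℂ :=
  powChar (-((r : ℂ) * l * degree c / 4) + ∑ j, ν (aVec c l j))

end

end EuclideanJordanAlgebra

open EuclideanJordanAlgebra

namespace EuclideanJordanAlgebra

noncomputable section

set_option linter.unusedSectionVars false

variable {V : Type*} [NormedAddCommGroup V] [InnerProductSpace ℝ V] [FiniteDimensional ℝ V]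
  [EuclideanJordanAlgebra V]

/-! ### Linearised Jordan identities -/

/-! Positive scalars are central in `G` and belong to `Q_l`, where the character `e^ν` takes the
value `ζ ^ (∑ ν_j)`. A function in the space induced from `Q_l` is therefore determined by its
restriction to `G'`, and restriction is the required isomorphism (`restrictEquiv`) as soon as (a) `G
= G' × ℝ₊`, (b) `Q'_l = Q_l ∩ G'`, and (c) the two characters agree on `Q'_l`. The twist contributes
the rest of `m_ν`, since `Δ(ζ) = ζ ^ r`.

(a) An element of `GL(Ω)` has a polar decomposition `exp L(x) · k` with `k` an automorphism of the
Jordan algebra. Simplicity makes `k` orthogonal and `tr L(x)` equal to `n/r` times the Jordan trace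
of `x`, where `n = dim V`. Hence `Δ(g e) = |det g| ^ (r/n)` (`jdet_apply_e`), which is visibly a
continuous character; `decomp` divides `g` by the `r`-th root of its value.

(b) Put `h₀ = l c_1 + (l-1) c_2 + ⋯ + c_l` and `D = 2 L(h₀)`. On `V_{ij}` the operator `D` is the
sum of the weights of `i` and `j`, so it grades `V` by the integers from `0` to `2l`. The weights of
`c_1, …, c_l` are distinct and positive and the other weights are zero. Hence `D` alone has the same
centraliser in `G` as `𝔞_l` (`mem_ZA_iff_gradOp`), `𝔫̄_l` is the part of positive degree of the
structure algebra (`mem_nBar`), and `𝔮'_l` is the trace-zero part of nonnegative degree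
(`qSub'_eq`).

Let `g` normalise `𝔮'_l`. It normalises `𝔫̄_l`, the radical of the trace form on `𝔮'_l`
(`mem_nBar_iff_tr`). As `V` is simple, `𝔫̄_l` maps the elements of degree at least `s` onto a
spanning set of those of degree at least `s + 1` (`filt_succ_le`), so `g` preserves the filtration
by degree (`mem_shift_zero_of_conj`). Conjugating `g` by `τ ^ D` and letting `τ → 0` leaves its
degree-zero part `z`, which lies in the closed group `G` and commutes with `D`. Then `z⁻¹ g` is
unipotent, and correcting its leading term degree by degree shows that it is in `exp 𝔫̄_l`
(`mem_NBar_of_sub_one_mem_shift`). Conversely, elements of `Q_l` preserve the filtration, the trace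
and the structure algebra, hence `𝔮'_l` (`mem_Q'_iff`).

(c) For `q = m a n` one has `q c_j = exp(t_j) c_j +` terms of higher degree, where `t_j` is the
`j`-th coordinate of `log a`. This holds both for `𝔞_l` with basis `L(c_j)` and for `𝔞'_l` with
basis `h_j`, so both characters are the same function of the diagonal coefficients of `q`
(`expChar'_eq`). -/

@[simp] lemma L_apply (x y : V) : L x y = jmul x y := rfl

lemma jmul_e (x : V) : jmul x e = x := by rw [jmul_comm, e_jmul]

lemma L_e : L (e : V) = 1 := by ext x; simp [e_jmul]

/-- Polarisation: the difference of the Jordan identities at `x + y` and `x - y` keeps the terms of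
odd degree in `y`, and the cubic ones cancel by the identity at `y`. -/
lemma jordan_linearised_aux (x y w : V) :
    (2 : ℝ) • jmul x (jmul (jmul x y) w) + jmul y (jmul (jmul x x) w) =
      (2 : ℝ) • jmul (jmul x y) (jmul x w) + jmul (jmul x x) (jmul y w) := by
  have h1 := jordan (x + y) w
  have h2 := jordan (x - y) w
  have h3 := jordan y w
  have hc : jmul y x = jmul x y := jmul_comm y x
  simp only [map_add, map_sub, LinearMap.add_apply, LinearMap.sub_apply, hc] at h1 h2
  linear_combination (norm := module) (1 / 2 : ℝ) • h1 - (1 / 2 : ℝ) • h2 - h3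

lemma jordan_linearised (x y z w : V) :
    jmul x (jmul (jmul y z) w) + jmul y (jmul (jmul z x) w) + jmul z (jmul (jmul x y) w) =
      jmul (jmul y z) (jmul x w) + jmul (jmul z x) (jmul y w) + jmul (jmul x y) (jmul z w) := by
  have h1 := jordan_linearised_aux (x + z) y w
  have h2 := jordan_linearised_aux x y w
  have h3 := jordan_linearised_aux z y w
  have hc : jmul z x = jmul x z := jmul_comm z x
  have hd : jmul y z = jmul z y := jmul_comm y z
  simp only [map_add, LinearMap.add_apply, hc] at h1
  rw [hc, hd]
  linear_combination (norm := module) (1 / 2 : ℝ) • h1 - (1 / 2 : ℝ) • h2 - (1 / 2 : ℝ) • h3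

lemma L_lie_cyclic (x y z : V) :
    L x * L (jmul y z) + L y * L (jmul z x) + L z * L (jmul x y) =
      L (jmul y z) * L x + L (jmul z x) * L y + L (jmul x y) * L z := by
  ext w
  simpa using jordan_linearised x y z w

/-- The linearised identity read as an operator in `z` instead of `w`. It is the reduction rule that
expresses `L` of a triple product by products of simpler multiplication operators. -/
lemma L_jmul_jmul (w x y : V) :
    L (jmul w (jmul x y)) = L (jmul x y) * L w + L (jmul x w) * L y + L (jmul y w) * L x
      - L x * L w * L y - L y * L w * L x := by
  ext z
  have h := jordan_linearised x y z w
  simp only [sub_apply, add_apply,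
    mul_apply_eq_comp, L_apply]
  rw [jmul_comm (jmul w (jmul x y)) z, jmul_comm w (jmul x y), jmul_comm w z, jmul_comm w,
    jmul_comm w]
  rw [jmul_comm (jmul y z) (jmul x w), jmul_comm (jmul z x) (jmul y w), jmul_comm z x] at h
  linear_combination (norm := module) h

/-- Says that `[L(x), L(y)]` is a derivation; it follows by antisymmetrising the reduction rule in
`x` and `y`. -/
lemma L_bracket_bracket (x y z : V) :
    (L x * L y - L y * L x) * L z - L z * (L x * L y - L y * L x) =
      L (jmul x (jmul y z) - jmul y (jmul x z)) := by
  have h1 := L_jmul_jmul x y z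
  have h2 := L_jmul_jmul y x z
  rw [map_sub, h1, h2, jmul_comm y x, jmul_comm z x, jmul_comm z y]
  noncomm_ring

lemma inner_jmul_left (x y z : V) : ⟪jmul x y, z⟫_ℝ = ⟪y, jmul x z⟫_ℝ := symm x y z

lemma inner_jmul_right (x y z : V) : ⟪x, jmul y z⟫_ℝ = ⟪jmul x y, z⟫_ℝ := by
  rw [jmul_comm x y, inner_jmul_left]

lemma adjoint_L (x : V) : ContinuousLinearMap.adjoint (L x) = L x := by
  symm
  rw [ContinuousLinearMap.eq_adjoint_iff]
  intro y z
  exact inner_jmul_left x y z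

/-- The bilinear form `P(x, y) = L(x) L(y) + L(y) L(x) - L(xy)` attached to `P`. -/
def PP (x y : V) : V →L[ℝ] V := L x * L y + L y * L x - L (jmul x y)

lemma PP_self (x : V) : PP x x = P x := by simp [PP, P, two_smul]

lemma PP_comm (x y : V) : PP x y = PP y x := by
  simp only [PP, jmul_comm x y]; abel

lemma PP_add_left (x y z : V) : PP (x + y) z = PP x z + PP y z := by
  simp only [PP, map_add, LinearMap.add_apply]; noncomm_ring

lemma P_add (x y : V) : P (x + y) = P x + (2 : ℝ) • PP x y + P y := by
  rw [← PP_self, ← PP_self, ← PP_self, PP_add_left, PP_comm x (x + y), PP_comm y (x + y),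
    PP_add_left, PP_add_left, PP_comm y x, two_smul]; abel

lemma P_e : P (e : V) = 1 := by simp [P, L_e, e_jmul, two_smul]

lemma PP_e (x : V) : PP x e = L x := by simp [PP, L_e, jmul_e]

/-- The infinitesimal form of `P(g y) = g P(y) g*`, for `g = exp L(x)`. -/
lemma L_mul_P (x y : V) : L x * P y + P y * L x = (2 : ℝ) • PP (jmul x y) y := by
  have h1 := L_jmul_jmul x y y
  have h2 := L_jmul_jmul y x y
  have h3 := L_lie_cyclic x y y
  rw [PP, P, jmul_comm (jmul x y) y, h2]
  simp only [jmul_comm y x, two_smul, smul_add, smul_sub, mul_add, add_mul, mul_sub, sub_mul, mul_assoc] at *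
  linear_combination (norm := module) (-1 : ℝ) • h3

/-! ### Peirce decomposition with respect to an idempotent -/

/-- The polynomial `t (2t - 1)(t - 1)` annihilates `L(c)`, so its only possible eigenvalues are `0`,
`1/2` and `1`. The case `x = y = w = c` of the reduction rule gives this. -/
lemma L_cube {c : V} (hc : jmul c c = c) :
    (2 : ℝ) • (L c * L c * L c) = (3 : ℝ) • (L c * L c) - L c := by
  have h := L_jmul_jmul c c c
  simp only [hc] at h
  linear_combination (norm := module) (1 : ℝ) • h

lemma jmul_cube {c : V} (hc : jmul c c = c) (x : V) :
    (2 : ℝ) • jmul c (jmul c (jmul c x)) = (3 : ℝ) • jmul c (jmul c x) - jmul c x := by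
  simpa using congrArg (fun A : V →L[ℝ] V => A x) (L_cube hc)

lemma P_apply (c x : V) : P c x = (2 : ℝ) • jmul c (jmul c x) - jmul (jmul c c) x := by
  simp [P]

lemma jmul_P {c : V} (hc : jmul c c = c) (x : V) : jmul c (P c x) = P c x := by
  have h := jmul_cube hc x
  simp only [P_apply, hc, map_sub, map_smul]
  linear_combination (norm := module) (1 : ℝ) • h

lemma P_of_jmul_eq {c x : V} (hc : jmul c c = c) (hx : jmul c x = x) : P c x = x := by
  simp [P_apply, hc, hx, two_smul]

/-- The projection onto the Peirce space `V(c, 1/2)`. -/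
lemma jmul_half_part {c : V} (hc : jmul c c = c) (x : V) :
    jmul c (jmul c x - jmul c (jmul c x)) = (1 / 2 : ℝ) • (jmul c x - jmul c (jmul c x)) := by
  have h := jmul_cube hc x
  simp only [map_sub]
  linear_combination (norm := module) (-1 / 2 : ℝ) • h

/-- In the cyclic identity for `c, c, x` only `L(c) L(x)` and `L(x) L(c)` remain, with coefficients
2, 1 on one side and 1, 2 on the other. -/
lemma commute_L_of_one {c x : V} (hx : jmul c x = x) (hc : jmul c c = c) :
    Commute (L c) (L x) := by
  have h := L_lie_cyclic c c x
  have hx' : jmul x c = x := by rw [jmul_comm, hx]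
  rw [hx, hx', hc] at h
  show L c * L x = L x * L c
  linear_combination (norm := module) (1 : ℝ) • h

lemma commute_L_of_zero {c x : V} (hx : jmul c x = 0) (hc : jmul c c = c) :
    Commute (L c) (L x) := by
  have h := L_lie_cyclic c c x
  have hx' : jmul x c = 0 := by rw [jmul_comm, hx]
  rw [hx, hx', hc] at h
  show L c * L x = L x * L c
  simp only [map_zero, mul_zero, zero_mul, zero_add] at h
  exact h.symm

lemma jmul_left_comm_of_commute {a b : V} (h : Commute (L a) (L b)) (x : V) :
    jmul a (jmul b x) = jmul b (jmul a x) := by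
  simpa using congrArg (fun A : V →L[ℝ] V => A x) h.eq

/-- Both `L(x)` and `L(y)` commute with `L(c)`, so `c(xy)` equals `x(cy) = 0` on the one hand and
`y(cx) = xy` on the other. -/
lemma jmul_one_zero {c x y : V} (hc : jmul c c = c) (hx : jmul c x = x) (hy : jmul c y = 0) :
    jmul x y = 0 := by
  have h1 := jmul_left_comm_of_commute (commute_L_of_one hx hc) y
  have h2 := jmul_left_comm_of_commute (commute_L_of_zero hy hc) x
  rw [hy, map_zero] at h1
  rw [hx, jmul_comm y x] at h2
  rw [← h2, h1]

lemma jmul_half_half {c x y : V} (hc : jmul c c = c) (hx : jmul c x = (1 / 2 : ℝ) • x)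
    (hy : jmul c y = (1 / 2 : ℝ) • y) : jmul c (jmul c (jmul x y)) = jmul c (jmul x y) := by
  have h := congrArg (fun A : V →L[ℝ] V => A c) (L_jmul_jmul c x y)
  have hx' : jmul x c = (1 / 2 : ℝ) • x := by rw [jmul_comm, hx]
  have hy' : jmul y c = (1 / 2 : ℝ) • y := by rw [jmul_comm, hy]
  simp only [sub_apply, add_apply, mul_apply_eq_comp, L_apply, hx', hy', map_smul,
    smul_apply, hx, hy, jmul_comm y x, hc] at h
  rw [jmul_comm c (jmul c (jmul x y)), h, jmul_comm c]
  module

/-- The identity `t = (2t² - t)² + 8 (t - t²)²` holds for `t = 0, 1/2, 1`. Applied to `L(c)`, it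
writes the quadratic form as a sum of squares. -/
lemma inner_jmul_self_eq {c : V} (hc : jmul c c = c) (x : V) :
    ⟪jmul c x, x⟫_ℝ = ⟪P c x, P c x⟫_ℝ +
      8 * ⟪jmul c x - jmul c (jmul c x), jmul c x - jmul c (jmul c x)⟫_ℝ := by
  have h := jmul_cube hc x
  have h2 := congrArg (fun v => ⟪v, x⟫_ℝ) h
  have h4 := congrArg (fun v => ⟪v, jmul c x⟫_ℝ) h
  simp only [inner_sub_left, inner_smul_left, conj_trivial, inner_jmul_left c (jmul c _) x,
    inner_jmul_left c (jmul c (jmul c x)) (jmul c x)] at h2 h4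
  simp only [P_apply, hc, inner_sub_left, inner_sub_right, inner_smul_left, inner_smul_right,
    conj_trivial, real_inner_comm (jmul c (jmul c x)) (jmul c x)] at h2 h4 ⊢
  linarith

lemma inner_jmul_self_nonneg {c : V} (hc : jmul c c = c) (x : V) : 0 ≤ ⟪jmul c x, x⟫_ℝ := by
  rw [inner_jmul_self_eq hc]
  have h1 := real_inner_self_nonneg (x := P c x)
  have h2 := real_inner_self_nonneg (x := jmul c x - jmul c (jmul c x))
  linarith

lemma jmul_eq_zero_of_inner {c x : V} (hc : jmul c c = c) (h : ⟪jmul c x, x⟫_ℝ = 0) :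
    jmul c x = 0 := by
  rw [inner_jmul_self_eq hc] at h
  have h1 := real_inner_self_nonneg (x := P c x)
  have h2 := real_inner_self_nonneg (x := jmul c x - jmul c (jmul c x))
  have h3 : P c x = 0 := inner_self_eq_zero (𝕜 := ℝ).1 (by linarith)
  have h4 : jmul c x - jmul c (jmul c x) = 0 := inner_self_eq_zero (𝕜 := ℝ).1 (by linarith)
  rw [P_apply, hc] at h3
  linear_combination (norm := module) (1 : ℝ) • h3 + (2 : ℝ) • h4

lemma jmul_eq_zero_of_inner_idem {a c : V} (ha : jmul a a = a) (hc : jmul c c = c)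
    (h : ⟪a, c⟫_ℝ = 0) : jmul a c = 0 := by
  rw [jmul_comm]
  apply jmul_eq_zero_of_inner hc
  rwa [jmul_comm c a, inner_jmul_left, ha, real_inner_comm]

lemma inner_jmul_idem {a x : V} (ha : jmul a a = a) : ⟪jmul x a, a⟫_ℝ = ⟪x, a⟫_ℝ := by
  rw [jmul_comm, inner_jmul_left, ha]

/-! ### The spectral theorem -/

/-- The reduction rule with two factors `x` expresses `L(x^{n+2})` by `L(x)`, `L(x²)`, `L(x^n)` and
`L(x^{n+1})`, so commutation propagates by induction. -/
lemma commute_L_pow (x : V) (n : ℕ) :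
    Commute (L x) (L ((L x ^ n) e)) ∧ Commute (L (jmul x x)) (L ((L x ^ n) e)) := by
  have hB : Commute (L x) (L (jmul x x)) := by
    ext y; simpa using jordan x y
  -- The recursion has order two, hence two consecutive exponents are carried along.
  have key : ∀ n, (Commute (L x) (L ((L x ^ n) e)) ∧ Commute (L (jmul x x)) (L ((L x ^ n) e))) ∧
      (Commute (L x) (L ((L x ^ (n + 1)) e)) ∧
        Commute (L (jmul x x)) (L ((L x ^ (n + 1)) e))) := by
    intro n
    induction n with
    | zero =>
      simp only [pow_zero, one_apply_eq_self, zero_add, pow_one, L_apply, jmul_e, L_e]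
      exact ⟨⟨Commute.one_right _, Commute.one_right _⟩, Commute.refl _, hB.symm⟩
    | succ n ih =>
      refine ⟨ih.2, ?_⟩
      obtain ⟨⟨h1, h2⟩, h3, h4⟩ := ih
      have hx : (L x ^ (n + 1)) (e : V) = jmul x ((L x ^ n) e) := by
        rw [pow_succ']; rfl
      have hx2 : (L x ^ (n + 1 + 1)) (e : V) = jmul x (jmul x ((L x ^ n) e)) := by
        rw [pow_succ', pow_succ']; rfl
      have hL := L_jmul_jmul x x ((L x ^ n) e)
      rw [← hx2, jmul_comm ((L x ^ n) e) x, ← hx] at hL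
      rw [hL]
      have hxx := Commute.refl (L x)
      exact ⟨((((h3.mul_right hxx).add_right (hB.mul_right h1)).add_right (h3.mul_right hxx)).sub_right
        ((hxx.mul_right hxx).mul_right h1)).sub_right ((h1.mul_right hxx).mul_right hxx),
        ((((h4.mul_right hB.symm).add_right ((Commute.refl _).mul_right h2)).add_right
          (h4.mul_right hB.symm)).sub_right
        ((hB.symm.mul_right hB.symm).mul_right h2)).sub_right
          ((h2.mul_right hB.symm).mul_right hB.symm)⟩
  exact (key n).1

open Polynomial in
lemma commute_L_aeval (x : V) (p : ℝ[X]) : Commute (L x) (L (aeval (L x) p e)) := by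
  induction p using Polynomial.induction_on' with
  | add p q hp hq => simpa using hp.add_right hq
  | monomial n a =>
    have h : aeval (L x) (monomial n a) (e : V) = a • (L x ^ n) e := by
      rw [aeval_monomial, Algebra.algebraMap_eq_smul_one]; simp
    rw [h, map_smul]
    exact ((commute_L_pow x n).1).smul_right a

-- Power associativity: the vectors `p(L(x)) e` multiply like polynomials, because `L(p(L(x)) e)`
-- commutes with `L(x)` and hence with `q(L(x))`.
open Polynomial in
lemma jmul_aeval (x : V) (p q : ℝ[X]) :
    jmul (aeval (L x) p e) (aeval (L x) q e) = aeval (L x) (p * q) e := by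
  have h : Commute (aeval (L x) q) (L (aeval (L x) p e)) := by
    have := (commute_L_aeval x p)
    induction q using Polynomial.induction_on' with
    | add p q hp hq => simpa using hp.add_left hq
    | monomial n a =>
      rw [aeval_monomial]
      exact (Algebra.commute_algebraMap_left _ _).mul_left (this.pow_left n)
  rw [mul_comm p q, map_mul, mul_apply_eq_comp, ← L_apply, ← mul_apply_eq_comp, ← h.eq,
    mul_apply_eq_comp, L_apply, jmul_e]

/-- Complete systems of orthogonal idempotents. -/
structure IsCSOI {ι : Type*} [Fintype ι] (c : ι → V) : Prop where
  idem : ∀ i, jmul (c i) (c i) = c i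
  orth : ∀ i j, i ≠ j → jmul (c i) (c j) = 0
  sum : ∑ i, c i = e

open Polynomial in
/-- The spectral theorem. -/
theorem exists_spectral (x : V) : ∃ (s : Finset ℝ) (u : s → V), IsCSOI u ∧
    x = ∑ i : s, (i : ℝ) • u i ∧ ∀ i, ∃ p : ℝ[X], u i = aeval (L x) p e := by
  classical
  have hsymm : ((L x : V →L[ℝ] V) : V →ₗ[ℝ] V).IsSymmetric := fun y z => inner_jmul_left x y z
  set b := hsymm.eigenvectorBasis rfl with hb
  set μ := hsymm.eigenvalues rfl with hμ
  have hbe : ∀ i, L x (b i) = μ i • b i := fun i => by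
    exact hsymm.apply_eigenvectorBasis rfl i
  have hpow : ∀ i n, (L x ^ n) (b i) = (μ i ^ n) • b i := fun i n => by
    induction n with
    | zero => simp
    | succ n ih => rw [pow_succ', mul_apply_eq_comp, ih, map_smul, hbe, smul_smul, pow_succ]
  have haev : ∀ (p : ℝ[X]) i, aeval (L x) p (b i) = p.eval (μ i) • b i := fun p i => by
    induction p using Polynomial.induction_on' with
    | add p q hp hq => simp [hp, hq, add_smul]
    | monomial n a =>
      rw [aeval_monomial, Algebra.algebraMap_eq_smul_one]
      simp [hpow, smul_smul]
  -- The index set is the spectrum of `L(x)`, possibly larger than that of `x`; the surplus values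
  -- only produce zero idempotents. Polynomials that agree on `s` give the same operator, so the
  -- Lagrange basis gives orthogonal idempotents.
  set s : Finset ℝ := Finset.univ.image μ with hs
  have hext : ∀ p q : ℝ[X], (∀ t ∈ s, p.eval t = q.eval t) → aeval (L x) p = aeval (L x) q := by
    intro p q h
    have : ((aeval (L x) p : V →L[ℝ] V) : V →ₗ[ℝ] V) = (aeval (L x) q : V →L[ℝ] V) := by
      refine b.toBasis.ext fun i => ?_
      simp only [OrthonormalBasis.coe_toBasis, ContinuousLinearMap.coe_coe, haev]
      rw [h _ (Finset.mem_image_of_mem _ (Finset.mem_univ i))]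
    exact ContinuousLinearMap.coe_injective this
  have hself : ∀ i ∈ s, (Lagrange.basis s id i).eval i = 1 := fun i hi =>
    Lagrange.eval_basis_self (v := id) (Set.injOn_id _) hi
  have hne : ∀ i j, i ≠ j → j ∈ s → (Lagrange.basis s id i).eval j = 0 := fun i j hij hj =>
    Lagrange.eval_basis_of_ne (v := id) hij hj
  refine ⟨s, fun i => aeval (L x) (Lagrange.basis s id i) e, ⟨fun i => ?_, fun i j hij => ?_, ?_⟩,
    ?_, fun i => ⟨_, rfl⟩⟩
  · rw [jmul_aeval]
    congr 1
    apply hext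
    intro t ht
    by_cases h : (i : ℝ) = t
    · subst h; simp [hself _ ht]
    · simp [hne _ _ h ht]
  · rw [jmul_aeval, hext _ 0]
    · simp
    intro t ht
    by_cases h : (i : ℝ) = t
    · have h' : (j : ℝ) ≠ t := fun h' => hij (Subtype.ext (h.trans h'.symm))
      simp [hne _ _ h' ht]
    · simp [hne _ _ h ht]
  · have h := hext (∑ i : s, Lagrange.basis s id (i : ℝ)) 1 (fun t ht => by
      rw [eval_finsetSum, Finset.sum_eq_single ⟨t, ht⟩]
      · simp [hself t ht]
      · intro i _ hi
        exact hne _ _ (fun h => hi (Subtype.ext h)) ht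
      · simp)
    have h2 := congrArg (fun A : V →L[ℝ] V => A e) h
    simpa using h2
  · have h := hext (∑ i : s, (i : ℝ) • Lagrange.basis s id (i : ℝ)) X (fun t ht => by
      rw [eval_finsetSum, Finset.sum_eq_single ⟨t, ht⟩]
      · simp [hself t ht]
      · intro i _ hi
        simp [hne _ _ (fun h => hi (Subtype.ext h)) ht]
      · simp)
    have h2 := congrArg (fun A : V →L[ℝ] V => A e) h
    simp only [map_sum, map_smul, aeval_X, L_apply, jmul_e, sum_apply, smul_apply] at h2
    exact h2.symm

namespace IsCSOI

variable {ι : Type*} [Fintype ι] {c : ι → V}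

lemma jmul_eq (hc : IsCSOI c) [DecidableEq ι] (i j : ι) :
    jmul (c i) (c j) = if i = j then c i else 0 := by
  split_ifs with h
  · subst h; exact hc.idem i
  · exact hc.orth i j h

lemma jmul_sum (hc : IsCSOI c) (a : ι → ℝ) (i : ι) :
    jmul (c i) (∑ j, a j • c j) = a i • c i := by
  classical
  simp [map_sum, hc.jmul_eq]

lemma sum_jmul_sum (hc : IsCSOI c) (a b : ι → ℝ) :
    jmul (∑ j, a j • c j) (∑ j, b j • c j) = ∑ j, (a j * b j) • c j := by
  rw [map_sum]
  refine Finset.sum_congr rfl fun i _ => ?_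
  rw [map_smul, jmul_comm, hc.jmul_sum, smul_smul, mul_comm]

lemma commute (hc : IsCSOI c) (i j : ι) : Commute (L (c i)) (L (c j)) := by
  by_cases h : i = j
  · subst h; exact Commute.refl _
  · exact commute_L_of_zero (hc.orth i j h) (hc.idem i)

end IsCSOI

/-! ### Primitive idempotents -/

lemma IsPrimitive.eq_zero_or_eq {c p : V} (hc : IsPrimitive c) (hp : jmul p p = p)
    (hcp : jmul c p = p) : p = 0 ∨ p = c := by
  by_contra h
  push Not at h
  refine hc.2.2 ⟨p, c - p, h.1, sub_ne_zero.2 h.2.symm, hp, ?_, ?_, by abel⟩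
  · simp [hc.2.1, hp, hcp, jmul_comm p c]
  · simp [jmul_comm p c, hcp, hp]

/-- A spectral idempotent of `x` with nonzero eigenvalue is a polynomial in `L(x)` applied to a
multiple of `x`. As `L(c)` commutes with `L(x)`, it stays in `V(c, 1)`, and primitivity forces it to
be `0` or `c`. -/
lemma IsPrimitive.exists_smul {c x : V} (hc : IsPrimitive c) (hx : jmul c x = x) :
    ∃ a : ℝ, x = a • c := by
  classical
  obtain ⟨s, u, hu, hxs, hpoly⟩ := exists_spectral x
  have key : ∀ i : s, ∃ a : ℝ, (i : ℝ) • u i = a • c := by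
    intro i
    by_cases hi : (i : ℝ) = 0
    · exact ⟨0, by simp [hi]⟩
    obtain ⟨p, hp⟩ := hpoly i
    have h1 : jmul x (u i) = (i : ℝ) • u i := by
      rw [jmul_comm]; nth_rewrite 1 [hxs]; exact hu.jmul_sum _ i
    have h2 : jmul x (u i) = Polynomial.aeval (L x) p x := by
      have : Commute (L x) (Polynomial.aeval (L x) p) := by
        exact (Polynomial.commute_X p).map (Polynomial.aeval (L x)) |> fun h => by simpa using h
      have h := congrArg (fun A : V →L[ℝ] V => A e) this.eq
      simpa [← hp, jmul_e] using h
    have h3 : Commute (L c) (Polynomial.aeval (L x) p) :=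
      Polynomial.induction_on' p (fun p q hp hq => by simpa using hp.add_right hq) (fun n a => by
        rw [Polynomial.aeval_monomial]
        exact (Algebra.commute_algebraMap_right _ _).mul_right
          ((commute_L_of_one hx hc.2.1).pow_right n))
    have h4 : jmul c (jmul x (u i)) = jmul x (u i) := by
      have h := congrArg (fun A : V →L[ℝ] V => A x) h3.eq
      simp only [mul_apply_eq_comp, L_apply, hx] at h
      rw [h2, h]
    rw [h1, map_smul] at h4
    have h5 : jmul c (u i) = u i := smul_right_injective V hi h4
    rcases hc.eq_zero_or_eq (hu.idem i) h5 with h | h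
    · exact ⟨0, by simp [h]⟩
    · exact ⟨i, by rw [h]⟩
  choose a ha using key
  exact ⟨∑ i, a i, by rw [Finset.sum_smul, ← Finset.sum_congr rfl fun i _ => ha i]; exact hxs⟩

/-- Induction on a bound for `dim V(c, 1)`: if `c = a + b` splits, then `V(a, 1)` is a proper
subspace of `V(c, 1)` because it misses `b`, and symmetrically. -/
lemma exists_primitive_decomposition (n : ℕ) : ∀ c : V, jmul c c = c →
    Module.finrank ℝ (Module.End.eigenspace (jmul c) (1 : ℝ)) ≤ n →
    ∃ s : Finset V, (∀ p ∈ s, IsPrimitive p ∧ jmul c p = p) ∧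
      (∀ p ∈ s, ∀ q ∈ s, p ≠ q → jmul p q = 0) ∧ ∑ p ∈ s, p = c := by
  classical
  induction n with
  | zero =>
    intro c hc hn
    have h0 : c = 0 := by
      have h1 := Submodule.finrank_eq_zero.1 (Nat.le_zero.1 hn)
      have h2 : c ∈ Module.End.eigenspace (jmul c) (1 : ℝ) := by
        simp [hc]
      simpa [h1] using h2
    exact ⟨∅, by simp, by simp, by simp [h0]⟩
  | succ n ih =>
    intro c hc hn
    by_cases h0 : c = 0
    · exact ⟨∅, by simp, by simp, by simp [h0]⟩
    by_cases hp : IsPrimitive c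
    · exact ⟨{c}, by simp [hp, hc], by simp, by simp⟩
    have : ∃ a b : V, a ≠ 0 ∧ b ≠ 0 ∧ jmul a a = a ∧ jmul b b = b ∧ jmul a b = 0 ∧ c = a + b := by
      by_contra h; exact hp ⟨h0, hc, h⟩
    obtain ⟨a, b, ha0, hb0, ha, hb, hab, rfl⟩ := this
    have hba : jmul b a = 0 := by rw [jmul_comm, hab]
    have step : ∀ a b : V, b ≠ 0 → jmul a a = a → jmul b b = b → jmul a b = 0 →
        Module.finrank ℝ (Module.End.eigenspace (jmul (a + b)) (1 : ℝ)) ≤ n + 1 →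
        (∀ v, jmul a v = v → jmul (a + b) v = v) ∧
        Module.finrank ℝ (Module.End.eigenspace (jmul a) (1 : ℝ)) ≤ n := by
      intro a b hb0 ha hb hab hn
      have h1 : ∀ v, jmul a v = v → jmul (a + b) v = v := fun v hv => by
        have := jmul_one_zero ha hv hab
        rw [map_add, LinearMap.add_apply, hv, jmul_comm b v, this, add_zero]
      refine ⟨h1, Nat.le_of_lt_succ (lt_of_lt_of_le (Submodule.finrank_lt_finrank_of_lt ?_) hn)⟩
      refine lt_of_le_of_ne (fun v hv => ?_) fun h => ?_
      · simp only [Module.End.mem_eigenspace_iff, one_smul] at hv ⊢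
        exact h1 v hv
      · have h2 : b ∈ Module.End.eigenspace (jmul (a + b)) (1 : ℝ) := by
          simp [hab, hb]
        rw [← h] at h2
        simp only [Module.End.mem_eigenspace_iff, one_smul, hab] at h2
        exact hb0 h2.symm
    obtain ⟨h1, h2⟩ := step a b hb0 ha hb hab hn
    obtain ⟨h3, h4⟩ := step b a ha0 hb ha hba (by rwa [add_comm])
    obtain ⟨s, hs1, hs2, hs3⟩ := ih a ha h2
    obtain ⟨t, ht1, ht2, ht3⟩ := ih b hb h4
    have hst : ∀ p ∈ s, ∀ q ∈ t, jmul p q = 0 := fun p hp q hq => by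
      have h5 : jmul a q = 0 := by
        rw [jmul_comm]; exact jmul_one_zero hb (ht1 q hq).2 hba
      exact jmul_one_zero ha (hs1 p hp).2 h5
    have hdisj : Disjoint s t := Finset.disjoint_left.2 fun p hp hq => by
      have := hst p hp p hq
      rw [(hs1 p hp).1.2.1] at this
      exact (hs1 p hp).1.1 this
    refine ⟨s ∪ t, fun p hp => ?_, fun p hp q hq hpq => ?_, ?_⟩
    · rcases Finset.mem_union.1 hp with hp | hp
      · exact ⟨(hs1 p hp).1, h1 p (hs1 p hp).2⟩
      · exact ⟨(ht1 p hp).1, by rw [add_comm]; exact h3 p (ht1 p hp).2⟩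
    · rcases Finset.mem_union.1 hp with hp | hp <;> rcases Finset.mem_union.1 hq with hq | hq
      · exact hs2 p hp q hq hpq
      · exact hst p hp q hq
      · rw [jmul_comm]; exact hst q hq p hp
      · exact ht2 p hp q hq hpq
    · rw [Finset.sum_union hdisj, hs3, ht3]

/-- Every element is a combination of the elements of a Jordan frame. -/
lemma exists_frame (x : V) : ∃ (n : ℕ) (u : Fin n → V) (ev : Fin n → ℝ),
    IsJordanFrame u ∧ x = ∑ j, ev j • u j := by
  classical
  obtain ⟨s, u, hu, hxs, -⟩ := exists_spectral x
  choose S hS1 hS2 hS3 using fun i => exists_primitive_decomposition _ (u i) (hu.idem i) le_rfl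
  have hdiff : ∀ i j, i ≠ j → ∀ p ∈ S i, ∀ q ∈ S j, jmul p q = 0 := by
    intro i j hij p hp q hq
    have h5 : jmul (u i) q = 0 := by
      rw [jmul_comm]; exact jmul_one_zero (hu.idem j) (hS1 j q hq).2 (hu.orth j i hij.symm)
    exact jmul_one_zero (hu.idem i) (hS1 i p hp).2 h5
  have hdisj : ((Finset.univ : Finset s) : Set s).PairwiseDisjoint S := by
    intro i _ j _ hij
    refine Finset.disjoint_left.2 fun p hp hq => ?_
    have := hdiff i j hij p hp p hq
    rw [(hS1 i p hp).1.2.1] at this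
    exact (hS1 i p hp).1.1 this
  set F := Finset.univ.biUnion S with hF
  have hFmem : ∀ p ∈ F, ∃ i, p ∈ S i := fun p hp => by simpa [hF] using hp
  have hxp : ∀ i, ∀ p ∈ S i, jmul x p = (i : ℝ) • p := by
    intro i p hp
    rw [← (hS1 i p hp).2, hxs, map_sum, LinearMap.sum_apply, Finset.sum_eq_single i]
    · rw [map_smul, LinearMap.smul_apply, (hS1 i p hp).2, (hS1 i p hp).2]
    · intro j _ hj
      rw [map_smul, LinearMap.smul_apply, (hS1 i p hp).2, jmul_comm,
        jmul_one_zero (hu.idem i) (hS1 i p hp).2 (hu.orth i j hj.symm), smul_zero]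
    · simp
  -- The eigenvalue is written as a Rayleigh quotient so that it depends on `p` only, not on the set
  -- `S i` that contains it; this allows the reindexing by `Fin n`.
  have hev : ∀ i, ∀ p ∈ S i, ⟪jmul x p, p⟫_ℝ / ⟪p, p⟫_ℝ = i := by
    intro i p hp
    rw [hxp i p hp, inner_smul_left, conj_trivial, mul_div_assoc, div_self, mul_one]
    exact inner_self_ne_zero.2 (hS1 i p hp).1.1
  refine ⟨F.card, fun k => (F.equivFin.symm k : V), fun k =>
    ⟪jmul x (F.equivFin.symm k : V), (F.equivFin.symm k : V)⟫_ℝ /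
      ⟪(F.equivFin.symm k : V), (F.equivFin.symm k : V)⟫_ℝ, ⟨fun k => ?_, fun k m hkm => ?_, ?_⟩, ?_⟩
  · obtain ⟨i, hi⟩ := hFmem _ (F.equivFin.symm k).2
    exact (hS1 i _ hi).1
  · obtain ⟨i, hi⟩ := hFmem _ (F.equivFin.symm k).2
    obtain ⟨j, hj⟩ := hFmem _ (F.equivFin.symm m).2
    have hne : (F.equivFin.symm k : V) ≠ (F.equivFin.symm m : V) := fun h =>
      hkm (F.equivFin.symm.injective (Subtype.ext h))
    by_cases hij : i = j
    · subst hij; exact hS2 i _ hi _ hj hne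
    · exact hdiff i j hij _ hi _ hj
  · rw [Equiv.sum_comp F.equivFin.symm (fun p : F => (p : V)), Finset.sum_coe_sort F (fun p => p),
      hF, Finset.sum_biUnion hdisj]
    simp only [hS3]
    exact hu.sum
  · rw [Equiv.sum_comp F.equivFin.symm
      (fun p : F => (⟪jmul x (p : V), (p : V)⟫_ℝ / ⟪(p : V), (p : V)⟫_ℝ) • (p : V)),
      Finset.sum_coe_sort F (fun p => (⟪jmul x p, p⟫_ℝ / ⟪p, p⟫_ℝ) • p), hF,
      Finset.sum_biUnion hdisj]
    nth_rewrite 1 [hxs]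
    refine Finset.sum_congr rfl fun i _ => ?_
    rw [Finset.sum_congr rfl fun p hp => by rw [hev i p hp], ← Finset.smul_sum, hS3]

lemma IsJordanFrame.isCSOI {n : ℕ} {u : Fin n → V} (hu : IsJordanFrame u) : IsCSOI u :=
  ⟨fun i => (hu.1 i).2.1, hu.2.1, hu.2.2⟩

/-! ### Exponentials -/

lemma exp_add_of_commute' {X Y : V →L[ℝ] V} (h : Commute X Y) :
    NormedSpace.exp (X + Y) = NormedSpace.exp X * NormedSpace.exp Y :=
  letI : NormedAlgebra ℚ (V →L[ℝ] V) := NormedAlgebra.restrictScalars ℚ ℝ (V →L[ℝ] V)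
  NormedSpace.exp_add_of_commute h

lemma exp_mul_exp_neg (X : V →L[ℝ] V) : NormedSpace.exp X * NormedSpace.exp (-X) = 1 := by
  rw [← exp_add_of_commute' (Commute.refl X).neg_right, add_neg_cancel, NormedSpace.exp_zero]

lemma exp_neg_mul_exp (X : V →L[ℝ] V) : NormedSpace.exp (-X) * NormedSpace.exp X = 1 := by
  rw [← exp_add_of_commute' (Commute.refl X).neg_left, neg_add_cancel, NormedSpace.exp_zero]

/-- The exponential as an element of `GL(V)`. -/
def expU (X : V →L[ℝ] V) : GLV V where
  val := NormedSpace.exp X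
  inv := NormedSpace.exp (-X)
  val_inv := exp_mul_exp_neg X
  inv_val := exp_neg_mul_exp X

@[simp] lemma coe_expU (X : V →L[ℝ] V) : (expU X : V →L[ℝ] V) = NormedSpace.exp X := rfl

lemma coe_expU_inv (X : V →L[ℝ] V) :
    (((expU X)⁻¹ : GLV V) : V →L[ℝ] V) = NormedSpace.exp (-X) := rfl

lemma exp_apply_eigenvector {X : V →L[ℝ] V} {v : V} {a : ℝ} (h : X v = a • v) :
    NormedSpace.exp X v = Real.exp a • v := by
  have h1 := (NormedSpace.exp_series_hasSum_exp' (𝕂 := ℝ) X).mapL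
    (ContinuousLinearMap.apply ℝ V v)
  have h2 := (NormedSpace.exp_series_hasSum_exp' (𝕂 := ℝ) a).smul_const v
  have hpow : ∀ n : ℕ, (X ^ n) v = a ^ n • v := fun n => by
    induction n with
    | zero => simp
    | succ n ih => rw [pow_succ', mul_apply_eq_comp, ih, map_smul, h, smul_smul, pow_succ]
  rw [← Real.exp_eq_exp_ℝ] at h2
  refine h1.unique ?_
  convert h2 using 2 with n
  simp [hpow, smul_smul]

lemma exp_apply_fixed {X : V →L[ℝ] V} {v : V} (h : X v = 0) : NormedSpace.exp X v = v := by
  simpa using exp_apply_eigenvector (X := X) (v := v) (a := 0) (by simpa using h)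

lemma adjoint_exp (X : V →L[ℝ] V) : ContinuousLinearMap.adjoint (NormedSpace.exp X) =
    NormedSpace.exp (ContinuousLinearMap.adjoint X) := by
  have := NormedSpace.star_exp (𝔸 := V →L[ℝ] V) X
  simpa [ContinuousLinearMap.star_eq_adjoint] using this

/-! ### The structure algebra and its exponentials. -/

/-- The infinitesimal condition characterising the structure algebra. -/
def IsStr (X : V →L[ℝ] V) : Prop :=
  ∀ y, X * P y + P y * ContinuousLinearMap.adjoint X = (2 : ℝ) • PP (X y) y

lemma isStr_L (x : V) : IsStr (L x) := fun y => by rw [adjoint_L]; exact L_mul_P x y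

lemma PP_smul_left (a : ℝ) (x y : V) : PP (a • x) y = a • PP x y := by
  simp [PP, smul_sub]

variable (V) in
/-- The structure algebra. -/
def strAlg : Submodule ℝ (V →L[ℝ] V) where
  carrier := {X | IsStr X}
  add_mem' {X Y} hX hY y := by
    have h1 := hX y
    have h2 := hY y
    rw [add_apply, PP_add_left, smul_add, ← h1, ← h2, map_add]
    noncomm_ring
  zero_mem' y := by
    have : PP (0 : V) y = 0 := by simp [PP]
    simp [this]
  smul_mem' a X hX y := by
    have h1 := hX y
    rw [smul_apply, PP_smul_left, smul_comm, ← h1, map_smulₛₗ]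
    simp

lemma hasDerivAt_L {z : ℝ → V} {z' : V} {t : ℝ} (h : HasDerivAt z z' t) :
    HasDerivAt (fun s => L (z s)) (L z') t :=
  ((LinearMap.toContinuousLinearMap (L : V →ₗ[ℝ] V →L[ℝ] V)).hasFDerivAt.comp_hasDerivAt t h)

lemma hasDerivAt_P {z : ℝ → V} {z' : V} {t : ℝ} (h : HasDerivAt z z' t) :
    HasDerivAt (fun s => P (z s)) ((2 : ℝ) • PP z' (z t)) t := by
  have h1 := hasDerivAt_L h
  have h2 := hasDerivAt_L (h1.clm_apply h)
  have h3 := ((h1.mul h1).const_smul (2 : ℝ)).sub h2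
  refine HasDerivAt.congr_deriv h3 ?_
  simp only [PP,  L_apply, jmul_comm (z t) z', map_add]
  module

/-- The defining condition of the structure algebra says exactly that `exp(-tX) P(exp(tX) y)
exp(-tX*)` has zero derivative in `t`. -/
lemma IsStr.P_exp {X : V →L[ℝ] V} (hX : IsStr X) (y : V) :
    P (NormedSpace.exp X y) = NormedSpace.exp X * P y *
      ContinuousLinearMap.adjoint (NormedSpace.exp X) := by
  set X' := ContinuousLinearMap.adjoint X with hX'
  have hd : ∀ t : ℝ, HasDerivAt (fun t : ℝ => NormedSpace.exp (t • -X) *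
      P (NormedSpace.exp (t • X) y) * NormedSpace.exp (t • -X')) 0 t := by
    intro t
    have h1 := hasDerivAt_exp_smul_const (𝕂 := ℝ) (-X) t
    have h2 := hasDerivAt_exp_smul_const' (𝕂 := ℝ) (-X') t
    have h3 := (hasDerivAt_exp_smul_const' (𝕂 := ℝ) X t).clm_apply (hasDerivAt_const t y)
    have h4 := hasDerivAt_P h3
    have h5 := (h1.mul h4).mul h2
    refine HasDerivAt.congr_deriv h5 ?_
    have h6 := hX (NormedSpace.exp (t • X) y)
    simp only [map_zero, add_zero, mul_apply_eq_comp]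
    rw [← h6]
    show _ + NormedSpace.exp (t • -X) * P (NormedSpace.exp (t • X) y) * _ = _
    noncomm_ring
  have hc := is_const_of_deriv_eq_zero (fun t => (hd t).differentiableAt) (fun t => (hd t).deriv) 1 0
  simp only [one_smul, zero_smul, NormedSpace.exp_zero, one_mul, mul_one,
    one_apply_eq_self] at hc
  rw [adjoint_exp, ← hX', ← hc, ← mul_assoc, ← mul_assoc, exp_mul_exp_neg, one_mul, mul_assoc,
    exp_neg_mul_exp, mul_one]

/-! ### The order and the symmetric cone -/

/-- Elements with positive semidefinite multiplication operator. -/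
def Nonneg (x : V) : Prop := ∀ v, 0 ≤ ⟪jmul x v, v⟫_ℝ

/-- Elements with positive definite multiplication operator. -/
def IsPos (x : V) : Prop := ∀ v, v ≠ 0 → 0 < ⟪jmul x v, v⟫_ℝ

lemma inner_sum_jmul {n : ℕ} (u : Fin n → V) (ev : Fin n → ℝ) (v : V) :
    ⟪jmul (∑ j, ev j • u j) v, v⟫_ℝ = ∑ j, ev j * ⟪jmul (u j) v, v⟫_ℝ := by
  simp [map_sum, LinearMap.sum_apply, sum_inner, inner_smul_left]

namespace IsJordanFrame

variable {n : ℕ} {u : Fin n → V}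

lemma inner_pos (hu : IsJordanFrame u) (i : Fin n) : 0 < ⟪u i, u i⟫_ℝ :=
  real_inner_self_pos.2 (hu.1 i).1

lemma inner_sum_self (hu : IsJordanFrame u) (ev : Fin n → ℝ) (i : Fin n) :
    ⟪jmul (∑ j, ev j • u j) (u i), u i⟫_ℝ = ev i * ⟪u i, u i⟫_ℝ := by
  rw [jmul_comm, hu.isCSOI.jmul_sum, inner_smul_left, conj_trivial]

lemma nonneg_iff (hu : IsJordanFrame u) (ev : Fin n → ℝ) :
    Nonneg (∑ j, ev j • u j) ↔ ∀ i, 0 ≤ ev i := by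
  refine ⟨fun h i => ?_, fun h v => ?_⟩
  · have := h (u i)
    rw [hu.inner_sum_self] at this
    exact nonneg_of_mul_nonneg_left this (hu.inner_pos i)
  · rw [inner_sum_jmul]
    exact Finset.sum_nonneg fun i _ => mul_nonneg (h i)
      (inner_jmul_self_nonneg (hu.1 i).2.1 v)

lemma isPos_iff (hu : IsJordanFrame u) (ev : Fin n → ℝ) :
    IsPos (∑ j, ev j • u j) ↔ ∀ i, 0 < ev i := by
  refine ⟨fun h i => ?_, fun h v hv => ?_⟩
  · have := h (u i) (hu.1 i).1
    rw [hu.inner_sum_self] at this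
    exact pos_of_mul_pos_left this (hu.inner_pos i).le
  · rw [inner_sum_jmul]
    refine lt_of_le_of_ne (Finset.sum_nonneg fun i _ => mul_nonneg (h i).le
      (inner_jmul_self_nonneg (hu.1 i).2.1 v)) fun h0 => hv ?_
    have h1 := (Finset.sum_eq_zero_iff_of_nonneg (fun i _ => mul_nonneg (h i).le
      (inner_jmul_self_nonneg (hu.1 i).2.1 v))).1 h0.symm
    rw [← e_jmul v, ← hu.2.2, map_sum, LinearMap.sum_apply]
    refine Finset.sum_eq_zero fun i hi => jmul_eq_zero_of_inner (hu.1 i).2.1 ?_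
    exact (mul_eq_zero.1 (h1 i hi)).resolve_left (h i).ne'

lemma exp_sum (hu : IsJordanFrame u) (ev : Fin n → ℝ) :
    NormedSpace.exp (L (∑ j, ev j • u j)) e = ∑ j, Real.exp (ev j) • u j := by
  nth_rewrite 1 [← hu.2.2]
  rw [map_sum]
  refine Finset.sum_congr rfl fun i _ => exp_apply_eigenvector ?_
  rw [L_apply, jmul_comm, hu.isCSOI.jmul_sum]

end IsJordanFrame

lemma isUnit_P_exp {X : V →L[ℝ] V} (hX : IsStr X) {y : V} (hy : IsUnit (P y)) :
    IsUnit (P (NormedSpace.exp X y)) := by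
  rw [hX.P_exp, adjoint_exp]
  exact ((expU X).isUnit.mul hy).mul (expU _).isUnit

lemma IsPos.nonneg {x : V} (h : IsPos x) : Nonneg x := fun v => by
  by_cases hv : v = 0
  · simp [hv]
  · exact (h v hv).le

lemma IsPos.exists_log {y : V} (hy : IsPos y) : ∃ x : V, y = NormedSpace.exp (L x) e := by
  obtain ⟨n, u, ev, hu, rfl⟩ := exists_frame y
  have h := (hu.isPos_iff ev).1 hy
  refine ⟨∑ j, Real.log (ev j) • u j, ?_⟩
  rw [hu.exp_sum]
  simp [Real.exp_log (h _)]

lemma IsPos.isUnit {y : V} (hy : IsPos y) : IsUnit (P y) := by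
  obtain ⟨x, rfl⟩ := hy.exists_log
  exact isUnit_P_exp (isStr_L x) (by rw [P_e]; exact isUnit_one)

/-- If an eigenvalue of `y` vanished, `P(y)` would annihilate the corresponding idempotent. -/
lemma Nonneg.isPos {y : V} (hy : Nonneg y) (h : IsUnit (P y)) : IsPos y := by
  obtain ⟨n, u, ev, hu, rfl⟩ := exists_frame y
  have h0 := (hu.nonneg_iff ev).1 hy
  refine (hu.isPos_iff ev).2 fun i => lt_of_le_of_ne (h0 i) fun hi => (hu.1 i).1 ?_
  have h1 : P (∑ j, ev j • u j) (u i) = 0 := by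
    rw [P_apply, hu.isCSOI.sum_jmul_sum, jmul_comm _ (u i), hu.isCSOI.jmul_sum, ← hi,
      jmul_comm _ (u i), hu.isCSOI.jmul_sum, ← hi]
    simp
  obtain ⟨U, hU⟩ := h
  have h2 := congrArg (fun A : V →L[ℝ] V => A (u i)) U.inv_mul
  simpa [hU, h1] using h2.symm

lemma nonneg_sq (x : V) : Nonneg (jmul x x) := by
  obtain ⟨n, u, ev, hu, rfl⟩ := exists_frame x
  rw [hu.isCSOI.sum_jmul_sum, hu.nonneg_iff]
  exact fun i => mul_self_nonneg _

/-- Squares have nonnegative eigenvalues, invertibility of `P` excludes zero, and positive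
eigenvalues have square roots. From here on the cone is handled through the quadratic form of
`L(y)`. -/
lemma mem_cone_iff {y : V} : y ∈ cone V ↔ IsPos y := by
  refine ⟨fun ⟨⟨x, hx⟩, h⟩ => (hx ▸ nonneg_sq x : Nonneg y).isPos h, fun h => ⟨?_, h.isUnit⟩⟩
  obtain ⟨n, u, ev, hu, rfl⟩ := exists_frame y
  have h1 := (hu.isPos_iff ev).1 h
  refine ⟨∑ j, Real.sqrt (ev j) • u j, ?_⟩
  rw [hu.isCSOI.sum_jmul_sum]
  simp [Real.mul_self_sqrt (h1 _).le]

lemma Nonneg.add_isPos {x y : V} (hx : Nonneg x) (hy : IsPos y) : IsPos (x + y) := fun v hv => by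
  rw [map_add, LinearMap.add_apply, inner_add_left]; exact add_pos_of_nonneg_of_pos (hx v) (hy v hv)

lemma IsPos.smul {x : V} (hx : IsPos x) {a : ℝ} (ha : 0 < a) : IsPos (a • x) := fun v hv => by
  rw [map_smul, LinearMap.smul_apply, inner_smul_left]; exact mul_pos ha (hx v hv)

lemma isPos_e : IsPos (e : V) := fun v hv => by rw [e_jmul]; exact real_inner_self_pos.2 hv

lemma nonneg_idem {c : V} (hc : jmul c c = c) : Nonneg c := inner_jmul_self_nonneg hc

/-- The closed cone is contained in its dual. -/
lemma Nonneg.inner_nonneg {x y : V} (hx : Nonneg x) (hy : Nonneg y) : 0 ≤ ⟪x, y⟫_ℝ := by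
  obtain ⟨n, u, ev, hu, rfl⟩ := exists_frame x
  rw [sum_inner]
  refine Finset.sum_nonneg fun i _ => ?_
  rw [inner_smul_left, real_inner_comm, ← inner_jmul_idem (hu.1 i).2.1]
  exact mul_nonneg ((hu.nonneg_iff ev).1 hx i) (hy _)

lemma Nonneg.eq_zero {x : V} (hx : Nonneg x) (h : ⟪x, e⟫_ℝ = 0) : x = 0 := by
  obtain ⟨n, u, ev, hu, rfl⟩ := exists_frame x
  have h0 := (hu.nonneg_iff ev).1 hx
  have h1 : ∀ i, ⟪ev i • u i, e⟫_ℝ = ev i * ⟪u i, u i⟫_ℝ := fun i => by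
    rw [inner_smul_left, ← (hu.1 i).2.1, inner_jmul_left, jmul_e, (hu.1 i).2.1, conj_trivial]
  rw [sum_inner, Finset.sum_congr rfl fun i _ => h1 i] at h
  have h2 := (Finset.sum_eq_zero_iff_of_nonneg
    (fun i _ => mul_nonneg (h0 i) (hu.inner_pos i).le)).1 h
  refine Finset.sum_eq_zero fun i hi => ?_
  rw [(mul_eq_zero.1 (h2 i hi)).resolve_right (hu.inner_pos i).ne', zero_smul]

lemma continuous_L : Continuous (L : V → V →L[ℝ] V) :=
  (L : V →ₗ[ℝ] V →L[ℝ] V).continuous_of_finiteDimensional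

lemma isClosed_nonneg : IsClosed {x : V | Nonneg x} := by
  simp only [Nonneg, Set.ofPred_forall]
  refine isClosed_iInter fun v => isClosed_le continuous_const ?_
  exact ((continuous_L.clm_apply continuous_const).inner continuous_const)

lemma IsPos.exists_sub_nonneg {y : V} (hy : IsPos y) : ∃ ε : ℝ, 0 < ε ∧ Nonneg (y - ε • e) := by
  obtain ⟨n, u, ev, hu, rfl⟩ := exists_frame y
  have h := (hu.isPos_iff ev).1 hy
  obtain ⟨ε, hε, hle⟩ : ∃ ε : ℝ, 0 < ε ∧ ∀ i, ε ≤ ev i := by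
    rcases isEmpty_or_nonempty (Fin n) with hn | hn
    · exact ⟨1, one_pos, fun i => hn.elim i⟩
    · obtain ⟨i, hi⟩ := Finite.exists_min ev
      exact ⟨ev i, h i, hi⟩
  refine ⟨ε, hε, ?_⟩
  rw [← hu.2.2, Finset.smul_sum, ← Finset.sum_sub_distrib]
  simp only [← sub_smul]
  rw [hu.nonneg_iff]
  exact fun i => sub_nonneg.2 (hle i)

/-- If `L(y) ≥ ε`, then `L(z)` is still positive definite when `‖L(z) - L(y)‖ < ε`. -/
lemma isOpen_isPos : IsOpen {x : V | IsPos x} := by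
  rw [Metric.isOpen_iff]
  intro y hy
  obtain ⟨ε, hε, h⟩ := IsPos.exists_sub_nonneg hy
  obtain ⟨δ, hδ, hc⟩ := Metric.continuous_iff.1 (continuous_L (V := V)) y ε hε
  refine ⟨δ, hδ, fun z hz v hv => ?_⟩
  have h1 : ‖L z - L y‖ < ε := by rw [← dist_eq_norm]; exact hc z hz
  have h2 := h v
  have h3 : |⟪(L z - L y) v, v⟫_ℝ| ≤ ‖L z - L y‖ * (‖v‖ * ‖v‖) := by
    refine (abs_real_inner_le_norm _ _).trans ?_
    rw [← mul_assoc]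
    exact mul_le_mul_of_nonneg_right (ContinuousLinearMap.le_opNorm _ _) (norm_nonneg _)
  have hv' : 0 < ‖v‖ * ‖v‖ := mul_pos (norm_pos_iff.2 hv) (norm_pos_iff.2 hv)
  rw [map_sub, LinearMap.sub_apply, map_smul, LinearMap.smul_apply, e_jmul, inner_sub_left,
    inner_smul_left, conj_trivial, real_inner_self_eq_norm_mul_norm] at h2
  rw [sub_apply, L_apply, L_apply, inner_sub_left] at h3
  have h4 := neg_le_of_abs_le h3
  nlinarith

/-- Along `exp(tX) y` the operator `P` stays invertible, so there positive and nonnegative are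
equivalent. The set of good `t` is open and closed and contains `0`. -/
lemma isPos_exp {X : V →L[ℝ] V} (hX : IsStr X) {y : V} (hy : IsPos y) :
    IsPos (NormedSpace.exp X y) := by
  have hcont : Continuous fun t : ℝ => NormedSpace.exp (t • X) y :=
    (continuous_iff_continuousAt.2 fun t => (hasDerivAt_exp_smul_const (𝕂 := ℝ) X t).continuousAt).clm_apply
      continuous_const
  have hun : ∀ t : ℝ, IsUnit (P (NormedSpace.exp (t • X) y)) := fun t =>
    isUnit_P_exp ((strAlg V).smul_mem t hX) hy.isUnit
  have hcl : IsClopen {t : ℝ | IsPos (NormedSpace.exp (t • X) y)} := by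
    refine ⟨?_, isOpen_isPos.preimage hcont⟩
    have : {t : ℝ | IsPos (NormedSpace.exp (t • X) y)} =
        {t : ℝ | Nonneg (NormedSpace.exp (t • X) y)} := by
      ext t; exact ⟨fun h => h.nonneg, fun h => h.isPos (hun t)⟩
    rw [this]
    exact isClosed_nonneg.preimage hcont
  have := hcl.eq_univ ⟨0, by simpa [NormedSpace.exp_zero] using hy⟩
  have h1 : (1 : ℝ) ∈ {t : ℝ | IsPos (NormedSpace.exp (t • X) y)} := by rw [this]; trivial
  simpa using h1

/-! ### The group of the cone and its identity component. -/

lemma mem_GLcone_iff {g : GLV V} : g ∈ GLcone V ↔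
    (∀ y, IsPos y → IsPos ((g : V →L[ℝ] V) y)) ∧
    (∀ y, IsPos y → IsPos (((g⁻¹ : GLV V) : V →L[ℝ] V) y)) := by
  have hi : ∀ g : GLV V, g ∈ GLcone V → ∀ y, IsPos y → IsPos ((g : V →L[ℝ] V) y) := by
    intro g hg y hy
    rw [← mem_cone_iff] at hy ⊢
    have h : (fun x => (g : V →L[ℝ] V) x) '' cone V = cone V := hg
    rw [← h]
    exact ⟨y, hy, rfl⟩
  refine ⟨fun h => ⟨hi g h, hi _ (inv_mem h)⟩, fun ⟨h1, h2⟩ => ?_⟩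
  show (fun x => (g : V →L[ℝ] V) x) '' cone V = cone V
  ext y
  constructor
  · rintro ⟨x, hx, rfl⟩
    exact mem_cone_iff.2 (h1 x (mem_cone_iff.1 hx))
  · intro hy
    refine ⟨((g⁻¹ : GLV V) : V →L[ℝ] V) y, mem_cone_iff.2 (h2 y (mem_cone_iff.1 hy)), ?_⟩
    show ((g : V →L[ℝ] V) * ((g⁻¹ : GLV V) : V →L[ℝ] V)) y = y
    simp

lemma expU_mem_GLcone {X : V →L[ℝ] V} (hX : IsStr X) : expU X ∈ GLcone V :=
  mem_GLcone_iff.2 ⟨fun _ hy => isPos_exp hX hy, fun _ hy =>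
    isPos_exp ((strAlg V).neg_mem hX) hy⟩

lemma continuous_exp_smul (X : V →L[ℝ] V) : Continuous fun t : ℝ => NormedSpace.exp (t • X) :=
  continuous_iff_continuousAt.2 fun t => (hasDerivAt_exp_smul_const (𝕂 := ℝ) X t).continuousAt

lemma continuous_expU (X : V →L[ℝ] V) : Continuous fun t : ℝ => expU (t • X) := by
  refine Units.continuous_iff.2 ⟨continuous_exp_smul X, ?_⟩
  have := (continuous_exp_smul (-X))
  simpa [Function.comp_def, coe_expU_inv] using this

lemma G_le : G V ≤ GLcone V := by
  rintro g ⟨h, -, rfl⟩; exact h.2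

lemma expU_mem_G {X : V →L[ℝ] V} (hX : IsStr X) : expU X ∈ G V := by
  refine ⟨⟨expU X, expU_mem_GLcone hX⟩, ?_, rfl⟩
  have hc : Continuous fun t : ℝ => (⟨expU (t • X), expU_mem_GLcone ((strAlg V).smul_mem t hX)⟩ :
      GLcone V) := (continuous_expU X).subtype_mk _
  have h1 := (isPreconnected_univ.image _ hc.continuousOn).subset_connectedComponent
    (x := 1) ⟨0, trivial, by ext1; ext1; simp [NormedSpace.exp_zero]⟩
  exact h1 ⟨1, trivial, by ext1; simp⟩

/-- With `w = g⁻¹ e` and small `ε`, the vector `y - (ε/2) w` is still positive, so `g y` is a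
nonnegative element plus `(ε/2) e`. Thus stability of the open cone can be tested by closed
conditions, which makes `GL(Ω)` closed in `GL(V)`. -/
lemma isPos_of_forall_nonneg {g : GLV V}
    (h : ∀ y, IsPos y → Nonneg ((g : V →L[ℝ] V) y)) {y : V} (hy : IsPos y) :
    IsPos ((g : V →L[ℝ] V) y) := by
  set w : V := ((g⁻¹ : GLV V) : V →L[ℝ] V) e with hw
  have hgw : (g : V →L[ℝ] V) w = e := by
    show ((g : V →L[ℝ] V) * ((g⁻¹ : GLV V) : V →L[ℝ] V)) e = e
    simp
  have hcont : Continuous fun t : ℝ => y - t • w := by fun_prop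
  have hopen := isOpen_isPos.preimage hcont
  obtain ⟨ε, hε, hball⟩ := Metric.isOpen_iff.1 hopen 0 (by simpa using hy)
  have h1 : IsPos (y - (ε / 2) • w) := hball (by
    rw [Metric.mem_ball, dist_zero_right, Real.norm_eq_abs, abs_of_pos (half_pos hε)]
    exact half_lt_self hε)
  have h2 := (h _ h1).add_isPos (isPos_e.smul (half_pos hε))
  rwa [map_sub, map_smul, hgw, sub_add_cancel] at h2

lemma isClosed_GLcone : IsClosed (GLcone V : Set (GLV V)) := by
  have : (GLcone V : Set (GLV V)) = ⋂ y : {y : V // IsPos y},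
      {g : GLV V | Nonneg ((g : V →L[ℝ] V) y)} ∩
        {g : GLV V | Nonneg (((g⁻¹ : GLV V) : V →L[ℝ] V) y)} := by
    ext g
    simp only [SetLike.mem_coe, Set.mem_iInter, Set.mem_inter_iff]
    refine ⟨fun h y => ⟨((mem_GLcone_iff.1 h).1 y y.2).nonneg, ((mem_GLcone_iff.1 h).2 y y.2).nonneg⟩,
      fun h => mem_GLcone_iff.2 ⟨fun y hy => ?_, fun y hy => ?_⟩⟩
    · exact isPos_of_forall_nonneg (fun y hy => (h ⟨y, hy⟩).1) hy
    · exact isPos_of_forall_nonneg (fun y hy => (h ⟨y, hy⟩).2) hy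
  rw [this]
  refine isClosed_iInter fun y => IsClosed.inter ?_ ?_
  · exact isClosed_nonneg.preimage (Units.continuous_val.clm_apply continuous_const)
  · exact isClosed_nonneg.preimage ((Units.continuous_val.comp continuous_inv).clm_apply
      continuous_const)

lemma isClosed_G : IsClosed (G V : Set (GLV V)) := by
  have h : (G V : Set (GLV V)) = Subtype.val '' (connectedComponent (1 : GLcone V)) := by
    ext g; rfl
  rw [h]
  exact isClosed_GLcone.isClosedEmbedding_subtypeVal.isClosedMap _ isClosed_connectedComponent

/-! ### Automorphisms of the cone -/

lemma unit_inv_apply (g : GLV V) (x : V) :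
    ((g⁻¹ : GLV V) : V →L[ℝ] V) ((g : V →L[ℝ] V) x) = x := by
  show (((g⁻¹ : GLV V) : V →L[ℝ] V) * (g : V →L[ℝ] V)) x = x
  simp

lemma unit_apply_inv (g : GLV V) (x : V) :
    (g : V →L[ℝ] V) (((g⁻¹ : GLV V) : V →L[ℝ] V) x) = x := by
  show ((g : V →L[ℝ] V) * ((g⁻¹ : GLV V) : V →L[ℝ] V)) x = x
  simp

lemma nonneg_apply {g : GLV V} (hg : g ∈ GLcone V) {x : V} (hx : Nonneg x) :
    Nonneg ((g : V →L[ℝ] V) x) := by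
  have hcont : Continuous fun t : ℝ => (g : V →L[ℝ] V) (x + t • e) := by fun_prop
  have hlim : Filter.Tendsto (fun t : ℝ => (g : V →L[ℝ] V) (x + t • e))
      (nhdsWithin 0 (Set.Ioi 0)) (nhds ((g : V →L[ℝ] V) x)) := by
    have := (hcont.tendsto 0).mono_left (nhdsWithin_le_nhds (s := Set.Ioi (0 : ℝ)))
    simpa using this
  refine isClosed_nonneg.mem_of_tendsto hlim ?_
  filter_upwards [self_mem_nhdsWithin] with t ht
  exact ((mem_GLcone_iff.1 hg).1 _ (hx.add_isPos (isPos_e.smul ht))).nonneg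

lemma jmul_compl {c : V} (hc : jmul c c = c) : jmul (e - c) (e - c) = e - c := by
  simp [hc, e_jmul, jmul_e]

/-- The eigenvalues of `g c` lie in `[0, 1]`. If one were strictly between, with idempotent `u`,
then `ε u` would be below both `g c` and `e - g c`. For `w = g⁻¹ u` this puts `ε w` below both `c`
and `e - c`; pairing with `e - c` and `c`, which are orthogonal, gives `⟪w, e⟫ = 0`, so `w = 0`. -/
lemma idem_apply {g : GLV V} (hg : g ∈ GLcone V) (he : (g : V →L[ℝ] V) e = e) {c : V}
    (hc : jmul c c = c) :
    jmul ((g : V →L[ℝ] V) c) ((g : V →L[ℝ] V) c) = (g : V →L[ℝ] V) c := by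
  obtain ⟨n, u, ev, hu, hy⟩ := exists_frame ((g : V →L[ℝ] V) c)
  have h0 : ∀ i, 0 ≤ ev i := (hu.nonneg_iff ev).1 (hy ▸ nonneg_apply hg (nonneg_idem hc))
  have hsub : e - (g : V →L[ℝ] V) c = ∑ j, (1 - ev j) • u j := by
    rw [hy]; simp only [sub_smul, one_smul, Finset.sum_sub_distrib, hu.2.2]
  have h1 : ∀ i, 0 ≤ 1 - ev i := (hu.nonneg_iff _).1 (by
    rw [← hsub]
    have := nonneg_apply hg (nonneg_idem (jmul_compl hc))
    rwa [map_sub, he] at this)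
  have hg' := inv_mem hg
  have he' : ((g⁻¹ : GLV V) : V →L[ℝ] V) e = e := by
    conv_lhs => rw [← he]
    rw [unit_inv_apply]
  have h01 : ∀ i, ev i = 0 ∨ ev i = 1 := by
    intro i
    by_contra hcon
    push Not at hcon
    have hp0 : 0 < ev i := lt_of_le_of_ne (h0 i) hcon.1.symm
    have hp1 : 0 < 1 - ev i := lt_of_le_of_ne (h1 i) (fun h => hcon.2 (by linarith))
    set ε := min (ev i) (1 - ev i) with hε
    have hε0 : 0 < ε := lt_min hp0 hp1
    have key : ∀ a : Fin n → ℝ, (∀ j, 0 ≤ a j) → ε ≤ a i →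
        Nonneg (∑ j, a j • u j - ε • u i) := by
      intro a ha hai
      have : ∑ j, a j • u j - ε • u i = ∑ j, (a j - if j = i then ε else 0) • u j := by
        simp [sub_smul, Finset.sum_sub_distrib, ite_smul]
      rw [this, hu.nonneg_iff]
      intro j
      by_cases hj : j = i
      · subst hj; simpa using hai
      · simpa [hj] using ha j
    set w := ((g⁻¹ : GLV V) : V →L[ℝ] V) (u i) with hw
    have hw0 : Nonneg w := nonneg_apply hg' (nonneg_idem (hu.1 i).2.1)
    have ha : Nonneg (c - ε • w) := by
      have := nonneg_apply hg' (key ev h0 (min_le_left _ _))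
      rwa [← hy, map_sub, map_smul, unit_inv_apply] at this
    have hb : Nonneg (e - c - ε • w) := by
      have := nonneg_apply hg' (key _ h1 (min_le_right _ _))
      rwa [← hsub, map_sub, map_smul, map_sub, unit_inv_apply, he'] at this
    have hce : ⟪c, e - c⟫_ℝ = 0 := by
      have := inner_jmul_left c c (e - c)
      rwa [map_sub, hc, jmul_e, sub_self, inner_zero_right] at this
    have h2 := ha.inner_nonneg (nonneg_idem (jmul_compl hc))
    have h3 := hb.inner_nonneg (nonneg_idem hc)
    rw [inner_sub_left, inner_smul_left, hce, conj_trivial] at h2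
    rw [inner_sub_left, inner_smul_left, real_inner_comm, hce, conj_trivial] at h3
    have h4 : ⟪w, e⟫_ℝ = ⟪w, e - c⟫_ℝ + ⟪w, c⟫_ℝ := by rw [← inner_add_right, sub_add_cancel]
    have h5 := hw0.inner_nonneg (isPos_e (V := V)).nonneg
    have h6 : ⟪w, e⟫_ℝ = 0 := by nlinarith
    have h7 := hw0.eq_zero h6
    apply (hu.1 i).1
    rw [← unit_apply_inv g (u i), ← hw, h7, map_zero]
  rw [hy, hu.isCSOI.sum_jmul_sum]
  refine Finset.sum_congr rfl fun i _ => ?_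
  rcases h01 i with h | h <;> simp [h]

/-- Automorphisms of the Jordan algebra. -/
def IsAut (k : V →L[ℝ] V) : Prop := ∀ x y, k (jmul x y) = jmul (k x) (k y)

/-- Idempotents go to idempotents; applied to `u_i + u_j` this shows that orthogonality is preserved
too. So `g` respects spectral decompositions, hence squares, hence products by polarisation. -/
lemma isAut_of_mem {g : GLV V} (hg : g ∈ GLcone V) (he : (g : V →L[ℝ] V) e = e) :
    IsAut (g : V →L[ℝ] V) := by
  have hsq : ∀ x, (g : V →L[ℝ] V) (jmul x x) = jmul ((g : V →L[ℝ] V) x) ((g : V →L[ℝ] V) x) := by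
    intro x
    obtain ⟨n, u, ev, hu, rfl⟩ := exists_frame x
    have hid := fun i => idem_apply hg he (hu.1 i).2.1
    have horth : ∀ i j, i ≠ j → jmul ((g : V →L[ℝ] V) (u i)) ((g : V →L[ℝ] V) (u j)) = 0 := by
      intro i j hij
      have h1 : jmul (u i + u j) (u i + u j) = u i + u j := by
        simp [(hu.1 i).2.1, (hu.1 j).2.1, hu.2.1 i j hij, hu.2.1 j i hij.symm]
      have h2 := idem_apply hg he h1
      simp only [map_add, LinearMap.add_apply, hid] at h2
      rw [jmul_comm ((g : V →L[ℝ] V) (u j))] at h2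
      have h3 : (2 : ℝ) • jmul ((g : V →L[ℝ] V) (u i)) ((g : V →L[ℝ] V) (u j)) = 0 := by
        linear_combination (norm := module) (1 : ℝ) • h2
      exact (smul_eq_zero.1 h3).resolve_left two_ne_zero
    have hcs : IsCSOI fun i => (g : V →L[ℝ] V) (u i) :=
      ⟨hid, horth, by rw [← map_sum, hu.2.2, he]⟩
    rw [hu.isCSOI.sum_jmul_sum]
    simp only [map_sum _ _ Finset.univ, map_smul]
    have := hcs.sum_jmul_sum ev ev
    simp only [map_sum _ _ Finset.univ, map_smul] at this
    exact this.symm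
  intro x y
  have h := hsq (x + y)
  simp only [map_add, LinearMap.add_apply, hsq, jmul_comm y x,
    jmul_comm ((g : V →L[ℝ] V) y) ((g : V →L[ℝ] V) x)] at h
  have h3 : (2 : ℝ) • (g : V →L[ℝ] V) (jmul x y) =
      (2 : ℝ) • jmul ((g : V →L[ℝ] V) x) ((g : V →L[ℝ] V) y) := by
    linear_combination (norm := module) (1 : ℝ) • h
  exact smul_right_injective V two_ne_zero h3

lemma IsAut.mul_L {k : GLV V} (hk : IsAut (k : V →L[ℝ] V)) (x : V) :
    (k : V →L[ℝ] V) * L x = L ((k : V →L[ℝ] V) x) * k := by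
  ext y; simpa using hk x y

/-! ### The trace form of a simple algebra -/

variable (V) in
/-- The trace, as a linear form on the continuous operators. -/
def tr : (V →L[ℝ] V) →ₗ[ℝ] ℝ :=
  LinearMap.trace ℝ V ∘ₗ ContinuousLinearMap.coeLM ℝ

lemma tr_mul_comm (A B : V →L[ℝ] V) : tr V (A * B) = tr V (B * A) :=
  LinearMap.trace_mul_comm ℝ (A : V →ₗ[ℝ] V) (B : V →ₗ[ℝ] V)

lemma tr_conj (g : GLV V) (A : V →L[ℝ] V) :
    tr V ((g : V →L[ℝ] V) * A * ((g⁻¹ : GLV V) : V →L[ℝ] V)) = tr V A := by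
  rw [tr_mul_comm, ← mul_assoc, Units.inv_mul, one_mul]

lemma tr_one : tr V (1 : V →L[ℝ] V) = Module.finrank ℝ V :=
  LinearMap.trace_one ℝ V

lemma e_ne_zero (hV : IsSimple V) : (e : V) ≠ 0 := by
  obtain ⟨x, hx⟩ := @exists_ne V hV.1 0
  intro h
  apply hx
  rw [← e_jmul x, h, map_zero, LinearMap.zero_apply]

/-- An eigenspace of `L(t)` is an ideal when `L(t)` commutes with all multiplications, so a nonzero
one is the whole of `V`. -/
lemma exists_eq_smul_e (hV : IsSimple V) {t : V} (ht : ∀ x, Commute (L t) (L x)) :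
    ∃ a : ℝ, t = a • e := by
  obtain ⟨n, u, ev, hu, rfl⟩ := exists_frame t
  have hn : n ≠ 0 := by
    rintro rfl
    exact e_ne_zero hV (by rw [← hu.2.2]; simp)
  set i : Fin n := ⟨0, Nat.pos_of_ne_zero hn⟩
  rcases hV.2 (Module.End.eigenspace (jmul (∑ j, ev j • u j)) (ev i)) (fun x y hy => by
    rw [Module.End.mem_eigenspace_iff] at hy ⊢
    rw [jmul_left_comm_of_commute (ht x), hy, map_smul]) with h | h
  · have hm : u i ∈ Module.End.eigenspace (jmul (∑ j, ev j • u j)) (ev i) := by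
      rw [Module.End.mem_eigenspace_iff, jmul_comm, hu.isCSOI.jmul_sum]
    rw [h] at hm
    exact absurd hm (hu.1 i).1
  · have hm : (e : V) ∈ Module.End.eigenspace (jmul (∑ j, ev j • u j)) (ev i) := by rw [h]; trivial
    rw [Module.End.mem_eigenspace_iff, jmul_e] at hm
    exact ⟨ev i, hm⟩

/-- Let `t` represent the linear form `x ↦ tr L(x)`. Commutators have trace zero and `[L(x), L(y)]`
is a derivation, so the trace form is associative. This translates into `L(t)` commuting with every
`L(x)`, and then `t` is a multiple of `e`. -/
lemma exists_tr_L (hV : IsSimple V) : ∃ a : ℝ, 0 < a ∧ ∀ x : V, tr V (L x) = a * ⟪e, x⟫_ℝ := by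
  set t := (InnerProductSpace.toDual ℝ V).symm (LinearMap.toContinuousLinearMap (tr V ∘ₗ L)) with ht
  have htx : ∀ x, ⟪t, x⟫_ℝ = tr V (L x) := fun x => by
    rw [ht, InnerProductSpace.toDual_symm_apply]; rfl
  have hassoc : ∀ x y z, ⟪t, jmul x (jmul y z)⟫_ℝ = ⟪t, jmul y (jmul x z)⟫_ℝ := by
    intro x y z
    rw [← sub_eq_zero, ← inner_sub_right, htx, ← L_bracket_bracket, map_sub,
      tr_mul_comm (L z), sub_self]
  obtain ⟨a, ha⟩ := exists_eq_smul_e hV (t := t) (fun x => by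
    have hin : ∀ p q, ⟪jmul t p, q⟫_ℝ = ⟪t, jmul p q⟫_ℝ := fun p q => by
      rw [jmul_comm, inner_jmul_left]
    ext y
    refine ext_inner_right ℝ fun z => ?_
    simp only [mul_apply_eq_comp, L_apply]
    rw [hin, inner_jmul_left, hin, jmul_comm (jmul x y) z, jmul_comm x y, hassoc z y x,
      jmul_comm z x])
  have hlam : ∀ x : V, tr V (L x) = a * ⟪e, x⟫_ℝ := fun x => by
    rw [← htx, ha, inner_smul_left, conj_trivial]
  refine ⟨a, ?_, hlam⟩
  have h1 := hlam e
  rw [L_e, tr_one] at h1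
  have h2 : 0 < ⟪(e : V), e⟫_ℝ := real_inner_self_pos.2 (e_ne_zero hV)
  have h3 : (0 : ℝ) < Module.finrank ℝ V := by
    have := hV.1
    exact_mod_cast Module.finrank_pos
  rw [h1] at h3
  exact pos_of_mul_pos_left h3 h2.le

/-- One has `⟪x, y⟫ = ⟪e, xy⟫`, and `⟪e, ·⟫` is proportional to `tr L`, which is invariant because
`L(k z)` is conjugate to `L(z)`. -/
lemma IsAut.inner (hV : IsSimple V) {k : GLV V} (hk : IsAut (k : V →L[ℝ] V)) (x y : V) :
    ⟪(k : V →L[ℝ] V) x, (k : V →L[ℝ] V) y⟫_ℝ = ⟪x, y⟫_ℝ := by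
  obtain ⟨a, ha, htr⟩ := exists_tr_L hV
  have h1 : ∀ z, ⟪e, (k : V →L[ℝ] V) z⟫_ℝ = ⟪e, z⟫_ℝ := by
    intro z
    have h2 : L ((k : V →L[ℝ] V) z) = (k : V →L[ℝ] V) * L z * ((k⁻¹ : GLV V) : V →L[ℝ] V) := by
      rw [hk.mul_L, mul_assoc, Units.mul_inv, mul_one]
    have h3 := htr ((k : V →L[ℝ] V) z)
    rw [h2, tr_conj, htr] at h3
    exact (mul_left_cancel₀ ha.ne' h3).symm
  have h4 : ∀ x y : V, ⟪x, y⟫_ℝ = ⟪e, jmul x y⟫_ℝ := fun x y => by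
    rw [← inner_jmul_left, jmul_e]
  rw [h4, ← hk, h1, ← h4]

lemma IsAut.adjoint (hV : IsSimple V) {k : GLV V} (hk : IsAut (k : V →L[ℝ] V)) :
    ContinuousLinearMap.adjoint (k : V →L[ℝ] V) = ((k⁻¹ : GLV V) : V →L[ℝ] V) := by
  symm
  rw [ContinuousLinearMap.eq_adjoint_iff]
  intro x y
  rw [← hk.inner hV, unit_apply_inv]

lemma IsAut.P_apply {k : GLV V} (hk : IsAut (k : V →L[ℝ] V)) (y : V) :
    P ((k : V →L[ℝ] V) y) = (k : V →L[ℝ] V) * P y * ((k⁻¹ : GLV V) : V →L[ℝ] V) := by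
  rw [Units.eq_mul_inv_iff_mul_eq]
  simp only [P, ← hk y y, sub_mul, mul_sub, smul_mul_assoc, mul_smul_comm, ← hk.mul_L, mul_assoc]
  rw [← mul_assoc _ _ (L y), ← hk.mul_L, mul_assoc]

/-- The point `g e` of the cone has a logarithm: it is `exp(L(x)) e` for some `x`. -/
lemma exists_polar {g : GLV V} (hg : g ∈ GLcone V) : ∃ (x : V) (k : GLV V), k ∈ GLcone V ∧
    (k : V →L[ℝ] V) e = e ∧ g = expU (L x) * k := by
  obtain ⟨x, hx⟩ := ((mem_GLcone_iff.1 hg).1 e isPos_e).exists_log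
  refine ⟨x, (expU (L x))⁻¹ * g, mul_mem (inv_mem (expU_mem_GLcone (isStr_L x))) hg, ?_, by simp⟩
  rw [Units.val_mul, mul_apply_eq_comp, hx]
  exact unit_inv_apply (expU (L x)) e

/-- Both polar factors satisfy the formula; for the automorphism this is because its adjoint is its
inverse. -/
lemma P_GLcone (hV : IsSimple V) {g : GLV V} (hg : g ∈ GLcone V) (y : V) :
    P ((g : V →L[ℝ] V) y) = (g : V →L[ℝ] V) * P y *
      ContinuousLinearMap.adjoint (g : V →L[ℝ] V) := by
  obtain ⟨x, k, hk, he, rfl⟩ := exists_polar hg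
  have hka := isAut_of_mem hk he
  rw [Units.val_mul, mul_apply_eq_comp, coe_expU, (isStr_L x).P_exp, hka.P_apply]
  have : ContinuousLinearMap.adjoint (NormedSpace.exp (L x) * (k : V →L[ℝ] V)) =
      ContinuousLinearMap.adjoint (k : V →L[ℝ] V) *
        ContinuousLinearMap.adjoint (NormedSpace.exp (L x)) :=
    ContinuousLinearMap.adjoint_comp _ _
  rw [this, hka.adjoint hV]
  simp only [mul_assoc]

lemma adjoint_mul (A B : V →L[ℝ] V) : ContinuousLinearMap.adjoint (A * B) =
    ContinuousLinearMap.adjoint B * ContinuousLinearMap.adjoint A :=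
  ContinuousLinearMap.adjoint_comp _ _

lemma PP_smul_right (a : ℝ) (x y : V) : PP x (a • y) = a • PP x y := by
  rw [PP_comm, PP_smul_left, PP_comm]

lemma IsStr.conj (hV : IsSimple V) {g : GLV V} (hg : g ∈ GLcone V) {X : V →L[ℝ] V}
    (hX : IsStr X) : IsStr ((g : V →L[ℝ] V) * X * ((g⁻¹ : GLV V) : V →L[ℝ] V)) := by
  intro y
  set z := ((g⁻¹ : GLV V) : V →L[ℝ] V) y with hz
  have hy : y = (g : V →L[ℝ] V) z := (unit_apply_inv g y).symm
  have hPP : ∀ u v, PP ((g : V →L[ℝ] V) u) ((g : V →L[ℝ] V) v) = (g : V →L[ℝ] V) * PP u v *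
      ContinuousLinearMap.adjoint (g : V →L[ℝ] V) := by
    intro u v
    have h := P_GLcone hV hg (u + v)
    rw [map_add, P_add, P_add, P_GLcone hV hg, P_GLcone hV hg] at h
    simp only [mul_add, add_mul, mul_smul_comm, smul_mul_assoc] at h
    have h2 : (2 : ℝ) • PP ((g : V →L[ℝ] V) u) ((g : V →L[ℝ] V) v) = (2 : ℝ) •
      ((g : V →L[ℝ] V) * PP u v * ContinuousLinearMap.adjoint (g : V →L[ℝ] V)) := by
      linear_combination (norm := module) (1 : ℝ) • h
    exact smul_right_injective _ two_ne_zero h2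
  have hadj := adjoint_mul (((g⁻¹ : GLV V) : V →L[ℝ] V)) (g : V →L[ℝ] V)
  rw [Units.inv_mul, ← L_e, adjoint_L, L_e] at hadj
  have h := hX z
  rw [adjoint_mul, adjoint_mul, hy, P_GLcone hV hg]
  set A := (g : V →L[ℝ] V)
  set A' := ((g⁻¹ : GLV V) : V →L[ℝ] V)
  set S := ContinuousLinearMap.adjoint A
  set S' := ContinuousLinearMap.adjoint A'
  have hA : A' * A = 1 := Units.inv_mul g
  have h1 : (A * X * A') (A z) = A (X z) := by
    show (A * X * A' * A) z = _
    rw [mul_assoc, hA, mul_one]; rfl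
  rw [h1, hPP, ← smul_mul_assoc, ← mul_smul_comm, ← h]
  calc A * X * A' * (A * P z * S) + A * P z * S * (S' * (ContinuousLinearMap.adjoint X * S))
      = A * X * (A' * A) * P z * S + A * P z * (S * S') * ContinuousLinearMap.adjoint X * S := by
        simp only [mul_assoc]
    _ = _ := by rw [hA, ← hadj]; simp only [mul_one, mul_add, add_mul, mul_assoc]

/-! ### Derivations and tangent vectors in the structure algebra. -/

lemma IsStr.adjoint_eq {X : V →L[ℝ] V} (hX : IsStr X) :
    ContinuousLinearMap.adjoint X = (2 : ℝ) • L (X e) - X := by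
  have h := hX e
  rw [P_e, PP_e, mul_one, one_mul] at h
  rw [← h]; abel

lemma IsStr.adjoint {X : V →L[ℝ] V} (hX : IsStr X) : IsStr (ContinuousLinearMap.adjoint X) := by
  rw [hX.adjoint_eq]
  exact (strAlg V).sub_mem ((strAlg V).smul_mem 2 (isStr_L _)) hX

/-- Here `X* = -X`, and the difference of the structure conditions at `y + e` and at `y` is twice
the derivation rule. -/
lemma IsStr.derivation {X : V →L[ℝ] V} (hX : IsStr X) (he : X e = 0) (y : V) :
    X * L y - L y * X = L (X y) := by
  have h1 := hX (y + e)
  have h2 := hX y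
  have h3 := hX.adjoint_eq
  rw [he, map_zero, smul_zero, zero_sub] at h3
  rw [P_add, PP_e, P_e, map_add, he, add_zero, PP_comm, PP_add_left, PP_comm, PP_comm e, PP_e, h3] at h1
  rw [h3] at h2
  have h4 : (2 : ℝ) • (X * L y - L y * X) = (2 : ℝ) • L (X y) := by
    simp only [mul_add, add_mul, mul_smul_comm, smul_mul_assoc, mul_one, one_mul, mul_neg] at h1 h2
    linear_combination (norm := module) (1 : ℝ) • h1 - (1 : ℝ) • h2
  exact smul_right_injective _ two_ne_zero h4

lemma isStr_of_derivation {D : V →L[ℝ] V} (h : ∀ y, D * L y - L y * D = L (D y))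
    (hadj : ContinuousLinearMap.adjoint D = -D) : IsStr D := by
  intro y
  have h1 := h y
  have h2 := h (jmul y y)
  have h3 : D (jmul y y) = (2 : ℝ) • jmul (D y) y := by
    have := congrArg (fun A : V →L[ℝ] V => A y) h1
    simp only [sub_apply, mul_apply_eq_comp, L_apply, jmul_comm y (D y)] at this
    linear_combination (norm := module) (1 : ℝ) • this
  rw [h3, map_smul] at h2
  rw [hadj, P, PP, ← h1]
  have h4 : L (jmul (D y) y) = (1 / 2 : ℝ) • (D * L (jmul y y) - L (jmul y y) * D) := by
    rw [h2, smul_smul]; norm_num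
  rw [h4]
  simp only [mul_sub, sub_mul, mul_smul_comm, smul_mul_assoc, mul_neg, mul_assoc]
  module

lemma isStr_bracket (a b : V) : IsStr (L a * L b - L b * L a) := by
  refine isStr_of_derivation (fun y => ?_) ?_
  · rw [L_bracket_bracket]; simp
  · rw [map_sub, adjoint_mul, adjoint_mul, adjoint_L, adjoint_L]; abel

lemma isStr_box (a b : V) : IsStr (box a b) :=
  (strAlg V).add_mem (isStr_L _) (isStr_bracket a b)

/-- Put `g = 1 + ε B` in `P(g y) = g P(y) g*`, divide by `ε` and let `ε → 0`. The filter is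
arbitrary because this serves both for one-parameter groups and for rescaled unipotent elements. -/
lemma isStr_of_tendsto (hV : IsSimple V) {α : Type*} {l : Filter α} [l.NeBot] {g : α → GLV V}
    (hg : ∀ᶠ t in l, g t ∈ GLcone V) {ε : α → ℝ} (hε : Filter.Tendsto ε l (nhds 0))
    (hε0 : ∀ᶠ t in l, ε t ≠ 0) {X : V →L[ℝ] V}
    (hlim : Filter.Tendsto (fun t => (ε t)⁻¹ • ((g t : V →L[ℝ] V) - 1)) l (nhds X)) : IsStr X := by
  intro y
  set B : α → (V →L[ℝ] V) := fun t => (ε t)⁻¹ • ((g t : V →L[ℝ] V) - 1) with hB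
  have hcP : Continuous fun z : V => P z := by
    unfold P
    have h1 : Continuous fun z : V => L z := continuous_L
    have h2 : Continuous fun z : V => jmul z z := by
      have := h1.clm_apply continuous_id
      exact this
    exact Continuous.sub (Continuous.const_smul (Continuous.mul h1 h1) (2 : ℝ)) (continuous_L.comp h2)
  have hcPP : Continuous fun z : V => PP z y := by
    have : (fun z => PP z y) = fun z => (1 / 2 : ℝ) • (P (z + y) - P z - P y) := by
      funext z; rw [P_add]; module
    rw [this]
    have h1 : Continuous fun z : V => P (z + y) := hcP.comp (continuous_id.add continuous_const)
    exact Continuous.const_smul (Continuous.sub (Continuous.sub h1 hcP) continuous_const) (1 / 2 : ℝ)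
  have hadjc : Continuous fun A : V →L[ℝ] V => ContinuousLinearMap.adjoint A :=
    ContinuousLinearMap.adjoint.continuous
  have hBy : Filter.Tendsto (fun t => B t y) l (nhds (X y)) :=
    ((ContinuousLinearMap.apply ℝ V y).continuous.tendsto X).comp hlim
  have hBa := (hadjc.tendsto X).comp hlim
  have hl : Filter.Tendsto (fun t => (2 : ℝ) • PP (B t y) y + ε t • P (B t y)) l
      (nhds ((2 : ℝ) • PP (X y) y + (0 : ℝ) • P (X y))) :=
    (((hcPP.tendsto _).comp hBy).const_smul 2).add (hε.smul ((hcP.tendsto _).comp hBy))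
  have hr : Filter.Tendsto (fun t => B t * P y + P y * ContinuousLinearMap.adjoint (B t) +
      ε t • (B t * P y * ContinuousLinearMap.adjoint (B t))) l
      (nhds (X * P y + P y * ContinuousLinearMap.adjoint X +
        (0 : ℝ) • (X * P y * ContinuousLinearMap.adjoint X))) :=
    ((hlim.mul_const _).add (hBa.const_mul _)).add (hε.smul ((hlim.mul_const _).mul hBa))
  have heq : ∀ᶠ t in l, (2 : ℝ) • PP (B t y) y + ε t • P (B t y) =
      B t * P y + P y * ContinuousLinearMap.adjoint (B t) +
      ε t • (B t * P y * ContinuousLinearMap.adjoint (B t)) := by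
    filter_upwards [hg, hε0] with t ht h0
    have hgt : (g t : V →L[ℝ] V) = 1 + ε t • B t := by
      simp [hB, smul_smul, mul_inv_cancel₀ h0]
    have h := P_GLcone hV ht y
    have ha1 : ContinuousLinearMap.adjoint (1 : V →L[ℝ] V) = 1 := by
      rw [← L_e, adjoint_L]
    rw [hgt, map_add, ha1, add_apply, one_apply_eq_self, smul_apply, P_add, map_smulₛₗ,
      PP_smul_right] at h
    have hPs : P (ε t • B t y) = (ε t * ε t) • P (B t y) := by
      rw [← PP_self, PP_smul_left, PP_smul_right, PP_self, smul_smul]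
    rw [hPs, PP_comm] at h
    simp only [mul_add, add_mul, mul_smul_comm, smul_mul_assoc, mul_one, one_mul, conj_trivial] at h
    refine smul_right_injective _ h0 ?_
    simp only
    linear_combination (norm := module) (1 : ℝ) • h
  have := tendsto_nhds_unique (hl.congr' heq) hr
  simpa using this.symm

/-! ### Primitive idempotents, trace and determinant of a simple algebra -/

lemma continuous_P : Continuous (P : V → V →L[ℝ] V) := by
  unfold P
  have h1 : Continuous fun z : V => L z := continuous_L
  have h2 : Continuous fun z : V => jmul z z := h1.clm_apply continuous_id
  exact Continuous.sub (Continuous.const_smul (Continuous.mul h1 h1) (2 : ℝ)) (continuous_L.comp h2)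

/-- For `y = exp(L(x)) e` one has `P(y) = exp(L(x))²`, and each factor obeys the transformation rule
of `P`. The nonnegative case, needed for idempotents, follows by replacing `y` by `y + t e` and
letting `t → 0`. -/
lemma P_fundamental_of_isPos {y : V} (hy : IsPos y) (z : V) :
    P (P y z) = P y * P z * P y := by
  obtain ⟨x, rfl⟩ := hy.exists_log
  have h1 := (isStr_L x).P_exp e
  rw [P_e, mul_one, adjoint_exp, adjoint_L] at h1
  rw [h1, mul_apply_eq_comp, (isStr_L x).P_exp, (isStr_L x).P_exp, adjoint_exp, adjoint_L]
  simp only [mul_assoc]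

lemma P_fundamental_of_nonneg {y : V} (hy : Nonneg y) (z : V) :
    P (P y z) = P y * P z * P y := by
  have hc : Continuous fun t : ℝ => P (y + t • e) :=
    continuous_P.comp (continuous_const.add (continuous_id.smul continuous_const))
  have h1 : Continuous fun t : ℝ => P (P (y + t • e) z) :=
    continuous_P.comp (hc.clm_apply continuous_const)
  have h2 : Continuous fun t : ℝ => P (y + t • e) * P z * P (y + t • e) :=
    (hc.mul continuous_const).mul hc
  have h3 := (h1.tendsto 0).mono_left (nhdsWithin_le_nhds (s := Set.Ioi (0 : ℝ)))
  have h4 := (h2.tendsto 0).mono_left (nhdsWithin_le_nhds (s := Set.Ioi (0 : ℝ)))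
  have h5 := tendsto_nhds_unique (h3.congr' (by
    filter_upwards [self_mem_nhdsWithin] with t ht
    exact P_fundamental_of_isPos (hy.add_isPos (isPos_e.smul ht)) z)) h4
  simpa using h5

lemma inner_P (c x y : V) : ⟪P c x, y⟫_ℝ = ⟪x, P c y⟫_ℝ := by
  simp only [P_apply, inner_sub_left, inner_sub_right, inner_smul_left, inner_smul_right,
    inner_jmul_left, conj_trivial]

lemma IsPrimitive.P_apply {c : V} (hc : IsPrimitive c) (z : V) :
    P c z = (⟪c, z⟫_ℝ / ⟪c, c⟫_ℝ) • c := by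
  obtain ⟨a, ha⟩ := hc.exists_smul (jmul_P hc.2.1 z)
  have h := inner_P c z c
  rw [P_of_jmul_eq hc.2.1 hc.2.1, ha, inner_smul_left, conj_trivial] at h
  rw [ha, real_inner_comm z c, ← h, mul_div_assoc, div_self (inner_self_ne_zero.2 hc.1), mul_one]

/-- Pair `P(P(c) p) c = P(c) P(p) P(c) c` with `c`. As `P(c)` and `P(p)` are projections onto lines,
the two sides are `⟪c, p⟫² / ⟪c, c⟫` and `⟪c, p⟫² / ⟪p, p⟫`. -/
lemma IsPrimitive.inner_eq_of_inner_ne_zero {c p : V} (hc : IsPrimitive c) (hp : IsPrimitive p)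
    (h : ⟪c, p⟫_ℝ ≠ 0) : ⟪c, c⟫_ℝ = ⟪p, p⟫_ℝ := by
  have h1 := congrArg (fun A : V →L[ℝ] V => ⟪c, A c⟫_ℝ)
    (P_fundamental_of_nonneg (nonneg_idem hc.2.1) p)
  have hc0 : ⟪c, c⟫_ℝ ≠ 0 := inner_self_ne_zero.2 hc.1
  have hp0 : ⟪p, p⟫_ℝ ≠ 0 := inner_self_ne_zero.2 hp.1
  simp only [mul_apply_eq_comp] at h1
  rw [P_of_jmul_eq hc.2.1 hc.2.1, hp.P_apply, map_smul, hc.P_apply p, ← PP_self, PP_smul_left,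
    PP_smul_right, PP_self] at h1
  simp only [smul_apply, inner_smul_right] at h1
  rw [P_of_jmul_eq hc.2.1 hc.2.1, real_inner_comm] at h1
  rw [real_inner_comm] at h
  field_simp at h1
  linarith

lemma IsPrimitive.jmul_eq_zero {c p : V} (hc : IsPrimitive c) (hp : IsPrimitive p)
    (h : ⟪c, c⟫_ℝ ≠ ⟪p, p⟫_ℝ) : jmul c p = 0 := by
  refine jmul_eq_zero_of_inner_idem hc.2.1 hp.2.1 ?_
  by_contra h0
  exact h (hc.inner_eq_of_inner_ne_zero hp h0)

/-- The primitive idempotents with the norm of `c` span an ideal, hence `V`. One of a different norm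
would be orthogonal to all of them. -/
lemma IsPrimitive.inner_eq (hV : IsSimple V) {c p : V} (hc : IsPrimitive c) (hp : IsPrimitive p) :
    ⟪c, c⟫_ℝ = ⟪p, p⟫_ℝ := by
  by_contra hne
  set I := Submodule.span ℝ {q : V | IsPrimitive q ∧ ⟪q, q⟫_ℝ = ⟪c, c⟫_ℝ} with hI
  have hideal : ∀ x, ∀ y ∈ I, jmul x y ∈ I := by
    intro x y hy
    induction hy using Submodule.span_induction with
    | mem q hq =>
      obtain ⟨n, u, ev, hu, hxq⟩ := exists_frame (jmul x q)
      rw [hxq]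
      refine Submodule.sum_mem _ fun i _ => ?_
      by_cases hi : ⟪u i, u i⟫_ℝ = ⟪c, c⟫_ℝ
      · exact Submodule.smul_mem _ _ (Submodule.subset_span ⟨hu.1 i, hi⟩)
      -- An idempotent of another norm is orthogonal to `q`, so its coefficient in `x q` vanishes
      -- and only idempotents of the right norm remain.
      · have h1 : jmul q (u i) = 0 := hq.1.jmul_eq_zero (hu.1 i) (fun h => hi (h.symm.trans hq.2))
        have h2 : ⟪jmul x q, u i⟫_ℝ = ev i * ⟪u i, u i⟫_ℝ := by
          rw [← hu.inner_sum_self ev i, ← hxq, inner_jmul_idem (hu.1 i).2.1]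
        rw [jmul_comm, inner_jmul_left, h1, inner_zero_right] at h2
        rw [(mul_eq_zero.1 h2.symm).resolve_right (hu.inner_pos i).ne', zero_smul]
        exact I.zero_mem
    | zero => simp
    | add y z _ _ hy hz => rw [map_add]; exact I.add_mem hy hz
    | smul a y _ hy => rw [map_smul]; exact I.smul_mem a hy
  have hcI : c ∈ I := Submodule.subset_span ⟨hc, rfl⟩
  have htop := (hV.2 I hideal).resolve_left fun h => hc.1 (by rw [h] at hcI; exact hcI)
  have horth : ∀ y ∈ I, ⟪p, y⟫_ℝ = 0 := by
    intro y hy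
    induction hy using Submodule.span_induction with
    | mem q hq =>
      by_contra h
      exact hne (hq.2.symm.trans (hp.inner_eq_of_inner_ne_zero hq.1 h).symm)
    | zero => simp
    | add y z _ _ hy hz => rw [inner_add_right, hy, hz, add_zero]
    | smul a y _ hy => rw [inner_smul_right, hy, mul_zero]
  exact hp.1 (inner_self_eq_zero.1 (horth p (htop ▸ Submodule.mem_top)))

/-- All primitive idempotents have the same inner product with `e`, hence the same `tr L`. In
particular the sum of the coefficients of an element does not depend on the frame. -/
lemma IsJordanFrame.tr_L_mul (hV : IsSimple V) {n r : ℕ} {u : Fin n → V} {c : Fin r → V}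
    (hu : IsJordanFrame u) (hc : IsJordanFrame c) (ev : Fin n → ℝ) :
    (r : ℝ) * tr V (L (∑ j, ev j • u j)) = Module.finrank ℝ V * ∑ j, ev j := by
  obtain ⟨a, ha, htr⟩ := exists_tr_L hV
  have hidem : ∀ {p : V}, IsPrimitive p → ⟪e, p⟫_ℝ = ⟪p, p⟫_ℝ := fun {p} hp => by
    nth_rewrite 1 [← hp.2.1]
    rw [← inner_jmul_left, jmul_e]
  have hr : 0 < r := Nat.pos_of_ne_zero (by
    rintro rfl
    exact e_ne_zero hV (by rw [← hc.2.2]; simp))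
  set p := c ⟨0, hr⟩
  have hall : ∀ {q : V}, IsPrimitive q → ⟪e, q⟫_ℝ = ⟪p, p⟫_ℝ := fun hq => by
    rw [hidem hq, hq.inner_eq hV (hc.1 _)]
  have h1 := htr e
  rw [L_e, tr_one] at h1
  nth_rewrite 2 [← hc.2.2] at h1
  rw [inner_sum, Finset.sum_congr rfl fun i _ => hall (hc.1 i)] at h1
  simp only [Finset.sum_const, Finset.card_univ, Fintype.card_fin, nsmul_eq_mul] at h1
  rw [htr, inner_sum]
  simp only [inner_smul_right, hall (hu.1 _)]
  rw [← Finset.sum_mul, h1]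
  ring

lemma finrank_pos_of_isSimple (hV : IsSimple V) : (0 : ℝ) < Module.finrank ℝ V := by
  have := hV.1
  exact_mod_cast Module.finrank_pos

lemma IsJordanFrame.pos (hV : IsSimple V) {r : ℕ} {c : Fin r → V} (hc : IsJordanFrame c) :
    0 < r := Nat.pos_of_ne_zero (by
    rintro rfl
    exact e_ne_zero hV (by rw [← hc.2.2]; simp))

lemma eigenvalues_spec (x : V) : ∃ (n : ℕ) (u : Fin n → V) (ev : Fin n → ℝ),
    IsJordanFrame u ∧ x = ∑ j, ev j • u j ∧ eigenvalues x = Finset.univ.val.map ev := by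
  have h : ∃ s : Multiset ℝ, ∃ (n : ℕ) (u : Fin n → V) (ev : Fin n → ℝ),
      IsJordanFrame u ∧ x = ∑ j, ev j • u j ∧ s = Finset.univ.val.map ev := by
    obtain ⟨n, u, ev, hu, hx⟩ := exists_frame x
    exact ⟨_, n, u, ev, hu, hx, rfl⟩
  rw [eigenvalues, dif_pos h]
  exact h.choose_spec

lemma tr_L_eq_jtr (hV : IsSimple V) {r : ℕ} {c : Fin r → V} (hc : IsJordanFrame c) (x : V) :
    (r : ℝ) * tr V (L x) = Module.finrank ℝ V * jtr x := by
  obtain ⟨n, u, ev, hu, hx, hs⟩ := eigenvalues_spec x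
  rw [jtr, hs]
  nth_rewrite 1 [hx]
  exact hu.tr_L_mul hV hc ev

/-! ### The determinant of the algebra as a power of the determinant of operators. -/

lemma det_exp_of_symm {S : V →L[ℝ] V} (hS : (S : V →ₗ[ℝ] V).IsSymmetric) :
    (NormedSpace.exp S : V →L[ℝ] V).det = Real.exp (tr V S) := by
  classical
  set b := hS.eigenvectorBasis rfl with hb
  set μ := hS.eigenvalues rfl with hμ
  have hbe : ∀ i, S (b i) = μ i • b i := fun i => hS.apply_eigenvectorBasis rfl i
  have h1 : LinearMap.toMatrix b.toBasis b.toBasis ((NormedSpace.exp S : V →L[ℝ] V) : V →ₗ[ℝ] V) =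
      Matrix.diagonal fun i => Real.exp (μ i) := by
    ext i j
    rw [LinearMap.toMatrix_apply]
    simp only [OrthonormalBasis.coe_toBasis, ContinuousLinearMap.coe_coe,
      exp_apply_eigenvector (hbe j), map_smul]
    by_cases h : i = j
    · subst h; simp
    · simp [h]
  have h2 : LinearMap.toMatrix b.toBasis b.toBasis (S : V →ₗ[ℝ] V) = Matrix.diagonal μ := by
    ext i j
    rw [LinearMap.toMatrix_apply]
    simp only [OrthonormalBasis.coe_toBasis, ContinuousLinearMap.coe_coe, hbe j, map_smul]
    by_cases h : i = j
    · subst h; simp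
    · simp [h]
  rw [ContinuousLinearMap.det, ← LinearMap.det_toMatrix b.toBasis, h1, Matrix.det_diagonal]
  have h3 : tr V S = ∑ i, μ i := by
    show LinearMap.trace ℝ V (S : V →ₗ[ℝ] V) = _
    rw [LinearMap.trace_eq_matrix_trace ℝ b.toBasis, h2, Matrix.trace_diagonal]
  rw [h3, Real.exp_sum]

lemma det_exp_L (x : V) : (NormedSpace.exp (L x) : V →L[ℝ] V).det = Real.exp (tr V (L x)) :=
  det_exp_of_symm fun y z => inner_jmul_left x y z

lemma det_mul' (A B : V →L[ℝ] V) : (A * B).det = A.det * B.det :=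
  LinearMap.det.map_mul (A : V →ₗ[ℝ] V) B

lemma IsAut.abs_det (hV : IsSimple V) {k : GLV V} (hk : IsAut (k : V →L[ℝ] V)) :
    |(k : V →L[ℝ] V).det| = 1 := by
  let f : V →ₗᵢ[ℝ] V := ((k : V →L[ℝ] V) : V →ₗ[ℝ] V).isometryOfInner (hk.inner hV)
  have h := f.normDet_eq_one
  rwa [LinearMap.normDet_eq_abs_det] at h

lemma det_unit_ne_zero (g : GLV V) : (g : V →L[ℝ] V).det ≠ 0 := by
  intro h
  have := det_mul' (g : V →L[ℝ] V) ((g⁻¹ : GLV V) : V →L[ℝ] V)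
  rw [Units.mul_inv, h, zero_mul] at this
  have h1 : (1 : V →L[ℝ] V).det = 1 := LinearMap.det.map_one
  rw [h1] at this
  exact one_ne_zero this

/-- Write `g = exp(L(x)) k` with `x` the logarithm of `g e`. Then `|det g| = exp(tr L(x))`, and `tr
L(x)` is `n/r` times the sum of the logarithms of the eigenvalues of `g e`. -/
lemma jdet_apply_e (hV : IsSimple V) {r : ℕ} {c : Fin r → V} (hc : IsJordanFrame c) {g : GLV V}
    (hg : g ∈ GLcone V) : jdet ((g : V →L[ℝ] V) e) =
      |(g : V →L[ℝ] V).det| ^ ((r : ℝ) / Module.finrank ℝ V) := by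
  obtain ⟨n, u, ev, hu, hx, hs⟩ := eigenvalues_spec ((g : V →L[ℝ] V) e)
  have hpos : ∀ i, 0 < ev i := (hu.isPos_iff ev).1 (hx ▸ (mem_GLcone_iff.1 hg).1 e isPos_e)
  set x := ∑ j, Real.log (ev j) • u j with hxdef
  have hxe : NormedSpace.exp (L x) e = (g : V →L[ℝ] V) e := by
    rw [hxdef, hu.exp_sum, hx]; simp [Real.exp_log (hpos _)]
  set k := (expU (L x))⁻¹ * g with hk
  have hkG : k ∈ GLcone V := mul_mem (inv_mem (expU_mem_GLcone (isStr_L x))) hg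
  have hke : (k : V →L[ℝ] V) e = e := by
    rw [hk, Units.val_mul, mul_apply_eq_comp, ← hxe]; exact unit_inv_apply (expU (L x)) e
  have hgk : g = expU (L x) * k := by rw [hk]; simp
  have hdet : |(g : V →L[ℝ] V).det| = Real.exp (tr V (L x)) := by
    rw [hgk, Units.val_mul, det_mul', abs_mul, (isAut_of_mem hkG hke).abs_det hV, mul_one,
      coe_expU, det_exp_L, Real.abs_exp]
  have htr := hu.tr_L_mul hV hc (fun j => Real.log (ev j))
  have hn := finrank_pos_of_isSimple hV
  rw [jdet, hs, hdet, ← Real.exp_mul]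
  have h1 : tr V (L x) * ((r : ℝ) / Module.finrank ℝ V) = ∑ j, Real.log (ev j) := by
    rw [← mul_div_assoc, div_eq_iff hn.ne', mul_comm, htr, mul_comm]
  rw [h1, Real.exp_sum]
  simp [Real.exp_log (hpos _), List.prod_ofFn]

/-- The determinant character of `G`. -/
def detChar (r : ℕ) : G V →ₜ* PosReal where
  toFun g := ⟨|((g : GLV V) : V →L[ℝ] V).det| ^ ((r : ℝ) / Module.finrank ℝ V),
    Real.rpow_pos_of_pos (abs_pos.2 (det_unit_ne_zero _)) _⟩
  map_one' := by
    ext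
    have h1 : (1 : V →L[ℝ] V).det = 1 := LinearMap.det.map_one
    simp [h1]
  map_mul' g h := by
    ext
    simp [det_mul', abs_mul, Real.mul_rpow]
  continuous_toFun := by
    refine Continuous.subtype_mk ?_ _
    refine Continuous.rpow_const ?_ fun g => Or.inl (abs_ne_zero.2 (det_unit_ne_zero _))
    exact (ContinuousLinearMap.continuous_det.comp
      (Units.continuous_val.comp continuous_subtype_val)).abs

lemma detChar_eq (hV : IsSimple V) {r : ℕ} {c : Fin r → V} (hc : IsJordanFrame c) (g : G V) :
    (detChar r g : ℝ) = jdet (((g : GLV V) : V →L[ℝ] V) e) :=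
  (jdet_apply_e hV hc (G_le g.2)).symm

/-! ### Peirce decomposition with respect to a Jordan frame -/

namespace IsCSOI

variable {ι : Type*} [Fintype ι] {c : ι → V}

lemma sum_L (hc : IsCSOI c) : ∑ i, L (c i) = 1 := by
  rw [← map_sum, hc.sum, L_e]

/-- The idempotent `c_j` is in `V(c_i, 0)`, so it annihilates the image `V(c_i, 1)` of `P(c_i) = 2
L(c_i)² - L(c_i)`. -/
lemma L_mul_L_sq (hc : IsCSOI c) {i j : ι} (hij : i ≠ j) :
    L (c i) * (L (c i) * L (c j)) = (1 / 2 : ℝ) • (L (c i) * L (c j)) := by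
  ext x
  have h := jmul_one_zero (hc.idem i) (jmul_P (hc.idem i) x) (hc.orth i j hij)
  rw [jmul_comm, P_apply, hc.idem, map_sub, map_smul,
    jmul_left_comm_of_commute (hc.commute j i) (jmul (c i) x),
    jmul_left_comm_of_commute (hc.commute j i)] at h
  simp only [mul_apply_eq_comp, L_apply, smul_apply]
  linear_combination (norm := module) (1 / 2 : ℝ) • h

lemma jmul_jmul_half (hc : IsCSOI c) {i j : ι} (hij : i ≠ j) (x : V) :
    jmul (c i) (jmul (c i) (jmul (c j) x)) = (1 / 2 : ℝ) • jmul (c i) (jmul (c j) x) := by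
  simpa using congrArg (fun A : V →L[ℝ] V => A x) (hc.L_mul_L_sq hij)

lemma jmul_jmul_half' (hc : IsCSOI c) {i j : ι} (hij : i ≠ j) (x : V) :
    jmul (c j) (jmul (c i) (jmul (c j) x)) = (1 / 2 : ℝ) • jmul (c i) (jmul (c j) x) := by
  rw [jmul_left_comm_of_commute (hc.commute i j), hc.jmul_jmul_half hij.symm]

lemma jmul_jmul_zero (hc : IsCSOI c) {i j k : ι} (hij : i ≠ j) (hki : k ≠ i) (hkj : k ≠ j) (x : V) :
    jmul (c k) (jmul (c i) (jmul (c j) x)) = 0 := by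
  rw [jmul_comm]
  have hid : jmul (c i + c j) (c i + c j) = c i + c j := by
    simp [hc.idem, hc.orth i j hij, hc.orth j i hij.symm]
  refine jmul_one_zero hid ?_ ?_
  · rw [map_add, LinearMap.add_apply, hc.jmul_jmul_half hij, hc.jmul_jmul_half' hij]; module
  · rw [map_add, LinearMap.add_apply, hc.orth i k hki.symm, hc.orth j k hkj.symm, add_zero]

end IsCSOI

section

variable {r : ℕ} {c : Fin r → V}

lemma mem_peirce_iff {i j : Fin r} {a : V} : a ∈ peirce c i j ↔
    jmul (c i) a = (1 / 2 : ℝ) • a ∧ jmul (c j) a = (1 / 2 : ℝ) • a ∧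
      ∀ k, k ≠ i → k ≠ j → jmul (c k) a = 0 := by
  simp only [peirce, Submodule.mem_inf, Module.End.mem_eigenspace_iff, Submodule.mem_iInf, zero_smul,
    Subtype.forall, and_assoc, and_imp]

lemma peirce_comm (i j : Fin r) : peirce c i j = peirce c j i := by
  ext a
  rw [mem_peirce_iff, mem_peirce_iff]
  exact ⟨fun h => ⟨h.2.1, h.1, fun k h1 h2 => h.2.2 k h2 h1⟩,
    fun h => ⟨h.2.1, h.1, fun k h1 h2 => h.2.2 k h2 h1⟩⟩

lemma IsCSOI.jmul_jmul_mem_peirce (hc : IsCSOI c) {i j : Fin r} (hij : i ≠ j) (x : V) :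
    jmul (c i) (jmul (c j) x) ∈ peirce c i j :=
  mem_peirce_iff.2 ⟨hc.jmul_jmul_half hij x, hc.jmul_jmul_half' hij x,
    fun _ hki hkj => hc.jmul_jmul_zero hij hki hkj x⟩

lemma peirce_commute (hc : IsCSOI c) {i j : Fin r} (hij : i ≠ j) {a : V} (ha : a ∈ peirce c i j) :
    Commute (L (c i) + L (c j)) (L a) := by
  rw [← map_add]
  obtain ⟨h1, h2, -⟩ := mem_peirce_iff.1 ha
  refine commute_L_of_one ?_ ?_
  · rw [map_add, LinearMap.add_apply, h1, h2]; module
  · simp [hc.idem, hc.orth i j hij, hc.orth j i hij.symm]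

lemma box_apply (a b x : V) :
    box a b x = jmul (jmul a b) x + (jmul a (jmul b x) - jmul b (jmul a x)) := by
  simp [box]

lemma box_peirce_apply_self (hc : IsCSOI c) {i j : Fin r} {a : V}
    (ha : a ∈ peirce c i j) : box a (c j) (c j) = (1 / 2 : ℝ) • a := by
  obtain ⟨-, h2, -⟩ := mem_peirce_iff.1 ha
  rw [box_apply, hc.idem, jmul_comm a, h2, jmul_comm _ (c j)]
  simp only [map_smul, h2]
  module

lemma box_peirce_apply_of_ne (hc : IsCSOI c) {i j k : Fin r} (hij : i ≠ j) (hk : k ≠ j) {a : V}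
    (ha : a ∈ peirce c i j) : box a (c j) (c k) = 0 := by
  obtain ⟨h1, h2, h3⟩ := mem_peirce_iff.1 ha
  rw [box_apply, hc.orth j k hk.symm, jmul_comm a (c j), h2, jmul_comm _ (c k), jmul_comm a (c k)]
  by_cases hki : k = i
  · subst hki
    simp only [map_smul, h1, h2]; simp
  · simp [h3 k hki hk]

/-- The bracket relations between `𝔞` and the root vectors. -/
lemma L_bracket_box (hc : IsCSOI c) {i j : Fin r} (hij : i ≠ j) {a : V} (ha : a ∈ peirce c i j)
    (k : Fin r) : L (c k) * box a (c j) - box a (c j) * L (c k) =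
      ((if k = i then 1 / 2 else 0) - (if k = j then 1 / 2 else 0) : ℝ) • box a (c j) := by
  obtain ⟨h1, h2, h3⟩ := mem_peirce_iff.1 ha
  have hcomm := (peirce_commute hc hij ha).eq
  have hB := L_bracket_bracket a (c j) (c k)
  have hbox : box a (c j) = (1 / 2 : ℝ) • L a + (L a * L (c j) - L (c j) * L a) := by
    rw [box, jmul_comm, h2, map_smul]
  have hgen : L (c k) * box a (c j) - box a (c j) * L (c k) =
      (1 / 2 : ℝ) • (L (c k) * L a - L a * L (c k)) -
        L (jmul a (jmul (c j) (c k)) - jmul (c j) (jmul a (c k))) := by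
    rw [hbox, ← hB]
    simp only [mul_add, add_mul, mul_smul_comm, smul_mul_assoc]
    module
  rw [hgen, hbox, jmul_comm a (c k)]
  simp only [add_mul, mul_add] at hcomm
  by_cases hki : k = i
  · subst hki
    simp only [h1, h2, hc.orth j k hij.symm, map_zero, zero_sub, map_smul, if_true, if_neg hij, map_neg]
    linear_combination (norm := module) (1 / 2 : ℝ) • hcomm
  · by_cases hkj : k = j
    · subst hkj
      simp only [h2, hc.idem, jmul_comm a (c k), map_smul, if_neg hki, if_true, map_sub]
      module
    · have hz := (commute_L_of_zero (h3 k hki hkj) (hc.idem k)).eq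
      rw [h3 k hki hkj, hc.orth j k (Ne.symm hkj), map_zero, map_zero, sub_zero, map_zero, hz]
      simp [hki, hkj]

/-! ### Root decomposition of the structure algebra. -/

lemma IsJordanFrame.exists_smul (hc : IsJordanFrame c) (i : Fin r) (x : V) :
    P (c i) x = (⟪c i, x⟫_ℝ / ⟪c i, c i⟫_ℝ) • c i := (hc.1 i).P_apply x

/-- The coefficient of `X c_j` on `c_j`. -/
def diagCoeff (c : Fin r → V) (X : V →L[ℝ] V) (j : Fin r) : ℝ := ⟪c j, X (c j)⟫_ℝ / ⟪c j, c j⟫_ℝ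

/-- The polynomial `1 - 3t + 2t²` is the projection onto `V(p, 0)`. Subtracting `L(X e)` from `X`
leaves a derivation, which maps `p` into `V(p, 1/2)`, while `L(X e) p = p (X e)` has no component in
`V(p, 0)`. -/
lemma IsStr.zero_part {X : V →L[ℝ] V} (hX : IsStr X) {p : V} (hp : jmul p p = p) :
    X p - (3 : ℝ) • jmul p (X p) + (2 : ℝ) • jmul p (jmul p (X p)) = 0 := by
  set D := X - L (X e) with hD
  have hDs : IsStr D := (strAlg V).sub_mem hX (isStr_L _)
  have hDe : D e = 0 := by simp [hD, jmul_e]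
  have h1 := congrArg (fun A : V →L[ℝ] V => A p) (hDs.derivation hDe p)
  simp only [sub_apply, mul_apply_eq_comp, L_apply, hp, jmul_comm (D p) p] at h1
  have h2 : X p = D p + jmul p (X e) := by simp [hD, jmul_comm p]
  have h3 := jmul_cube hp (X e)
  have h4 : jmul p (D p) = (1 / 2 : ℝ) • D p := by
    linear_combination (norm := module) (-1 / 2 : ℝ) • h1
  rw [h2]
  simp only [map_add, h4, map_smul]
  linear_combination (norm := module) (1 : ℝ) • h3

/-- For `i ≠ j` the projection onto `V_{ij}` is `4 L(c_i) L(c_j)`. Since `X c_j` has no component in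
`V(c_j, 0)`, only the line of `c_j` and the `V_{ij}` occur. -/
lemma IsStr.apply_frame {X : V →L[ℝ] V} (hX : IsStr X) (hc : IsJordanFrame c) (j : Fin r) :
    X (c j) = diagCoeff c X j • c j +
      ∑ i ∈ Finset.univ.erase j, (4 : ℝ) • jmul (c i) (jmul (c j) (X (c j))) := by
  have hcs := hc.isCSOI
  have h1 := hX.zero_part (hcs.idem j)
  have h2 := hc.exists_smul j (X (c j))
  set v := X (c j) with hv
  set w := jmul (c j) v - jmul (c j) (jmul (c j) v) with hw
  have h3 := jmul_half_part (hcs.idem j) v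
  have h4 : w = ∑ i, jmul (c i) w := by
    rw [← LinearMap.sum_apply, ← map_sum, hcs.sum, e_jmul]
  rw [← Finset.add_sum_erase _ _ (Finset.mem_univ j)] at h4
  rw [← hw] at h3
  have h5 : ∀ i ∈ Finset.univ.erase j, jmul (c i) w = (1 / 2 : ℝ) • jmul (c i) (jmul (c j) v) := by
    intro i hi
    have hij := Finset.ne_of_mem_erase hi
    rw [hw, map_sub, jmul_left_comm_of_commute (hcs.commute i j) (jmul (c j) v),
      hcs.jmul_jmul_half' hij]
    module
  rw [Finset.sum_congr rfl h5, ← Finset.smul_sum] at h4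
  rw [P_apply, hcs.idem] at h2
  rw [← Finset.smul_sum, diagCoeff, ← hv]
  linear_combination (norm := module) (1 : ℝ) • h1 + (1 : ℝ) • h2 + (8 : ℝ) • h4 + (8 : ℝ) • h3 +
    (-4 : ℝ) • hw

lemma IsStr.tr_eq_zero {X : V →L[ℝ] V} (hX : IsStr X) (he : X e = 0) : tr V X = 0 := by
  have h1 := hX.adjoint_eq
  rw [he, map_zero, smul_zero, zero_sub] at h1
  have h2 : tr V X = ∑ i, ⟪stdOrthonormalBasis ℝ V i, X (stdOrthonormalBasis ℝ V i)⟫_ℝ :=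
    LinearMap.trace_eq_sum_inner (X : V →ₗ[ℝ] V) (stdOrthonormalBasis ℝ V)
  rw [h2]
  refine Finset.sum_eq_zero fun i _ => ?_
  have h3 := ContinuousLinearMap.adjoint_inner_left X (stdOrthonormalBasis ℝ V i)
    (stdOrthonormalBasis ℝ V i)
  rw [h1, neg_apply, inner_neg_left, real_inner_comm] at h3
  linarith

lemma mem_mSub {Y : V →L[ℝ] V} (hY : IsStr Y) (he : Y e = 0) (hc : ∀ j, Y (c j) = 0) :
    Y ∈ mSub c := by
  refine Submodule.subset_span ⟨fun t => ⟨expU (t • Y), ⟨expU_mem_G ((strAlg V).smul_mem t hY), ?_⟩,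
    rfl⟩, fun j => ?_⟩
  · exact exp_apply_fixed (by simp [he])
  · rw [← sub_eq_zero, hY.derivation he, hc, map_zero]

/-- The decomposition of an element of the structure algebra along the restricted root spaces. -/
lemma IsStr.exists_decomposition {X : V →L[ℝ] V} (hX : IsStr X) (hc : IsJordanFrame c) :
    ∃ Y : V →L[ℝ] V, IsStr Y ∧ Y e = 0 ∧ (∀ j, Y (c j) = 0) ∧
      X = Y + ∑ j, diagCoeff c X j • L (c j) +
        ∑ j, ∑ i ∈ Finset.univ.erase j, box ((8 : ℝ) • jmul (c i) (jmul (c j) (X (c j)))) (c j) := by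
  classical
  have hcs := hc.isCSOI
  set A := ∑ j, diagCoeff c X j • L (c j)
  -- Since `(a □ c_j) c_j = a / 2`, the factor `8 = 2 · 4` makes `B c_j` the off-diagonal part of `X
  -- c_j`.
  set B := ∑ j, ∑ i ∈ Finset.univ.erase j,
    box ((8 : ℝ) • jmul (c i) (jmul (c j) (X (c j)))) (c j)
  have hY : ∀ k, (X - A - B) (c k) = 0 := by
    intro k
    have hA : A (c k) = diagCoeff c X k • c k := by
      simp only [A, sum_apply, smul_apply, L_apply]
      rw [Finset.sum_eq_single k]
      · rw [hcs.idem]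
      · intro j _ hj; rw [hcs.orth j k hj, smul_zero]
      · simp
    have hB : B (c k) = ∑ i ∈ Finset.univ.erase k, (4 : ℝ) • jmul (c i) (jmul (c k) (X (c k))) := by
      simp only [B, sum_apply]
      rw [Finset.sum_eq_single k]
      · refine Finset.sum_congr rfl fun i hi => ?_
        rw [box_peirce_apply_self hcs (Submodule.smul_mem _ _
          (hcs.jmul_jmul_mem_peirce (Finset.ne_of_mem_erase hi) _))]
        module
      · intro j _ hj
        refine Finset.sum_eq_zero fun i hi => ?_
        exact box_peirce_apply_of_ne hcs (Finset.ne_of_mem_erase hi) hj.symm (Submodule.smul_mem _ _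
          (hcs.jmul_jmul_mem_peirce (Finset.ne_of_mem_erase hi) _))
      · simp
    rw [sub_apply, sub_apply, hA, hB]
    nth_rewrite 1 [hX.apply_frame hc k]
    abel
  refine ⟨X - A - B, ?_, ?_, hY, by abel⟩
  · refine (strAlg V).sub_mem ((strAlg V).sub_mem hX ?_) ?_
    · exact Submodule.sum_mem _ fun j _ => Submodule.smul_mem _ _ (isStr_L _)
    · exact Submodule.sum_mem _ fun j _ => Submodule.sum_mem _ fun i _ => isStr_box _ _
  · rw [← hc.2.2, map_sum]
    exact Finset.sum_eq_zero fun k _ => hY k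

lemma inner_e_peirce (hc : IsCSOI c) {i j : Fin r} {a : V} (ha : a ∈ peirce c i j) :
    ⟪e, a⟫_ℝ = 0 := by
  obtain ⟨h1, -, -⟩ := mem_peirce_iff.1 ha
  have h2 : ⟪c i, a⟫_ℝ = 0 := by
    have h := inner_jmul_left (c i) (c i) a
    rw [hc.idem, h1, inner_smul_right] at h
    linarith
  have h := inner_jmul_left (c i) e a
  rw [jmul_e, h2, h1, inner_smul_right] at h
  linarith

lemma tr_box_peirce (hV : IsSimple V) (hc : IsCSOI c) {i j : Fin r} {a : V}
    (ha : a ∈ peirce c i j) : tr V (box a (c j)) = 0 := by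
  obtain ⟨b, -, hb⟩ := exists_tr_L hV
  obtain ⟨-, h2, -⟩ := mem_peirce_iff.1 ha
  rw [box, map_add, map_sub, tr_mul_comm, sub_self, add_zero, hb, jmul_comm, h2, inner_smul_right,
    inner_e_peirce hc ha]
  simp

lemma tr_L_frame (hV : IsSimple V) (hc : IsJordanFrame c) (j : Fin r) :
    (r : ℝ) * tr V (L (c j)) = Module.finrank ℝ V := by
  classical
  have := hc.tr_L_mul hV hc (Pi.single j 1)
  simpa [Pi.single_apply, ite_smul] using this

/-- In the root decomposition only the `L(c_j)` have a trace, and it is the same for all `j`. -/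
lemma IsStr.sum_diagCoeff (hV : IsSimple V) {X : V →L[ℝ] V} (hX : IsStr X) (hc : IsJordanFrame c)
    (htr : tr V X = 0) : ∑ j, diagCoeff c X j = 0 := by
  obtain ⟨Y, hY, hYe, -, hXY⟩ := hX.exists_decomposition hc
  have hcs := hc.isCSOI
  have h1 := congrArg (fun A => (r : ℝ) * tr V A) hXY
  simp only [map_add, htr, hY.tr_eq_zero hYe, map_sum, map_smul, smul_eq_mul] at h1
  rw [Finset.sum_eq_zero (f := fun j => ∑ i ∈ Finset.univ.erase j, tr V (box _ _))
    (fun j _ => Finset.sum_eq_zero fun i hi => tr_box_peirce hV hcs (Submodule.smul_mem _ _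
      (hcs.jmul_jmul_mem_peirce (Finset.ne_of_mem_erase hi) _))), mul_zero, zero_add, add_zero,
    Finset.mul_sum] at h1
  have h2 : ∀ j, (r : ℝ) * (diagCoeff c X j * tr V (L (c j))) =
      diagCoeff c X j * Module.finrank ℝ V := fun j => by
    rw [← tr_L_frame hV hc j]; ring
  rw [Finset.sum_congr rfl fun j _ => h2 j, ← Finset.sum_mul] at h1
  exact (mul_eq_zero.1 h1.symm).resolve_right (finrank_pos_of_isSimple hV).ne'

end

variable {r : ℕ} {c : Fin r → V} {l : ℕ}

/-! ### The grading of `V` defined by `𝔞_l` -/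

/-- The weights of the grading element. -/
def wt (l : ℕ) {r : ℕ} (i : Fin r) : ℕ := l - i

/-- The projection onto the Peirce space `V_{ij}` (half of it, if `i ≠ j`). -/
def pc (c : Fin r → V) (i j : Fin r) : V →L[ℝ] V :=
  (2 : ℝ) • (L (c i) * L (c j)) - if i = j then L (c i) else 0

lemma pc_comm (hc : IsCSOI c) (i j : Fin r) : pc c i j = pc c j i := by
  unfold pc
  by_cases h : i = j
  · subst h; rfl
  · rw [(hc.commute i j).eq, if_neg h, if_neg (Ne.symm h)]

lemma pc_self (hc : IsCSOI c) (i : Fin r) : pc c i i = P (c i) := by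
  simp [pc, P, hc.idem]

lemma L_mul_pc (hc : IsCSOI c) (i j k : Fin r) : L (c k) * pc c i j =
    ((if k = i then 1 / 2 else 0) + (if k = j then 1 / 2 else 0) : ℝ) • pc c i j := by
  by_cases hij : i = j
  · subst hij
    rw [pc_self hc]
    ext x
    rw [mul_apply_eq_comp, L_apply, smul_apply]
    by_cases hk : k = i
    · subst hk
      rw [jmul_P (hc.idem k)]
      simp only [if_true]; module
    · rw [jmul_comm, jmul_one_zero (hc.idem i) (jmul_P (hc.idem i) x) (hc.orth i k (Ne.symm hk))]
      simp [hk]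
  · ext x
    simp only [pc, if_neg hij, sub_zero, mul_apply_eq_comp, smul_apply, L_apply, map_smul]
    by_cases hki : k = i
    · subst hki
      rw [hc.jmul_jmul_half hij]
      simp only [if_true, if_neg hij]; module
    · by_cases hkj : k = j
      · subst hkj
        rw [hc.jmul_jmul_half' hij]
        simp only [if_true, if_neg hki]; module
      · rw [hc.jmul_jmul_zero hij hki hkj]
        simp [hki, hkj]

lemma commute_L_pc (hc : IsCSOI c) (i j k : Fin r) : Commute (L (c k)) (pc c i j) := by
  unfold pc
  refine (((hc.commute k i).mul_right (hc.commute k j)).smul_right _).sub_right ?_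
  split_ifs
  · exact hc.commute k i
  · exact Commute.zero_right _

lemma sum_pc (hc : IsCSOI c) : ∑ i, ∑ j, pc c i j = 1 := by
  simp only [pc, Finset.sum_sub_distrib, Finset.sum_ite_eq, Finset.mem_univ, if_true,
    ← Finset.smul_sum, ← Finset.mul_sum, hc.sum_L, mul_one]
  module

variable (c l) in
/-- The grading element. -/
def gradEl : V := ∑ i, (wt l i : ℝ) • c i

variable (c l) in
/-- The grading operator. -/
def gradOp : V →L[ℝ] V := (2 : ℝ) • L (gradEl c l)

lemma gradOp_eq : gradOp c l = ∑ k, (2 * wt l k : ℝ) • L (c k) := by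
  simp only [gradOp, gradEl, map_sum, map_smul, Finset.smul_sum, smul_smul]

lemma gradOp_mul_pc (hc : IsCSOI c) (i j : Fin r) :
    gradOp c l * pc c i j = ((wt l i + wt l j : ℕ) : ℝ) • pc c i j := by
  rw [gradOp_eq, Finset.sum_mul]
  simp only [smul_mul_assoc, L_mul_pc hc, smul_smul, ← Finset.sum_smul, mul_add, mul_ite, mul_zero,
    Finset.sum_add_distrib, Finset.sum_ite_eq', Finset.mem_univ, if_true]
  congr 1
  push_cast; ring

variable (c l) in
/-- The projections of the grading. -/
def gr (t : ℕ) : V →L[ℝ] V := ∑ i, ∑ j, if wt l i + wt l j = t then pc c i j else 0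

lemma gradOp_mul_gr (hc : IsCSOI c) (t : ℕ) : gradOp c l * gr c l t = (t : ℝ) • gr c l t := by
  simp only [gr, Finset.mul_sum, Finset.smul_sum]
  refine Finset.sum_congr rfl fun i _ => Finset.sum_congr rfl fun j _ => ?_
  split_ifs with h
  · rw [gradOp_mul_pc hc, h]
  · simp

lemma commute_L_gr (hc : IsCSOI c) (k : Fin r) (t : ℕ) : Commute (L (c k)) (gr c l t) :=
  Commute.sum_right _ _ _ fun i _ => Commute.sum_right _ _ _ fun j _ => by
    split_ifs
    · exact commute_L_pc hc i j k
    · exact Commute.zero_right _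

lemma commute_gradOp_gr (hc : IsCSOI c) (t : ℕ) : Commute (gradOp c l) (gr c l t) := by
  rw [gradOp_eq]
  exact Commute.sum_left _ _ _ fun k _ => (commute_L_gr hc k t).smul_left _

lemma gr_mul_gradOp (hc : IsCSOI c) (t : ℕ) : gr c l t * gradOp c l = (t : ℝ) • gr c l t := by
  rw [← (commute_gradOp_gr hc t).eq, gradOp_mul_gr hc]

lemma sum_gr (hc : IsCSOI c) : ∑ t ∈ Finset.range (2 * l + 1), gr c l t = 1 := by
  unfold gr
  rw [Finset.sum_comm, ← sum_pc hc]
  refine Finset.sum_congr rfl fun i _ => ?_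
  rw [Finset.sum_comm]
  refine Finset.sum_congr rfl fun j _ => ?_
  rw [Finset.sum_ite_eq, if_pos]
  simp only [Finset.mem_range, wt]; omega

lemma gr_mul_gr_of_ne (hc : IsCSOI c) {s t : ℕ} (h : s ≠ t) : gr c l s * gr c l t = 0 := by
  have h1 : (s : ℝ) • (gr c l s * gr c l t) = (t : ℝ) • (gr c l s * gr c l t) := by
    rw [← smul_mul_assoc, ← gr_mul_gradOp hc, mul_assoc, gradOp_mul_gr hc, mul_smul_comm]
  rw [← sub_eq_zero, ← sub_smul] at h1
  exact (smul_eq_zero.1 h1).resolve_left (sub_ne_zero.2 (by exact_mod_cast h))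

lemma gr_eq_zero {t : ℕ} (h : 2 * l < t) : gr c l t = 0 :=
  Finset.sum_eq_zero fun i _ => Finset.sum_eq_zero fun j _ => if_neg (by simp only [wt]; omega)

lemma gr_mul_self (hc : IsCSOI c) (t : ℕ) : gr c l t * gr c l t = gr c l t := by
  by_cases ht : 2 * l < t
  · simp [gr_eq_zero ht]
  have h := congrArg (fun A => gr c l t * A) (sum_gr (l := l) hc)
  simp only [Finset.mul_sum, mul_one] at h
  rw [Finset.sum_eq_single t (fun s _ hs => gr_mul_gr_of_ne hc hs.symm)
    (fun h => absurd (Finset.mem_range.2 (by omega)) h)] at h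
  exact h

lemma gr_apply_of_eigen (hc : IsCSOI c) {d : ℕ} {v : V} (hv : gradOp c l v = (d : ℝ) • v) {t : ℕ}
    (h : t ≠ d) : gr c l t v = 0 := by
  have h1 := congrArg (fun A : V →L[ℝ] V => A v) (gr_mul_gradOp (l := l) hc t)
  simp only [mul_apply_eq_comp, hv, map_smul, smul_apply] at h1
  rw [← sub_eq_zero, ← sub_smul] at h1
  exact (smul_eq_zero.1 h1).resolve_left (sub_ne_zero.2 (by exact_mod_cast h.symm))

lemma gr_apply_self_of_eigen (hc : IsCSOI c) {d : ℕ} {v : V}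
    (hv : gradOp c l v = (d : ℝ) • v) : gr c l d v = v := by
  have h := congrArg (fun A : V →L[ℝ] V => A v) (sum_gr (l := l) hc)
  simp only [sum_apply, one_apply_eq_self] at h
  by_cases hd : d ∈ Finset.range (2 * l + 1)
  · rwa [Finset.sum_eq_single_of_mem d hd (fun t _ ht => gr_apply_of_eigen hc hv ht)] at h
  · rw [Finset.sum_eq_zero fun t ht => gr_apply_of_eigen hc hv (fun h => hd (h ▸ ht))] at h
    rw [← h, map_zero]

lemma adjoint_pc (hc : IsCSOI c) (i j : Fin r) : ContinuousLinearMap.adjoint (pc c i j) = pc c i j := by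
  unfold pc
  rw [map_sub, map_smulₛₗ, adjoint_mul, adjoint_L, adjoint_L, (hc.commute j i).eq]
  congr 1
  split_ifs <;> simp [adjoint_L]

lemma adjoint_gr (hc : IsCSOI c) (t : ℕ) : ContinuousLinearMap.adjoint (gr c l t) = gr c l t := by
  unfold gr
  simp only [map_sum]
  refine Finset.sum_congr rfl fun i _ => Finset.sum_congr rfl fun j _ => ?_
  split_ifs
  · exact adjoint_pc hc i j
  · simp

lemma inner_gr (hc : IsCSOI c) (t : ℕ) (x y : V) : ⟪gr c l t x, y⟫_ℝ = ⟪x, gr c l t y⟫_ℝ := by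
  rw [← ContinuousLinearMap.adjoint_inner_right, adjoint_gr hc]

lemma gradOp_frame (hc : IsCSOI c) (j : Fin r) :
    gradOp c l (c j) = ((2 * wt l j : ℕ) : ℝ) • c j := by
  rw [gradOp, gradEl, smul_apply, L_apply, jmul_comm, hc.jmul_sum, smul_smul]
  push_cast; rfl

lemma gradOp_peirce {i j : Fin r} (hij : i ≠ j) {a : V} (ha : a ∈ peirce c i j) :
    gradOp c l a = ((wt l i + wt l j : ℕ) : ℝ) • a := by
  classical
  obtain ⟨h1, h2, h3⟩ := mem_peirce_iff.1 ha
  rw [gradOp_eq]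
  simp only [sum_apply, smul_apply, L_apply]
  rw [← Finset.sum_subset (Finset.subset_univ {i, j})]
  · rw [Finset.sum_pair hij, h1, h2]
    push_cast; module
  · intro k _ hk
    simp only [Finset.mem_insert, Finset.mem_singleton, not_or] at hk
    rw [h3 k hk.1 hk.2, smul_zero]

/-! ### Operators that raise the degree -/

variable (c l) in
/-- The operators that raise the degree by at least `p`. -/
def shift (p : ℕ) : Submodule ℝ (V →L[ℝ] V) where
  carrier := {X | ∀ s t, t < s + p → gr c l t * X * gr c l s = 0}
  add_mem' hX hY s t h := by rw [mul_add, add_mul, hX s t h, hY s t h, add_zero]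
  zero_mem' s t h := by simp
  smul_mem' a X hX s t h := by rw [mul_smul_comm, smul_mul_assoc, hX s t h, smul_zero]

lemma eq_sum_gr (hc : IsCSOI c) (X : V →L[ℝ] V) : X = ∑ t ∈ Finset.range (2 * l + 1),
    ∑ s ∈ Finset.range (2 * l + 1), gr c l t * X * gr c l s := by
  simp only [← Finset.mul_sum, ← Finset.sum_mul, sum_gr hc, one_mul, mul_one]

lemma shift_mono {p q : ℕ} (h : p ≤ q) : shift c l q ≤ shift c l p :=
  fun _ hX s t hst => hX s t (by omega)

lemma one_mem_shift (hc : IsCSOI c) : (1 : V →L[ℝ] V) ∈ shift c l 0 := fun s t h => by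
  rw [mul_one, gr_mul_gr_of_ne hc (by omega)]

lemma mul_mem_shift (hc : IsCSOI c) {p q : ℕ} {X Y : V →L[ℝ] V} (hX : X ∈ shift c l p)
    (hY : Y ∈ shift c l q) : X * Y ∈ shift c l (p + q) := by
  intro s t h
  have h1 : gr c l t * (X * Y) * gr c l s =
      ∑ u ∈ Finset.range (2 * l + 1), (gr c l t * X * gr c l u) * (gr c l u * Y * gr c l s) := by
    have h2 : ∀ u, (gr c l t * X * gr c l u) * (gr c l u * Y * gr c l s) =
        gr c l t * X * gr c l u * (Y * gr c l s) := fun u => by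
      rw [mul_assoc (gr c l u) Y, ← mul_assoc (gr c l t * X * gr c l u) (gr c l u),
        mul_assoc (gr c l t * X) (gr c l u) (gr c l u), gr_mul_self hc]
    rw [Finset.sum_congr rfl fun u _ => h2 u, ← Finset.sum_mul, ← Finset.mul_sum, sum_gr hc, mul_one]
    simp only [mul_assoc]
  rw [h1]
  refine Finset.sum_eq_zero fun u _ => ?_
  by_cases hu : u < s + q
  · rw [hY s u hu, mul_zero]
  · rw [hX u t (by omega), zero_mul]

lemma eq_zero_of_mem_shift (hc : IsCSOI c) {p : ℕ} (hp : 2 * l < p) {X : V →L[ℝ] V}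
    (hX : X ∈ shift c l p) : X = 0 := by
  rw [eq_sum_gr (l := l) hc X]
  refine Finset.sum_eq_zero fun t ht => Finset.sum_eq_zero fun s _ => hX s t ?_
  have := Finset.mem_range.1 ht
  omega

/-- An eigenvector of the commutator with the grading operator, of eigenvalue `p`, raises every
degree by exactly `p`. -/
lemma gr_mul_of_bracket (hc : IsCSOI c) {X : V →L[ℝ] V} {p : ℕ}
    (h : gradOp c l * X - X * gradOp c l = (p : ℝ) • X) {s t : ℕ} (hst : t ≠ s + p) :
    gr c l t * X * gr c l s = 0 := by
  have h1 := congrArg (fun A => gr c l t * A * gr c l s) h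
  have h2 : gr c l t * (gradOp c l * X - X * gradOp c l) * gr c l s =
      (t : ℝ) • (gr c l t * X * gr c l s) - (s : ℝ) • (gr c l t * X * gr c l s) := by
    rw [mul_sub, sub_mul, ← mul_assoc, gr_mul_gradOp hc, ← mul_assoc, mul_assoc _ (gradOp c l),
      gradOp_mul_gr hc]
    simp only [smul_mul_assoc, mul_smul_comm]
  simp only [h2, mul_smul_comm, smul_mul_assoc] at h1
  rw [← sub_smul, ← sub_eq_zero, ← sub_smul] at h1
  refine (smul_eq_zero.1 h1).resolve_left fun h3 => hst ?_
  have h4 : (t : ℝ) = s + p := by linarith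
  exact_mod_cast h4

lemma mem_shift_of_bracket (hc : IsCSOI c) {X : V →L[ℝ] V} {p : ℕ}
    (h : gradOp c l * X - X * gradOp c l = (p : ℝ) • X) : X ∈ shift c l p :=
  fun s t hst => gr_mul_of_bracket hc h (by omega)

lemma gr_mul_of_commute (hc : IsCSOI c) {X : V →L[ℝ] V} (h : Commute (gradOp c l) X) {s t : ℕ}
    (hst : t ≠ s) : gr c l t * X * gr c l s = 0 :=
  gr_mul_of_bracket (p := 0) hc (by rw [h.eq]; simp) (by simpa using hst)

lemma mem_shift_of_commute (hc : IsCSOI c) {X : V →L[ℝ] V} (h : Commute (gradOp c l) X) :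
    X ∈ shift c l 0 := fun s t hst => gr_mul_of_commute hc h (by omega)

lemma eq_zero_of_commute_of_mem_shift (hc : IsCSOI c) {X : V →L[ℝ] V}
    (h : Commute (gradOp c l) X) (hX : X ∈ shift c l 1) : X = 0 := by
  rw [eq_sum_gr (l := l) hc X]
  refine Finset.sum_eq_zero fun t _ => Finset.sum_eq_zero fun s _ => ?_
  by_cases hst : t = s
  · exact hX s t (by omega)
  · exact gr_mul_of_commute hc h hst

lemma pow_mem_shift (hc : IsCSOI c) {X : V →L[ℝ] V} {p : ℕ} (hX : X ∈ shift c l p) (n : ℕ) :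
    X ^ n ∈ shift c l (n * p) := by
  induction n with
  | zero => simpa using one_mem_shift hc
  | succ n ih => rw [pow_succ, Nat.succ_mul]; exact mul_mem_shift hc ih hX

lemma hasSum_gr_exp (X : V →L[ℝ] V) (s t : ℕ) :
    HasSum (fun n : ℕ => ((n.factorial : ℝ)⁻¹) • (gr c l t * X ^ n * gr c l s))
      (gr c l t * NormedSpace.exp X * gr c l s) := by
  have h := ((NormedSpace.exp_series_hasSum_exp' (𝕂 := ℝ) X).mul_left (gr c l t)).mul_right
    (gr c l s)
  simpa only [mul_smul_comm, smul_mul_assoc] using h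

lemma exp_mem_shift (hc : IsCSOI c) {X : V →L[ℝ] V} (hX : X ∈ shift c l 0) :
    NormedSpace.exp X ∈ shift c l 0 := by
  intro s t h
  refine (hasSum_gr_exp X s t).unique ?_
  have : (fun n : ℕ => ((n.factorial : ℝ)⁻¹) • (gr c l t * X ^ n * gr c l s)) = fun _ => 0 := by
    funext n
    rw [pow_mem_shift hc hX n s t (by simpa using h), smul_zero]
  rw [this]; exact hasSum_zero

/-- In `(X + Z)^{n+1} - X^{n+1}` every word contains a factor `Z`, of degree at least `p`, and `n`
other factors of degree at least one. So only `n = 0` contributes below degree `p + 1`. -/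
lemma exp_add_sub_mem_shift (hc : IsCSOI c) {X Z : V →L[ℝ] V} {p : ℕ} (hp : 1 ≤ p)
    (hX : X ∈ shift c l 1) (hZ : Z ∈ shift c l p) :
    NormedSpace.exp (X + Z) - NormedSpace.exp X - Z ∈ shift c l (p + 1) := by
  have hXZ : X + Z ∈ shift c l 1 := Submodule.add_mem _ hX (shift_mono hp hZ)
  have key : ∀ n, (X + Z) ^ (n + 1) - X ^ (n + 1) ∈ shift c l (p + n) := by
    intro n
    induction n with
    | zero => simpa using hZ
    | succ n ih =>
      have h1 : (X + Z) ^ (n + 1 + 1) - X ^ (n + 1 + 1) =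
          (X + Z) * ((X + Z) ^ (n + 1) - X ^ (n + 1)) + Z * X ^ (n + 1) := by
        rw [pow_succ' (X + Z) (n + 1), pow_succ' X (n + 1)]; noncomm_ring
      rw [h1]
      refine Submodule.add_mem _ ?_ ?_
      · have := mul_mem_shift hc hXZ ih
        rwa [show 1 + (p + n) = p + (n + 1) by omega] at this
      · have := mul_mem_shift hc hZ (pow_mem_shift hc hX (n + 1))
        rwa [mul_one] at this
  intro s t h
  have h1 := (hasSum_gr_exp (c := c) (l := l) (X + Z) s t).sub (hasSum_gr_exp (c := c) (l := l) X s t)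
  have h2 := hasSum_single (f := fun n : ℕ =>
    ((n.factorial : ℝ)⁻¹) • (gr c l t * (X + Z) ^ n * gr c l s) -
    ((n.factorial : ℝ)⁻¹) • (gr c l t * X ^ n * gr c l s)) 1 (fun n hn => by
      rcases n with _ | _ | n
      · simp
      · exact absurd rfl hn
      · rw [← smul_sub, ← sub_mul, ← mul_sub, key (n + 1) s t (by omega), smul_zero])
  have h3 := h1.unique h2
  simp only [Nat.factorial_one, Nat.cast_one, inv_one, one_smul, pow_one, mul_add, add_mul] at h3
  rw [mul_sub, mul_sub, sub_mul, sub_mul, h3]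
  abel

lemma exp_sub_one_mem_shift (hc : IsCSOI c) {X : V →L[ℝ] V} (hX : X ∈ shift c l 1) :
    NormedSpace.exp X - 1 ∈ shift c l 1 := by
  have h := exp_add_sub_mem_shift hc le_rfl (Submodule.zero_mem _) hX
  rw [zero_add, NormedSpace.exp_zero] at h
  have := Submodule.add_mem _ (shift_mono (by omega) h) hX
  simpa using this

/-! ### Homogeneous components and rescaling. -/

variable (c l) in
/-- The component of degree `p` of an operator. -/
def comp (p : ℕ) (X : V →L[ℝ] V) : V →L[ℝ] V :=
  ∑ t ∈ Finset.range (2 * l + 1), ∑ s ∈ Finset.range (2 * l + 1),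
    if t = s + p then gr c l t * X * gr c l s else 0

lemma gr_comp (hc : IsCSOI c) (p : ℕ) (X : V →L[ℝ] V) (s t : ℕ) :
    gr c l t * comp c l p X * gr c l s = if t = s + p then gr c l t * X * gr c l s else 0 := by
  by_cases ht : 2 * l < t
  · simp [gr_eq_zero ht]
  by_cases hs : 2 * l < s
  · simp [gr_eq_zero hs]
  simp only [comp, Finset.mul_sum, Finset.sum_mul]
  rw [Finset.sum_eq_single t, Finset.sum_eq_single s]
  · split_ifs
    · rw [← mul_assoc, ← mul_assoc, gr_mul_self hc, mul_assoc _ (gr c l s), gr_mul_self hc]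
    · simp
  · intro s' _ hs'
    split_ifs
    · rw [mul_assoc _ _ (gr c l s), mul_assoc _ (gr c l s'), gr_mul_gr_of_ne hc hs']; simp
    · simp
  · intro h; exact absurd (Finset.mem_range.2 (by omega)) h
  · intro t' _ ht'
    refine Finset.sum_eq_zero fun s' _ => ?_
    split_ifs
    · rw [← mul_assoc, ← mul_assoc, gr_mul_gr_of_ne hc ht'.symm]; simp
    · simp
  · intro h; exact absurd (Finset.mem_range.2 (by omega)) h

lemma comp_mem_shift (hc : IsCSOI c) (p : ℕ) (X : V →L[ℝ] V) : comp c l p X ∈ shift c l p :=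
  fun s t h => by rw [gr_comp hc, if_neg (by omega)]

lemma sub_comp_mem_shift (hc : IsCSOI c) {p : ℕ} {X : V →L[ℝ] V} (hX : X ∈ shift c l p) :
    X - comp c l p X ∈ shift c l (p + 1) := fun s t h => by
  rw [mul_sub, sub_mul, gr_comp hc]
  split_ifs with h1
  · rw [sub_self]
  · rw [hX s t (by omega), sub_zero]

lemma commute_comp_zero (hc : IsCSOI c) (X : V →L[ℝ] V) : Commute (gradOp c l) (comp c l 0 X) := by
  simp only [comp, add_zero]
  refine Commute.sum_right _ _ _ fun t _ => Commute.sum_right _ _ _ fun s _ => ?_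
  split_ifs with h
  · subst h
    show _ = _
    rw [mul_assoc, ← mul_assoc, gradOp_mul_gr hc, mul_assoc, mul_assoc, gr_mul_gradOp hc]
    simp only [smul_mul_assoc, mul_smul_comm]
  · exact Commute.zero_right _

/-- The one-parameter group of the grading. -/
def dil (c : Fin r → V) (l : ℕ) (τ : ℝ) : GLV V := expU (Real.log τ • gradOp c l)

lemma dil_mem_G (τ : ℝ) : dil c l τ ∈ G V :=
  expU_mem_G ((strAlg V).smul_mem _ ((strAlg V).smul_mem _ (isStr_L _)))

lemma dil_mul_gr (hc : IsCSOI c) {τ : ℝ} (hτ : 0 < τ) (t : ℕ) :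
    (dil c l τ : V →L[ℝ] V) * gr c l t = τ ^ t • gr c l t := by
  ext x
  have h : (Real.log τ • gradOp c l) (gr c l t x) = (Real.log τ * t) • gr c l t x := by
    have := congrArg (fun A : V →L[ℝ] V => A x) (gradOp_mul_gr (l := l) hc t)
    simp only [mul_apply_eq_comp, smul_apply] at this
    rw [smul_apply, this, smul_smul]
  rw [mul_apply_eq_comp, dil, coe_expU, exp_apply_eigenvector h, smul_apply]
  congr 1
  rw [mul_comm, ← Real.log_pow, Real.exp_log (pow_pos hτ t)]

lemma gr_mul_dil_inv (hc : IsCSOI c) {τ : ℝ} (hτ : 0 < τ) (t : ℕ) :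
    gr c l t * (((dil c l τ)⁻¹ : GLV V) : V →L[ℝ] V) = (τ ^ t)⁻¹ • gr c l t := by
  have h1 : Commute (gr c l t) (((dil c l τ)⁻¹ : GLV V) : V →L[ℝ] V) := by
    rw [dil, coe_expU_inv]
    exact ((((commute_gradOp_gr hc t).symm).smul_right _).neg_right).exp_right
  rw [h1.eq, Units.inv_mul_eq_iff_eq_mul, mul_smul_comm, dil_mul_gr hc hτ, smul_smul,
    inv_mul_cancel₀ (pow_pos hτ t).ne', one_smul]

lemma dil_conj (hc : IsCSOI c) {τ : ℝ} (hτ : 0 < τ) (X : V →L[ℝ] V) :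
    (dil c l τ : V →L[ℝ] V) * X * (((dil c l τ)⁻¹ : GLV V) : V →L[ℝ] V) =
      ∑ t ∈ Finset.range (2 * l + 1), ∑ s ∈ Finset.range (2 * l + 1),
        (τ ^ t * (τ ^ s)⁻¹) • (gr c l t * X * gr c l s) := by
  conv_lhs => rw [eq_sum_gr (l := l) hc X]
  simp only [Finset.mul_sum, Finset.sum_mul]
  refine Finset.sum_congr rfl fun t _ => Finset.sum_congr rfl fun s _ => ?_
  rw [mul_assoc (gr c l t), ← mul_assoc, dil_mul_gr hc hτ, mul_assoc, mul_assoc X,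
    gr_mul_dil_inv hc hτ]
  simp only [smul_mul_assoc, mul_smul_comm, smul_smul]
  rw [mul_comm ((τ ^ s)⁻¹)]

/-- Rescaling by the one-parameter group of the grading isolates the lowest component. -/
lemma tendsto_dil_conj (hc : IsCSOI c) {p : ℕ} {X : V →L[ℝ] V} (hX : X ∈ shift c l p) :
    Filter.Tendsto (fun τ : ℝ => (τ ^ p)⁻¹ • ((dil c l τ : V →L[ℝ] V) * X *
      (((dil c l τ)⁻¹ : GLV V) : V →L[ℝ] V))) (nhdsWithin 0 (Set.Ioi 0)) (nhds (comp c l p X)) := by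
  have h : Filter.Tendsto (fun τ : ℝ => ∑ t ∈ Finset.range (2 * l + 1),
      ∑ s ∈ Finset.range (2 * l + 1), (if t < s + p then (0 : V →L[ℝ] V) else
        τ ^ (t - (s + p)) • (gr c l t * X * gr c l s))) (nhdsWithin 0 (Set.Ioi 0))
      (nhds (comp c l p X)) := by
    refine tendsto_finsetSum _ fun t _ => tendsto_finsetSum _ fun s _ => ?_
    by_cases h1 : t < s + p
    · simp only [if_pos h1, if_neg (show t ≠ s + p by omega)]
      exact tendsto_const_nhds
    · simp only [if_neg h1]
      have h2 : Filter.Tendsto (fun τ : ℝ => τ ^ (t - (s + p)) • (gr c l t * X * gr c l s))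
          (nhdsWithin 0 (Set.Ioi 0)) (nhds ((0 : ℝ) ^ (t - (s + p)) • (gr c l t * X * gr c l s))) :=
        (((continuous_pow _).tendsto 0).smul_const _).mono_left nhdsWithin_le_nhds
      convert h2 using 2
      split_ifs with h3
      · simp [h3]
      · rw [zero_pow (by omega), zero_smul]
  refine h.congr' ?_
  filter_upwards [self_mem_nhdsWithin] with τ hτ
  have hτ' : 0 < τ := hτ
  rw [dil_conj hc hτ', Finset.smul_sum]
  refine Finset.sum_congr rfl fun t _ => ?_
  rw [Finset.smul_sum]
  refine Finset.sum_congr rfl fun s _ => ?_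
  split_ifs with h1
  · rw [hX s t h1]; simp
  · rw [smul_smul]
    congr 1
    obtain ⟨k, rfl⟩ := Nat.exists_eq_add_of_le (not_lt.1 h1)
    rw [Nat.add_sub_cancel_left, pow_add, pow_add]
    field_simp

/-! ### The subalgebras `𝔪'_l`, `𝔫̄_l` and `𝔮'_l` of the structure algebra -/

lemma gradOp_bracket_box (hc : IsCSOI c) {i j : Fin r} (hij : i ≠ j) {a : V}
    (ha : a ∈ peirce c i j) : gradOp c l * box a (c j) - box a (c j) * gradOp c l =
      ((wt l i : ℝ) - wt l j) • box a (c j) := by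
  rw [gradOp_eq, Finset.sum_mul, Finset.mul_sum, ← Finset.sum_sub_distrib]
  simp only [smul_mul_assoc, mul_smul_comm, ← smul_sub, L_bracket_box hc hij ha, smul_smul,
    ← Finset.sum_smul, mul_sub, mul_ite, mul_zero, Finset.sum_sub_distrib, Finset.sum_ite_eq',
    Finset.mem_univ, if_true]
  congr 1
  ring

lemma commute_gradOp_L (hc : IsCSOI c) (j : Fin r) : Commute (gradOp c l) (L (c j)) := by
  rw [gradOp_eq]
  exact Commute.sum_left _ _ _ fun k _ => (hc.commute k j).smul_left _

lemma nBar_le_strAlg : nBar c l ≤ strAlg V :=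
  iSup_le fun _ => Submodule.span_le.2 (by rintro _ ⟨a, -, rfl⟩; exact isStr_box a _)

/-- The space `𝔤⁻_{ij}` has degree the weight of `i` minus that of `j`; this is positive because the
weights decrease strictly over the first `l` indices and vanish afterwards. -/
lemma nBar_le_shift (hc : IsCSOI c) : nBar c l ≤ shift c l 1 :=
  iSup_le fun p => Submodule.span_le.2 (by
    rintro _ ⟨a, ha, rfl⟩
    obtain ⟨⟨i, j⟩, hi, hij⟩ := p
    have h1 : wt l j + 1 ≤ wt l i := by simp only [wt]; simp only at hi hij; omega
    refine shift_mono (p := 1) (q := wt l i - wt l j) (by omega) (mem_shift_of_bracket hc ?_)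
    rw [gradOp_bracket_box hc hij.ne ha, Nat.cast_sub (by omega)])

lemma nBar_le_ker_tr (hV : IsSimple V) (hc : IsCSOI c) : nBar c l ≤ LinearMap.ker (tr V) :=
  iSup_le fun _ => Submodule.span_le.2 (by
    rintro _ ⟨a, ha, rfl⟩; exact tr_box_peirce hV hc ha)

/-- The elements of the Lie algebra of `K` belong to the structure algebra and annihilate `e`. -/
lemma isStr_of_mem_lieAlg (hV : IsSimple V) {X : V →L[ℝ] V} (hX : X ∈ lieAlg (K V)) :
    IsStr X ∧ X e = 0 := by
  have hK : ∀ t : ℝ, expU (t • X) ∈ K V := fun t => by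
    obtain ⟨g, hg, h⟩ := hX t
    rwa [show expU (t • X) = g from Units.ext h.symm]
  have hd : HasDerivAt (fun t : ℝ => NormedSpace.exp (t • X)) X 0 := by
    simpa using hasDerivAt_exp_smul_const (𝕂 := ℝ) X (0 : ℝ)
  have hl := hasDerivAt_iff_tendsto_slope_zero.1 hd
  simp only [zero_add, zero_smul, NormedSpace.exp_zero] at hl
  refine ⟨isStr_of_tendsto hV (l := nhdsWithin (0 : ℝ) {0}ᶜ) (g := fun t => expU (t • X)) (.of_forall fun t => G_le (hK t).1)
    (ε := fun t => t) (Filter.tendsto_id.mono_left nhdsWithin_le_nhds) self_mem_nhdsWithin hl, ?_⟩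
  have h2 := ((ContinuousLinearMap.apply ℝ V (e : V)).continuous.tendsto X).comp hl
  refine tendsto_nhds_unique h2 (tendsto_const_nhds.congr fun t => ?_)
  have h3 : NormedSpace.exp (t • X) (e : V) = e := (hK t).2
  simp [h3]

lemma mSub_spec (hV : IsSimple V) {X : V →L[ℝ] V} (hX : X ∈ lieAlg (K V))
    (h : ∀ j, X * L (c j) = L (c j) * X) (j : Fin r) : X (c j) = 0 := by
  have h1 := congrArg (fun A : V →L[ℝ] V => A e) (h j)
  simpa [jmul_e, (isStr_of_mem_lieAlg hV hX).2] using h1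

lemma sub_eSum (hc : IsCSOI c) : (e : V) - eSum c l = ∑ j : Fin r, if l ≤ (j : ℕ) then c j else 0 := by
  have h : eSum c l = ∑ j : Fin r, if (j : ℕ) < l then c j else 0 := by
    rw [eSum, ← Finset.sum_filter]
    exact (Finset.sum_subtype _ (by simp) c).symm
  rw [h, ← hc.sum, ← Finset.sum_sub_distrib]
  refine Finset.sum_congr rfl fun j _ => ?_
  by_cases hj : (j : ℕ) < l
  · simp [hj]
  · simp [hj, not_lt.1 hj]

lemma jmul_sub_eSum (hc : IsCSOI c) {k : Fin r} (hk : (k : ℕ) < l) :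
    jmul (e - eSum c l) (c k) = 0 := by
  rw [sub_eSum hc, map_sum, LinearMap.sum_apply]
  refine Finset.sum_eq_zero fun j _ => ?_
  split_ifs with h
  · exact hc.orth j k (by rintro rfl; omega)
  · simp

lemma L_sub_eSum (hc : IsCSOI c) :
    L ((e : V) - eSum c l) = ∑ j : Fin r, if l ≤ (j : ℕ) then L (c j) else 0 := by
  rw [sub_eSum hc, map_sum]
  exact Finset.sum_congr rfl fun j _ => by split_ifs <;> simp

lemma isStr_hVec (j : Fin r) : IsStr (hVec c l j) :=
  (strAlg V).sub_mem (isStr_L _) ((strAlg V).smul_mem _ (isStr_L _))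

lemma commute_gradOp_hVec (hc : IsCSOI c) (j : Fin r) : Commute (gradOp c l) (hVec c l j) := by
  refine (commute_gradOp_L hc j).sub_right (Commute.smul_right ?_ _)
  rw [L_sub_eSum hc]
  refine Commute.sum_right _ _ _ fun k _ => ?_
  split_ifs
  · exact commute_gradOp_L hc k
  · exact Commute.zero_right _

lemma sum_ite_le (hl : l ≤ r) {E : Type*} [AddCommGroup E] [Module ℝ E] (a : E) :
    ∑ j : Fin r, (if l ≤ (j : ℕ) then a else 0) = ((r : ℝ) - l) • a := by
  rw [Fin.sum_univ_eq_sum_range (fun j => if l ≤ j then a else 0) r]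
  obtain ⟨k, rfl⟩ := Nat.exists_eq_add_of_le hl
  rw [Finset.sum_range_add, Finset.sum_eq_zero fun j hj =>
    if_neg (not_le.2 (Finset.mem_range.1 hj))]
  simp [Nat.cast_smul_eq_nsmul]

lemma tr_hVec (hV : IsSimple V) (hc : IsJordanFrame c) (hlr : l < r) (j : Fin r) :
    tr V (hVec c l j) = 0 := by
  have hr : (0 : ℝ) < r := by exact_mod_cast (by omega : 0 < r)
  have hd : (0 : ℝ) < (r : ℝ) - l := sub_pos.2 (by exact_mod_cast hlr)
  have h1 : (r : ℝ) * tr V (L ((e : V) - eSum c l)) = (r - l) * Module.finrank ℝ V := by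
    rw [L_sub_eSum hc.isCSOI, map_sum, Finset.mul_sum, ← smul_eq_mul, ← sum_ite_le hlr.le]
    refine Finset.sum_congr rfl fun k _ => ?_
    split_ifs
    · exact tr_L_frame hV hc k
    · simp
  have h2 := tr_L_frame hV hc j
  have h3 : tr V (L ((e : V) - eSum c l)) = (r - l) * tr V (L (c j)) :=
    mul_left_cancel₀ hr.ne' (by linear_combination h1 - (r - l : ℝ) * h2)
  rw [hVec, map_sub, map_smul, smul_eq_mul, h3, inv_mul_cancel_left₀ hd.ne', sub_self]

lemma hVec_apply (hc : IsCSOI c) {j k : Fin r} (hj : l ≤ (j : ℕ)) (hk : (k : ℕ) < l) :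
    hVec c l j (c k) = 0 := by
  rw [hVec, sub_apply, smul_apply, L_apply, L_apply, jmul_sub_eSum hc hk,
    hc.orth j k (by rintro rfl; omega)]
  simp

/-- This relation makes the last `h_j` redundant, which is why `𝔪'_l` only lists `j ≤ r - 1`. -/
lemma sum_hVec (hc : IsCSOI c) (hlr : l < r) :
    ∑ j : Fin r, (if l ≤ (j : ℕ) then hVec c l j else 0) = 0 := by
  have hd : (r : ℝ) - l ≠ 0 := (sub_pos.2 (by exact_mod_cast hlr)).ne'
  have h : ∀ j : Fin r, (if l ≤ (j : ℕ) then hVec c l j else 0) =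
      (if l ≤ (j : ℕ) then L (c j) else 0) -
        if l ≤ (j : ℕ) then ((r : ℝ) - l)⁻¹ • L (e - eSum c l) else 0 := fun j => by
    split_ifs
    · rfl
    · simp
  simp only [h, Finset.sum_sub_distrib]
  rw [sum_ite_le hlr.le, ← L_sub_eSum hc, smul_smul, mul_inv_cancel₀ hd, one_smul, sub_self]

lemma sum_smul_hVec {ξ : Fin r → ℝ} (h : ∑ j, ξ j = 0) :
    ∑ j, ξ j • L (c j) = ∑ j, ξ j • hVec c l j := by
  simp only [hVec, smul_sub, Finset.sum_sub_distrib, ← Finset.sum_smul, h, zero_smul, sub_zero]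

variable (c l) in
/-- The elements of trace zero of the structure algebra that commute with the grading and
annihilate `c_1, …, c_l`. -/
def mStr : Submodule ℝ (V →L[ℝ] V) where
  carrier := {X | IsStr X ∧ tr V X = 0 ∧ Commute (gradOp c l) X ∧
    ∀ i : Fin r, (i : ℕ) < l → X (c i) = 0}
  add_mem' hX hY := ⟨(strAlg V).add_mem hX.1 hY.1, by rw [map_add, hX.2.1, hY.2.1, add_zero],
    hX.2.2.1.add_right hY.2.2.1, fun i hi => by
      rw [add_apply, hX.2.2.2 i hi, hY.2.2.2 i hi, add_zero]⟩
  zero_mem' := ⟨(strAlg V).zero_mem, map_zero _, Commute.zero_right _, fun _ _ => rfl⟩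
  smul_mem' a X hX := ⟨(strAlg V).smul_mem a hX.1, by rw [map_smul, hX.2.1, smul_zero],
    hX.2.2.1.smul_right a, fun i hi => by rw [smul_apply, hX.2.2.2 i hi, smul_zero]⟩

lemma box_mem_mStr (hV : IsSimple V) (hc : IsCSOI c) {i j : Fin r} (hij : i ≠ j) (hi : l ≤ (i : ℕ))
    (hj : l ≤ (j : ℕ)) {a : V} (ha : a ∈ peirce c i j) : box a (c j) ∈ mStr c l := by
  refine ⟨isStr_box _ _, tr_box_peirce hV hc ha, ?_, fun k hk =>
    box_peirce_apply_of_ne hc hij (by rintro rfl; omega) ha⟩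
  have h := gradOp_bracket_box (l := l) hc hij ha
  rw [show wt l i = 0 from Nat.sub_eq_zero_of_le hi, show wt l j = 0 from Nat.sub_eq_zero_of_le hj,
    sub_self, zero_smul, sub_eq_zero] at h
  exact h

lemma mSub'_le (hV : IsSimple V) (hc : IsJordanFrame c) (hlr : l < r) : mSub' c l ≤ mStr c l := by
  have hcs := hc.isCSOI
  refine sup_le (sup_le (Submodule.span_le.2 ?_) (Submodule.span_le.2 ?_)) (iSup_le ?_)
  · rintro X ⟨hX, h⟩
    obtain ⟨h1, h2⟩ := isStr_of_mem_lieAlg hV hX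
    refine ⟨h1, h1.tr_eq_zero h2, ?_, fun i _ => mSub_spec hV hX h i⟩
    rw [gradOp_eq]
    exact Commute.sum_left _ _ _ fun k _ => Commute.smul_left (h k).symm _
  · rintro _ ⟨j, hj, -, rfl⟩
    exact ⟨isStr_hVec j, tr_hVec hV hc hlr j, commute_gradOp_hVec hcs j,
      fun i hi => hVec_apply hcs hj hi⟩
  · rintro ⟨⟨i, j⟩, hi, hij⟩
    simp only at hi hij
    have hj : l ≤ (j : ℕ) := hi.trans (le_of_lt hij)
    refine sup_le (Submodule.span_le.2 ?_) (Submodule.span_le.2 ?_)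
    · rintro _ ⟨a, ha, rfl⟩
      exact box_mem_mStr hV hcs hij.ne' hj hi (by rwa [peirce_comm])
    · rintro _ ⟨a, ha, rfl⟩
      exact box_mem_mStr hV hcs hij.ne hi hj ha

variable (c l) in
/-- The elements of trace zero of the structure algebra that do not lower the degree. -/
def qStr : Submodule ℝ (V →L[ℝ] V) := strAlg V ⊓ LinearMap.ker (tr V) ⊓ shift c l 0

lemma aSub'_le (hV : IsSimple V) (hc : IsJordanFrame c) (hlr : l < r) : aSub' c l ≤ qStr c l :=
  Submodule.span_le.2 (by
    rintro _ ⟨j, rfl⟩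
    exact ⟨⟨isStr_hVec _, tr_hVec hV hc hlr _⟩,
      mem_shift_of_commute hc.isCSOI (commute_gradOp_hVec hc.isCSOI _)⟩)

lemma mStr_le (hc : IsCSOI c) : mStr c l ≤ qStr c l :=
  fun _ hX => ⟨⟨hX.1, hX.2.1⟩, mem_shift_of_commute hc hX.2.2.1⟩

lemma qSub'_le (hV : IsSimple V) (hc : IsJordanFrame c) (hlr : l < r) : qSub' c l ≤ qStr c l :=
  sup_le (sup_le ((mSub'_le hV hc hlr).trans (mStr_le hc.isCSOI)) (aSub'_le hV hc hlr))
    (le_inf (le_inf nBar_le_strAlg (nBar_le_ker_tr hV hc.isCSOI))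
      ((nBar_le_shift hc.isCSOI).trans (shift_mono (Nat.zero_le 1))))

/-- The component of `X c_j` in `V_{ij}` only sees the block of `X` from the degree of `c_j` to the
degree of `V_{ij}`. This converts conditions on degrees into the vanishing of root components. -/
lemma jmul_jmul_apply_eq_zero (hc : IsCSOI c) {X : V →L[ℝ] V} {i j : Fin r} (hij : i ≠ j)
    (h : gr c l (wt l i + wt l j) * X * gr c l (2 * wt l j) = 0) :
    jmul (c i) (jmul (c j) (X (c j))) = 0 := by
  have h1 := gr_apply_self_of_eigen hc
    (gradOp_peirce (l := l) hij (hc.jmul_jmul_mem_peirce hij (X (c j))))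
  have h2 : gr c l (wt l i + wt l j) (X (c j)) = 0 := by
    have := congrArg (fun A : V →L[ℝ] V => A (c j)) h
    simpa [gr_apply_self_of_eigen hc (gradOp_frame (l := l) hc j)] using this
  have h3 : gr c l (wt l i + wt l j) * (L (c i) * L (c j)) =
      (L (c i) * L (c j)) * gr c l (wt l i + wt l j) :=
    (((commute_L_gr hc i _).symm).mul_right ((commute_L_gr hc j _).symm)).eq
  have h4 := congrArg (fun A : V →L[ℝ] V => A (X (c j))) h3
  simp only [mul_apply_eq_comp, L_apply, h2, map_zero] at h4
  rw [← h1, h4]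

lemma diagCoeff_eq_zero (hc : IsCSOI c) {X : V →L[ℝ] V} (hX : X ∈ shift c l 1) (j : Fin r) :
    diagCoeff c X j = 0 := by
  have h := hX (2 * wt l j) (2 * wt l j) (by omega)
  have h1 := congrArg (fun A : V →L[ℝ] V => ⟪c j, A (c j)⟫_ℝ) h
  simp only [mul_apply_eq_comp, gr_apply_self_of_eigen hc (gradOp_frame (l := l) hc j),
    ← inner_gr hc, zero_apply, inner_zero_right] at h1
  rw [diagCoeff, h1, zero_div]

lemma box_zero_left (x : V) : box 0 x = 0 := by simp [box]

lemma commute_gradOp_of_apply {Y : V →L[ℝ] V} (hY : IsStr Y) (he : Y e = 0)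
    (h : ∀ j, Y (c j) = 0) : Commute (gradOp c l) Y := by
  rw [gradOp_eq]
  refine Commute.sum_left _ _ _ fun j _ => Commute.smul_left (Eq.symm ?_) _
  rw [← sub_eq_zero, hY.derivation he, h j, map_zero]

lemma box_mem_nBar (hc : IsCSOI c) {i j : Fin r} (hij : i < j) (hi : (i : ℕ) < l) (x : V) :
    box ((8 : ℝ) • jmul (c i) (jmul (c j) x)) (c j) ∈ nBar c l :=
  le_iSup (fun p : {p : Fin r × Fin r // (p.1 : ℕ) < l ∧ p.1 < p.2} => gMinus c p.1.1 p.1.2)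
    ⟨(i, j), hi, hij⟩ (Submodule.subset_span ⟨_, Submodule.smul_mem _ _
      (hc.jmul_jmul_mem_peirce hij.ne x), rfl⟩)

lemma box_mem_mSub' (hc : IsCSOI c) {i j : Fin r} (hij : i ≠ j) (hi : l ≤ (i : ℕ))
    (hj : l ≤ (j : ℕ)) (x : V) :
    box ((8 : ℝ) • jmul (c i) (jmul (c j) x)) (c j) ∈ mSub' c l := by
  have hx := Submodule.smul_mem _ (8 : ℝ) (hc.jmul_jmul_mem_peirce hij x)
  refine le_sup_right (a := mSub c ⊔ _) ?_
  rcases lt_or_gt_of_ne hij with h | h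
  · exact le_iSup (fun p : {p : Fin r × Fin r // l ≤ (p.1 : ℕ) ∧ p.1 < p.2} =>
      gPlus c p.1.1 p.1.2 ⊔ gMinus c p.1.1 p.1.2) ⟨(i, j), hi, h⟩
      (le_sup_right (a := gPlus c i j) (Submodule.subset_span ⟨_, hx, rfl⟩))
  · rw [peirce_comm] at hx
    exact le_iSup (fun p : {p : Fin r × Fin r // l ≤ (p.1 : ℕ) ∧ p.1 < p.2} =>
      gPlus c p.1.1 p.1.2 ⊔ gMinus c p.1.1 p.1.2) ⟨(j, i), hj, h⟩
      (le_sup_left (b := gMinus c j i) (Submodule.subset_span ⟨_, hx, rfl⟩))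

lemma hVec_mem_mSub' (hc : IsCSOI c) (hlr : l < r) {j : Fin r} (hj : l ≤ (j : ℕ)) :
    hVec c l j ∈ mSub' c l := by
  classical
  have key : ∀ j : Fin r, l ≤ (j : ℕ) → (j : ℕ) + 1 < r → hVec c l j ∈ mSub' c l :=
    fun j hj hjr => le_sup_left (b := ⨆ p : {p : Fin r × Fin r // l ≤ (p.1 : ℕ) ∧ p.1 < p.2},
      (gPlus c p.1.1 p.1.2 ⊔ gMinus c p.1.1 p.1.2)) (le_sup_right (a := mSub c)
      (Submodule.subset_span ⟨j, hj, hjr, rfl⟩))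
  by_cases hjr : (j : ℕ) + 1 < r
  · exact key j hj hjr
  have h := sum_hVec hc hlr
  rw [← Finset.add_sum_erase _ _ (Finset.mem_univ j), if_pos hj] at h
  rw [eq_neg_of_add_eq_zero_left h]
  refine Submodule.neg_mem _ (Submodule.sum_mem _ fun k hk => ?_)
  split_ifs with hkl
  · refine key k hkl ?_
    have : (k : ℕ) ≠ j := fun h => (Finset.mem_erase.1 hk).1 (Fin.ext h)
    have := k.2
    have := j.2
    omega
  · exact Submodule.zero_mem _

/-- In the root decomposition the diagonal terms and the roots of degree at most zero vanish. The
remaining term `Y` commutes with the grading and is also of positive degree, so it is zero. -/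
lemma mem_nBar (hc : IsJordanFrame c) {X : V →L[ℝ] V} (hX : IsStr X) (h : X ∈ shift c l 1) :
    X ∈ nBar c l := by
  classical
  have hcs := hc.isCSOI
  obtain ⟨Y, hY, hYe, hYc, hXY⟩ := hX.exists_decomposition hc
  have hS : ∑ j, ∑ i ∈ Finset.univ.erase j, box ((8 : ℝ) • jmul (c i) (jmul (c j) (X (c j)))) (c j)
      ∈ nBar c l := by
    refine Submodule.sum_mem _ fun j _ => Submodule.sum_mem _ fun i hi => ?_
    have hij := (Finset.mem_erase.1 hi).1
    by_cases hw : wt l i + wt l j < 2 * wt l j + 1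
    · rw [jmul_jmul_apply_eq_zero hcs hij (h _ _ hw), smul_zero, box_zero_left]
      exact Submodule.zero_mem _
    · simp only [wt] at hw
      exact box_mem_nBar hcs (Fin.lt_def.2 (by omega)) (by omega) _
  simp only [diagCoeff_eq_zero hcs h, zero_smul, Finset.sum_const_zero, add_zero] at hXY
  have hY0 : Y = 0 := by
    refine eq_zero_of_commute_of_mem_shift (l := l) hcs (commute_gradOp_of_apply hY hYe hYc) ?_
    rw [← sub_eq_iff_eq_add] at hXY
    rw [← hXY]
    exact Submodule.sub_mem _ h (nBar_le_shift hcs hS)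
  rw [hXY, hY0, zero_add]
  exact hS

lemma mSub_le_mSub' : mSub c ≤ mSub' c l := le_sup_left.trans le_sup_left

lemma qStr_le (hV : IsSimple V) (hc : IsJordanFrame c) (hlr : l < r) : qStr c l ≤ qSub' c l := by
  classical
  rintro X ⟨⟨hX, htr⟩, h⟩
  have hcs := hc.isCSOI
  have hm : mSub' c l ≤ qSub' c l := le_sup_left.trans le_sup_left
  have hn : nBar c l ≤ qSub' c l := le_sup_right
  have ha : aSub' c l ≤ qSub' c l := le_sup_right.trans le_sup_left
  obtain ⟨Y, hY, hYe, hYc, hXY⟩ := IsStr.exists_decomposition hX hc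
  rw [hXY, sum_smul_hVec (l := l) (IsStr.sum_diagCoeff hV hX hc htr)]
  refine Submodule.add_mem _ (Submodule.add_mem _ (hm (mSub_le_mSub' (mem_mSub hY hYe hYc)))
    (Submodule.sum_mem _ fun j _ => Submodule.smul_mem _ _ ?_))
    (Submodule.sum_mem _ fun j _ => Submodule.sum_mem _ fun i hi => ?_)
  · by_cases hj : (j : ℕ) < l
    · exact ha (Submodule.subset_span ⟨⟨j, hj⟩, rfl⟩)
    · exact hm (hVec_mem_mSub' hcs hlr (not_lt.1 hj))
  · have hij := (Finset.mem_erase.1 hi).1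
    have hij' : (i : ℕ) ≠ j := fun h => hij (Fin.ext h)
    by_cases hw : wt l i + wt l j < 2 * wt l j + 0
    · rw [jmul_jmul_apply_eq_zero hcs hij (h _ _ hw), smul_zero, box_zero_left]
      exact Submodule.zero_mem _
    simp only [wt] at hw
    by_cases hi : (i : ℕ) < l
    · exact hn (box_mem_nBar hcs (Fin.lt_def.2 (by omega)) hi _)
    · exact hm (box_mem_mSub' hcs hij (by omega) (by omega) _)

lemma qSub'_eq (hV : IsSimple V) (hc : IsJordanFrame c) (hlr : l < r) : qSub' c l = qStr c l :=
  le_antisymm (qSub'_le hV hc hlr) (qStr_le hV hc hlr)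

lemma mStr_le_mSub' (hV : IsSimple V) (hc : IsJordanFrame c) (hlr : l < r) :
    mStr c l ≤ mSub' c l := by
  classical
  rintro X ⟨hX, htr, h, hi0⟩
  have hcs := hc.isCSOI
  obtain ⟨Y, hY, hYe, hYc, hXY⟩ := IsStr.exists_decomposition hX hc
  rw [hXY, sum_smul_hVec (l := l) (IsStr.sum_diagCoeff hV hX hc htr)]
  refine Submodule.add_mem _ (Submodule.add_mem _ (mSub_le_mSub' (mem_mSub hY hYe hYc))
    (Submodule.sum_mem _ fun j _ => ?_))
    (Submodule.sum_mem _ fun j _ => Submodule.sum_mem _ fun i hi => ?_)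
  · by_cases hj : (j : ℕ) < l
    · rw [diagCoeff, hi0 j hj]
      simp
    · exact Submodule.smul_mem _ _ (hVec_mem_mSub' hcs hlr (not_lt.1 hj))
  · have hij := (Finset.mem_erase.1 hi).1
    have hij' : (i : ℕ) ≠ j := fun h => hij (Fin.ext h)
    by_cases hw : wt l i + wt l j = 2 * wt l j
    · simp only [wt] at hw
      exact box_mem_mSub' hcs hij (by omega) (by omega) _
    · rw [jmul_jmul_apply_eq_zero hcs hij (gr_mul_of_commute hcs h hw), smul_zero, box_zero_left]
      exact Submodule.zero_mem _

/-! ### Peirce spaces of a simple algebra -/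

lemma eq_zero_of_jmul_neg {p u : V} (hp : jmul p p = p) (h : jmul p u = -((1 / 2 : ℝ) • u)) :
    u = 0 := by
  have h1 := inner_jmul_self_nonneg hp u
  rw [h, inner_neg_left, inner_smul_left] at h1
  have h2 : 0 ≤ ⟪u, u⟫_ℝ := real_inner_self_nonneg
  simp only [conj_trivial] at h1
  exact inner_self_eq_zero.1 (le_antisymm (by linarith) h2)

/-- The rule `V_{im} V_{ij} ⊆ V_{mj}`. -/
lemma jmul_mem_peirce (hc : IsCSOI c) {i j m : Fin r} (hij : i ≠ j) (him : i ≠ m) (hmj : m ≠ j)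
    {a v : V} (ha : a ∈ peirce c i m) (hv : v ∈ peirce c i j) : jmul a v ∈ peirce c m j := by
  obtain ⟨a1, a2, a3⟩ := mem_peirce_iff.1 ha
  obtain ⟨v1, v2, v3⟩ := mem_peirce_iff.1 hv
  have ha' : a ∈ peirce c m i := by rwa [peirce_comm]
  have e1 : box a (c m) v = (1 / 2 : ℝ) • jmul a v - jmul (c m) (jmul a v) := by
    rw [box_apply, jmul_comm a (c m), a2, v3 m him.symm hmj]
    simp
    module
  have e2 : box a (c i) v = jmul a v - jmul (c i) (jmul a v) := by
    rw [box_apply, jmul_comm a (c i), a1, v1]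
    simp
    module
  have f1 : ∀ k, jmul (c k) (box a (c m) v) = box a (c m) (jmul (c k) v) +
      ((if k = i then 1 / 2 else 0) - (if k = m then 1 / 2 else 0) : ℝ) • box a (c m) v := fun k => by
    have := congrArg (fun A : V →L[ℝ] V => A v) (L_bracket_box hc him ha k)
    simp only [sub_apply, mul_apply_eq_comp, L_apply, smul_apply] at this
    rw [← this]; abel
  have f2 : ∀ k, jmul (c k) (box a (c i) v) = box a (c i) (jmul (c k) v) +
      ((if k = m then 1 / 2 else 0) - (if k = i then 1 / 2 else 0) : ℝ) • box a (c i) v := fun k => by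
    have := congrArg (fun A : V →L[ℝ] V => A v) (L_bracket_box hc him.symm ha' k)
    simp only [sub_apply, mul_apply_eq_comp, L_apply, smul_apply] at this
    rw [← this]; abel
  -- This operator lowers the eigenvalue of `c_m` by `1/2`, and `v` has eigenvalue `0`; but `L(c_m)`
  -- is positive semidefinite.
  have g1 : box a (c m) v = 0 := by
    refine eq_zero_of_jmul_neg (hc.idem m) ?_
    rw [f1 m, v3 m him.symm hmj, if_neg him.symm, if_pos rfl, map_zero]
    module
  rw [g1] at e1
  have g2 : jmul (c m) (jmul a v) = (1 / 2 : ℝ) • jmul a v := (sub_eq_zero.1 e1.symm).symm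
  have g3 : jmul (c i) (box a (c i) v) = 0 := by
    rw [f2 i, v1, if_neg him, if_pos rfl, map_smul]
    module
  have g4 : jmul (c i) (jmul (c i) (jmul a v)) = jmul (c i) (jmul a v) := by
    rw [e2, map_sub, sub_eq_zero] at g3
    exact g3.symm
  -- The vector `c_i (a v)` lies in `V(c_i, 1)`, which `c_m` annihilates, whereas `c_m` acts on it
  -- by `1/2`.
  have g5 : jmul (c i) (jmul a v) = 0 := by
    have h1 := jmul_one_zero (hc.idem i) g4 (hc.orth i m him)
    rw [jmul_comm, jmul_left_comm_of_commute (hc.commute m i), g2, map_smul] at h1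
    simpa using h1
  rw [g5, sub_zero] at e2
  rw [e2] at f2
  refine mem_peirce_iff.2 ⟨g2, ?_, fun k hkm hkj => ?_⟩
  · rw [f2 j, v2, map_smul, e2, if_neg hmj.symm, if_neg hij.symm]
    module
  · by_cases hki : k = i
    · rw [hki, g5]
    · rw [f2 k, v3 k hki hkj, if_neg hkm, if_neg hki]
      simp

/-- The square lies in `V(c_i + c_m, 1)`, and its products with `c_i` and `c_m` lie in the lines of
these idempotents. The inner product gives the coefficients, which agree because all primitive
idempotents have the same norm. -/
lemma jmul_self_peirce (hV : IsSimple V) (hc : IsJordanFrame c) {i m : Fin r} (him : i ≠ m) {a : V}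
    (ha : a ∈ peirce c i m) :
    jmul a a = (1 / 2 * ⟪a, a⟫_ℝ / ⟪c i, c i⟫_ℝ) • (c i + c m) := by
  have hcs := hc.isCSOI
  obtain ⟨a1, a2, -⟩ := mem_peirce_iff.1 ha
  have hid : jmul (c i + c m) (c i + c m) = c i + c m := by
    simp [hcs.idem, hcs.orth i m him, hcs.orth m i him.symm]
  have hpa : jmul (c i + c m) a = a := by
    rw [map_add, LinearMap.add_apply, a1, a2]; module
  have h1 : jmul (c i + c m) (jmul a a) = jmul a a := by
    rw [jmul_left_comm_of_commute (commute_L_of_one hpa hid), hpa]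
  have h2 : ∀ k, jmul (c k) a = (1 / 2 : ℝ) • a →
      jmul (c k) (jmul a a) = (1 / 2 * ⟪a, a⟫_ℝ / ⟪c k, c k⟫_ℝ) • c k := fun k hk => by
    obtain ⟨b, hb⟩ := (hc.1 k).exists_smul (jmul_half_half (hcs.idem k) hk hk)
    have h3 : ⟪c k, jmul (c k) (jmul a a)⟫_ℝ = 1 / 2 * ⟪a, a⟫_ℝ := by
      rw [inner_jmul_right, hcs.idem, inner_jmul_right, hk, inner_smul_left]
      simp
    rw [hb] at h3 ⊢
    rw [inner_smul_right] at h3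
    rw [← h3, mul_div_cancel_right₀ _ (hc.inner_pos k).ne']
  rw [← h1, map_add, LinearMap.add_apply, h2 i a1, h2 m a2, (hc.1 i).inner_eq hV (hc.1 m), smul_add]

/-- Consequently multiplication by a nonzero `a` in `V_{im}` is injective from `V_{ij}` to `V_{mj}`,
the source of all the nonvanishing arguments below. -/
lemma jmul_jmul_peirce (hV : IsSimple V) (hc : IsJordanFrame c) {i j m : Fin r} (hij : i ≠ j)
    (him : i ≠ m) (hmj : m ≠ j) {a v : V} (ha : a ∈ peirce c i m) (hv : v ∈ peirce c i j) :
    jmul a (jmul a v) = (1 / 2 * ⟪a, a⟫_ℝ / ⟪c i, c i⟫_ℝ / 4) • v := by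
  have hcs := hc.isCSOI
  obtain ⟨a1, a2, a3⟩ := mem_peirce_iff.1 ha
  obtain ⟨v1, v2, v3⟩ := mem_peirce_iff.1 hv
  have h := congrArg (fun A : V →L[ℝ] V => A v) (L_jmul_jmul (c i) a a)
  have hz := (mem_peirce_iff.1 (jmul_mem_peirce hcs hij him hmj ha hv)).2.2 i him hij
  simp only [jmul_self_peirce hV hc him ha, jmul_comm a (c i), a1, map_smul, map_add, hcs.idem,
    hcs.orth i m him, sub_apply, add_apply, mul_apply_eq_comp, smul_apply, L_apply, v1, hz,
    v3 m him.symm hmj, map_zero, add_zero, sub_zero] at h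
  linear_combination (norm := module) -h

/-- The indices linked to `i` by a nonzero Peirce space form a class: links compose by the
injectivity above. If the class were proper, the sum of its idempotents would have no Peirce
component `1/2`, so it would be central without being a multiple of `e`. -/
lemma peirce_ne_bot (hV : IsSimple V) (hc : IsJordanFrame c) {i j : Fin r} (hij : i ≠ j) :
    ∃ a ∈ peirce c i j, a ≠ 0 := by
  classical
  have hcs := hc.isCSOI
  by_contra hcon
  let I : Finset (Fin r) := Finset.univ.filter fun k => i = k ∨ ∃ a ∈ peirce c i k, a ≠ 0
  have hI : ∀ k, k ∈ I ↔ (i = k ∨ ∃ a ∈ peirce c i k, a ≠ 0) := fun k => by simp [I]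
  have hzero : ∀ k ∈ I, ∀ m ∉ I, ∀ x, jmul (c k) (jmul (c m) x) = 0 := by
    intro k hk m hm x
    have hkm : k ≠ m := by rintro rfl; exact hm hk
    by_contra hne
    have hx := hcs.jmul_jmul_mem_peirce hkm x
    refine hm ((hI m).2 ?_)
    rcases (hI k).1 hk with rfl | ⟨a, ha, ha0⟩
    · exact .inr ⟨_, hx, hne⟩
    by_cases him : i = m
    · exact .inl him
    by_cases hik : i = k
    · subst hik
      exact .inr ⟨_, hx, hne⟩
    rw [peirce_comm] at ha
    refine .inr ⟨_, jmul_mem_peirce hcs hkm (Ne.symm hik) him ha hx, fun h0 => ?_⟩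
    have h1 := jmul_jmul_peirce hV hc hkm (Ne.symm hik) him ha hx
    rw [h0, map_zero] at h1
    refine hne ((smul_eq_zero.1 h1.symm).resolve_left ?_)
    have := hc.inner_pos k
    have := real_inner_self_pos.2 ha0
    positivity
  set p := ∑ k ∈ I, c k with hp
  have hpk : ∀ k ∈ I, jmul p (c k) = c k := fun k hk => by
    rw [hp, map_sum, LinearMap.sum_apply, Finset.sum_eq_single k (fun m _ hm => hcs.orth m k hm)
      (fun h => absurd hk h), hcs.idem]
  have hpm : ∀ m ∉ I, jmul p (c m) = 0 := fun m hm => by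
    rw [hp, map_sum, LinearMap.sum_apply]
    exact Finset.sum_eq_zero fun k hk => hcs.orth k m (by rintro rfl; exact hm hk)
  have hpp : jmul p p = p := by
    conv_lhs => rw [hp, ← hp, map_sum]
    exact Finset.sum_congr rfl hpk
  have hp1 : ∀ x, jmul p (x - jmul p x) = 0 := fun x => by
    have : x - jmul p x = ∑ m ∈ Finset.univ \ I, jmul (c m) x := by
      have h1 : jmul (∑ m, c m) x = x := by rw [hcs.sum, e_jmul]
      rw [← Finset.sum_sdiff (Finset.subset_univ I), map_add, LinearMap.add_apply, ← hp] at h1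
      rw [← LinearMap.sum_apply, ← map_sum, sub_eq_iff_eq_add, h1]
    rw [this, map_sum, hp]
    refine Finset.sum_eq_zero fun m hm => ?_
    rw [map_sum, LinearMap.sum_apply]
    exact Finset.sum_eq_zero fun k hk => hzero k hk m (Finset.mem_sdiff.1 hm).2 x
  have hcent : ∀ x, Commute (L p) (L x) := fun x => by
    have h1 : jmul p (jmul p x) = jmul p x := by
      have := hp1 x
      rw [map_sub, sub_eq_zero] at this
      exact this.symm
    have h2 := (commute_L_of_one h1 hpp).add_right (commute_L_of_zero (hp1 x) hpp)
    rwa [← map_add, add_sub_cancel] at h2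
  obtain ⟨a, ha⟩ := exists_eq_smul_e hV hcent
  have hj : j ∉ I := fun h => by
    rcases (hI j).1 h with h | h
    · exact hij h
    · exact hcon h
  have h1 := hpm j hj
  rw [ha, map_smul, LinearMap.smul_apply, e_jmul] at h1
  have h2 := hpk i ((hI i).2 (.inl rfl))
  rw [ha, (smul_eq_zero.1 h1).resolve_right (hc.1 j).1, zero_smul, map_zero,
    LinearMap.zero_apply] at h2
  exact (hc.1 i).1 h2.symm

/-! ### The filtration of `V` defined by the grading -/

variable (c l) in
/-- The elements of degree at least `s`. -/
def filt (s : ℕ) : Submodule ℝ V where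
  carrier := {v | ∀ t < s, gr c l t v = 0}
  add_mem' hv hw t ht := by rw [map_add, hv t ht, hw t ht, add_zero]
  zero_mem' t _ := map_zero _
  smul_mem' a v hv t ht := by rw [map_smul, hv t ht, smul_zero]

lemma mem_filt_of_eigen (hc : IsCSOI c) {d s : ℕ} (hd : s ≤ d) {v : V}
    (hv : gradOp c l v = (d : ℝ) • v) : v ∈ filt c l s :=
  fun t ht => gr_apply_of_eigen hc hv (by omega)

lemma apply_mem_filt (hc : IsCSOI c) {p s : ℕ} {X : V →L[ℝ] V} (hX : X ∈ shift c l p) {v : V}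
    (hv : v ∈ filt c l s) : X v ∈ filt c l (s + p) := by
  intro t ht
  have h1 := congrArg (fun A : V →L[ℝ] V => gr c l t (X (A v))) (sum_gr (l := l) hc)
  simp only [sum_apply, map_sum, one_apply_eq_self] at h1
  rw [← h1]
  refine Finset.sum_eq_zero fun u _ => ?_
  by_cases hu : u < s
  · rw [hv u hu, map_zero, map_zero]
  · exact congrArg (fun A : V →L[ℝ] V => A v) (hX u t (by omega))

lemma mem_shift_zero (hc : IsCSOI c) {X : V →L[ℝ] V}
    (h : ∀ s, ∀ v ∈ filt c l s, X v ∈ filt c l s) : X ∈ shift c l 0 := by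
  intro s t hst
  ext v
  refine h s (gr c l s v) (fun u hu => ?_) t (by simpa using hst)
  exact congrArg (fun A : V →L[ℝ] V => A v) (gr_mul_gr_of_ne hc (by omega : u ≠ s))

lemma box_mem_nBar' {i j : Fin r} (hij : i < j) (hi : (i : ℕ) < l) {a : V}
    (ha : a ∈ peirce c i j) : box a (c j) ∈ nBar c l :=
  le_iSup (fun p : {p : Fin r × Fin r // (p.1 : ℕ) < l ∧ p.1 < p.2} => gMinus c p.1.1 p.1.2)
    ⟨(i, j), hi, hij⟩ (Submodule.subset_span ⟨_, ha, rfl⟩)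

/-- With `m` the index after `i`, an element of `𝔤⁻_{im}` raises the degree by one. For nonzero `a`
in `V_{im}`, `c_i` is a multiple of `(a □ c_m) a`, a vector `v` of `V_{im}` is `2 (v □ c_m) c_m`,
and a vector `v` of another `V_{ij}` is a multiple of `(a □ c_m)(a v)`. -/
lemma pc_apply_mem_span (hV : IsSimple V) (hc : IsJordanFrame c) (hlr : l < r) {i j : Fin r}
    (hij : i ≤ j) {s : ℕ} (hw : s + 1 ≤ wt l i + wt l j) (x : V) :
    pc c i j x ∈ Submodule.span ℝ {w | ∃ X ∈ nBar c l, ∃ v ∈ filt c l s, w = X v} := by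
  have hcs := hc.isCSOI
  have hij' : (i : ℕ) ≤ j := hij
  have hi : (i : ℕ) < l := by simp only [wt] at hw; omega
  -- Positive degree forces `i < l` (indices start at `0`), so `i + 1 ≤ l < r` is an index of weight
  -- exactly one less, even when it is outside the first `l`.
  obtain ⟨m, hm⟩ : ∃ m : Fin r, (m : ℕ) = i + 1 := ⟨⟨i + 1, by omega⟩, rfl⟩
  have him : i < m := Fin.lt_def.2 (by omega)
  rcases eq_or_ne i j with rfl | hne
  · obtain ⟨a, ha, ha0⟩ := peirce_ne_bot hV hc him.ne
    obtain ⟨a1, a2, -⟩ := mem_peirce_iff.1 ha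
    have h1 : box a (c m) a = (1 / 2 * ⟪a, a⟫_ℝ / ⟪c i, c i⟫_ℝ) • c i := by
      rw [box_apply, jmul_comm a (c m), a2, map_smul, map_smul, LinearMap.smul_apply,
        jmul_self_peirce hV hc him.ne ha, map_smul, map_add, hcs.idem, hcs.orth m i him.ne']
      module
    have h2 : c i = (1 / 2 * ⟪a, a⟫_ℝ / ⟪c i, c i⟫_ℝ)⁻¹ • box a (c m) a := by
      rw [h1, smul_smul, inv_mul_cancel₀, one_smul]
      have := hc.inner_pos i
      have := real_inner_self_pos.2 ha0
      positivity
    rw [pc_self hcs, hc.exists_smul]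
    refine Submodule.smul_mem _ _ ?_
    rw [h2]
    refine Submodule.smul_mem _ _ (Submodule.subset_span ⟨_, box_mem_nBar' him hi ha, a, ?_, rfl⟩)
    refine mem_filt_of_eigen hcs ?_ (gradOp_peirce him.ne ha)
    simp only [wt] at hw ⊢
    omega
  · have hv : pc c i j x ∈ peirce c i j := by
      have : pc c i j x = (2 : ℝ) • jmul (c i) (jmul (c j) x) := by simp [pc, hne]
      rw [this]
      exact Submodule.smul_mem _ _ (hcs.jmul_jmul_mem_peirce hne x)
    set v := pc c i j x
    have hij2 : i < j := lt_of_le_of_ne hij hne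
    rcases eq_or_ne m j with rfl | hmj
    · have h1 : v = (2 : ℝ) • box v (c m) (c m) := by
        rw [box_peirce_apply_self hcs hv, smul_smul]; norm_num
      rw [h1]
      refine Submodule.smul_mem _ _ (Submodule.subset_span ⟨_, box_mem_nBar' him hi hv, c m, ?_, rfl⟩)
      refine mem_filt_of_eigen hcs ?_ (gradOp_frame hcs m)
      simp only [wt] at hw ⊢
      omega
    · obtain ⟨a, ha, ha0⟩ := peirce_ne_bot hV hc him.ne
      obtain ⟨a1, a2, -⟩ := mem_peirce_iff.1 ha
      have hav := jmul_mem_peirce hcs hne him.ne hmj ha hv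
      have h0 := jmul_jmul_peirce hV hc hne him.ne hmj ha hv
      have h1 : box a (c m) (jmul a v) = (1 / 2 * ⟪a, a⟫_ℝ / ⟪c i, c i⟫_ℝ / 4) • v := by
        rw [box_apply, jmul_comm a (c m), a2, map_smul, LinearMap.smul_apply,
          (mem_peirce_iff.1 hav).1, map_smul, h0, map_smul,
          (mem_peirce_iff.1 hv).2.2 m him.ne' hmj]
        module
      have h2 : v = (1 / 2 * ⟪a, a⟫_ℝ / ⟪c i, c i⟫_ℝ / 4)⁻¹ • box a (c m) (jmul a v) := by
        rw [h1, smul_smul, inv_mul_cancel₀, one_smul]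
        have := hc.inner_pos i
        have := real_inner_self_pos.2 ha0
        positivity
      rw [h2]
      refine Submodule.smul_mem _ _ (Submodule.subset_span ⟨_, box_mem_nBar' him hi ha, _, ?_, rfl⟩)
      refine mem_filt_of_eigen hcs ?_ (gradOp_peirce hmj hav)
      simp only [wt] at hw ⊢
      omega

/-- `𝔫̄_l` maps the elements of degree at least `s` onto those of degree at least `s + 1`. -/
lemma filt_succ_le (hV : IsSimple V) (hc : IsJordanFrame c) (hlr : l < r) (s : ℕ) :
    filt c l (s + 1) ≤ Submodule.span ℝ {w | ∃ X ∈ nBar c l, ∃ v ∈ filt c l s, w = X v} := by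
  intro v hv
  have h1 := congrArg (fun A : V →L[ℝ] V => A v) (sum_gr (l := l) hc.isCSOI)
  simp only [sum_apply, one_apply_eq_self] at h1
  rw [← h1]
  refine Submodule.sum_mem _ fun t _ => ?_
  by_cases ht : t < s + 1
  · rw [hv t ht]
    exact Submodule.zero_mem _
  simp only [gr, sum_apply]
  refine Submodule.sum_mem _ fun i _ => Submodule.sum_mem _ fun j _ => ?_
  split_ifs with h
  · rcases le_total i j with hij | hij
    · exact pc_apply_mem_span hV hc hlr hij (by omega) v
    · rw [pc_comm hc.isCSOI]
      exact pc_apply_mem_span hV hc hlr hij (by omega) v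
  · exact Submodule.zero_mem _

/-- Induction on the filtration: vectors of degree at least `s + 1` are sums of `X w` with `X` in
`𝔫̄_l` and `w` of degree at least `s`, and `g X w = (g X g⁻¹)(g w)`. -/
lemma mem_shift_zero_of_conj (hV : IsSimple V) (hc : IsJordanFrame c) (hlr : l < r) {g : GLV V}
    (h : ∀ X ∈ nBar c l, (g : V →L[ℝ] V) * X * ((g⁻¹ : GLV V) : V →L[ℝ] V) ∈ nBar c l) :
    (g : V →L[ℝ] V) ∈ shift c l 0 := by
  refine mem_shift_zero hc.isCSOI fun s => ?_
  induction s with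
  | zero => exact fun v _ t ht => absurd ht (Nat.not_lt_zero t)
  | succ s ih =>
    intro v hv
    refine (Submodule.span_le (p := (filt c l (s + 1)).comap ((g : V →L[ℝ] V) : V →ₗ[ℝ] V))).2 ?_
      (filt_succ_le hV hc hlr s hv)
    rintro _ ⟨X, hX, w, hw, rfl⟩
    have h1 := apply_mem_filt hc.isCSOI (nBar_le_shift hc.isCSOI (h X hX)) (ih w hw)
    simpa [mul_apply_eq_comp, unit_inv_apply] using h1

/-! ### The normaliser of `𝔮'_l` -/

lemma tr_eq_zero_of_mem_shift (hc : IsCSOI c) {X : V →L[ℝ] V} (hX : X ∈ shift c l 1) :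
    tr V X = 0 := by
  rw [eq_sum_gr (l := l) hc X, map_sum]
  refine Finset.sum_eq_zero fun t _ => ?_
  rw [map_sum]
  refine Finset.sum_eq_zero fun s _ => ?_
  by_cases hst : s = t
  · rw [hX s t (by omega), map_zero]
  · rw [mul_assoc, tr_mul_comm, mul_assoc, gr_mul_gr_of_ne hc hst, mul_zero, map_zero]

lemma isStr_comp (hV : IsSimple V) (hc : IsCSOI c) {p : ℕ} {X : V →L[ℝ] V} (hX : IsStr X)
    (h : X ∈ shift c l p) : IsStr (comp c l p X) := by
  have hcl : IsClosed (strAlg V : Set (V →L[ℝ] V)) := Submodule.closed_of_finiteDimensional _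
  refine hcl.mem_of_tendsto (tendsto_dil_conj hc h) (.of_forall fun τ => ?_)
  exact (strAlg V).smul_mem _ (hX.conj hV (G_le (dil_mem_G τ)))

lemma tr_adjoint (X : V →L[ℝ] V) : tr V (ContinuousLinearMap.adjoint X) = tr V X := by
  have h : ∀ Y : V →L[ℝ] V, tr V Y =
      ∑ i, ⟪stdOrthonormalBasis ℝ V i, Y (stdOrthonormalBasis ℝ V i)⟫_ℝ := fun Y =>
    LinearMap.trace_eq_sum_inner (Y : V →ₗ[ℝ] V) (stdOrthonormalBasis ℝ V)
  rw [h, h]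
  refine Finset.sum_congr rfl fun i _ => ?_
  rw [ContinuousLinearMap.adjoint_inner_right, real_inner_comm]

lemma eq_zero_of_tr_mul_adjoint {X : V →L[ℝ] V}
    (h : tr V (ContinuousLinearMap.adjoint X * X) = 0) : X = 0 := by
  have h1 : tr V (ContinuousLinearMap.adjoint X * X) = ∑ i, ⟪stdOrthonormalBasis ℝ V i,
      (ContinuousLinearMap.adjoint X * X) (stdOrthonormalBasis ℝ V i)⟫_ℝ :=
    LinearMap.trace_eq_sum_inner ((ContinuousLinearMap.adjoint X * X : V →L[ℝ] V) : V →ₗ[ℝ] V)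
      (stdOrthonormalBasis ℝ V)
  simp only [mul_apply_eq_comp, ContinuousLinearMap.adjoint_inner_right] at h1
  rw [h, eq_comm, Finset.sum_eq_zero_iff_of_nonneg fun i _ => real_inner_self_nonneg] at h1
  have h2 : (X : V →ₗ[ℝ] V) = 0 := (stdOrthonormalBasis ℝ V).toBasis.ext fun i => by
    simpa using h1 i (Finset.mem_univ i)
  ext v
  exact congrArg (fun A : V →ₗ[ℝ] V => A v) h2

lemma adjoint_gradOp : ContinuousLinearMap.adjoint (gradOp c l) = gradOp c l := by
  rw [gradOp, map_smulₛₗ, adjoint_L, conj_trivial]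

lemma commute_adjoint {X : V →L[ℝ] V} (h : Commute (gradOp c l) X) :
    Commute (gradOp c l) (ContinuousLinearMap.adjoint X) := by
  have h1 := congrArg ContinuousLinearMap.adjoint h.eq
  rw [adjoint_mul, adjoint_mul, adjoint_gradOp] at h1
  exact h1.symm

/-- `𝔫̄_l` is the radical of the trace form on `𝔮'_l`. -/
lemma mem_nBar_iff_tr (hV : IsSimple V) (hc : IsJordanFrame c) {X : V →L[ℝ] V}
    (hX : X ∈ qStr c l) : X ∈ nBar c l ↔ ∀ Y ∈ qStr c l, tr V (X * Y) = 0 := by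
  have hcs := hc.isCSOI
  refine ⟨fun h Y hY => tr_eq_zero_of_mem_shift hcs
    (mul_mem_shift hcs (nBar_le_shift hcs h) hY.2), fun h => ?_⟩
  -- The degree-zero part `b` has trace zero and its adjoint is again in `𝔮'_l`; testing against
  -- this adjoint gives `tr(b* b) = 0`, so `b = 0`.
  set b := comp c l 0 X
  have hb : IsStr b := isStr_comp hV hcs hX.1.1 hX.2
  have hbX : X - b ∈ shift c l 1 := sub_comp_mem_shift hcs hX.2
  have hbc := commute_adjoint (commute_comp_zero hcs X (l := l))
  have htr : tr V b = 0 := by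
    have h1 := tr_eq_zero_of_mem_shift hcs hbX
    rwa [map_sub, show tr V X = 0 from hX.1.2, zero_sub, neg_eq_zero] at h1
  have hq : ContinuousLinearMap.adjoint b ∈ qStr c l :=
    ⟨⟨hb.adjoint, LinearMap.mem_ker.2 (by rw [tr_adjoint, htr])⟩, mem_shift_of_commute hcs hbc⟩
  have h2 := h _ hq
  have h3 := tr_eq_zero_of_mem_shift hcs (mul_mem_shift hcs hbX hq.2)
  rw [sub_mul, map_sub, h2, zero_sub, neg_eq_zero, tr_mul_comm] at h3
  rw [eq_zero_of_tr_mul_adjoint h3, sub_zero] at hbX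
  exact mem_nBar hc hX.1.1 hbX

lemma conj_conj_inv (g : GLV V) (X : V →L[ℝ] V) : (g : V →L[ℝ] V) *
    (((g⁻¹ : GLV V) : V →L[ℝ] V) * X * (g : V →L[ℝ] V)) * ((g⁻¹ : GLV V) : V →L[ℝ] V) = X := by
  simp only [mul_assoc, Units.mul_inv, mul_one, Units.mul_inv_cancel_left]

/-- Conjugation preserves the trace form on `𝔮'_l`, hence its radical. -/
lemma conj_mem_nBar (hV : IsSimple V) (hc : IsJordanFrame c) {g : GLV V}
    (h1 : ∀ X ∈ qStr c l, (g : V →L[ℝ] V) * X * ((g⁻¹ : GLV V) : V →L[ℝ] V) ∈ qStr c l)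
    (h2 : ∀ X ∈ qStr c l, ((g⁻¹ : GLV V) : V →L[ℝ] V) * X * (g : V →L[ℝ] V) ∈ qStr c l)
    {X : V →L[ℝ] V} (hX : X ∈ nBar c l) :
    (g : V →L[ℝ] V) * X * ((g⁻¹ : GLV V) : V →L[ℝ] V) ∈ nBar c l := by
  have hcs := hc.isCSOI
  have hXq : X ∈ qStr c l := ⟨⟨nBar_le_strAlg hX, nBar_le_ker_tr hV hcs hX⟩,
    shift_mono (Nat.zero_le 1) (nBar_le_shift hcs hX)⟩
  refine (mem_nBar_iff_tr hV hc (h1 X hXq)).2 fun Y hY => ?_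
  have h3 := (mem_nBar_iff_tr hV hc hXq).1 hX _ (h2 Y hY)
  rw [← tr_conj g] at h3
  rw [← h3]
  simp only [mul_assoc, Units.mul_inv, mul_one]

lemma comp_zero_mul (hc : IsCSOI c) {A B : V →L[ℝ] V} (hA : A ∈ shift c l 0)
    (hB : B ∈ shift c l 0) : comp c l 0 (A * B) = comp c l 0 A * comp c l 0 B := by
  have h1 := (tendsto_dil_conj hc hA).mul (tendsto_dil_conj hc hB)
  refine tendsto_nhds_unique (tendsto_dil_conj hc (mul_mem_shift hc hA hB)) (h1.congr fun τ => ?_)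
  simp only [pow_zero, inv_one, one_smul, mul_assoc, Units.inv_mul_cancel_left]

lemma comp_zero_one (hc : IsCSOI c) : comp c l 0 (1 : V →L[ℝ] V) = 1 := by
  refine tendsto_nhds_unique (tendsto_dil_conj hc (one_mem_shift hc))
    (tendsto_const_nhds.congr fun τ => ?_)
  simp

/-- The component of degree zero of an element of `G` that preserves the filtration is in `G`. -/
lemma exists_comp_zero_mem_G (hc : IsCSOI c) {g : GLV V} (hg : g ∈ G V)
    (h1 : (g : V →L[ℝ] V) ∈ shift c l 0) (h2 : ((g⁻¹ : GLV V) : V →L[ℝ] V) ∈ shift c l 0) :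
    ∃ z ∈ G V, (z : V →L[ℝ] V) = comp c l 0 g := by
  -- Taking degree-zero parts is multiplicative on operators that preserve the filtration, so the
  -- part of `g⁻¹` is the inverse.
  let z : GLV V := ⟨comp c l 0 g, comp c l 0 ((g⁻¹ : GLV V) : V →L[ℝ] V),
    by rw [← comp_zero_mul hc h1 h2, Units.mul_inv, comp_zero_one hc],
    by rw [← comp_zero_mul hc h2 h1, Units.inv_mul, comp_zero_one hc]⟩
  refine ⟨z, ?_, rfl⟩
  have hlim : Filter.Tendsto (fun τ => dil c l τ * g * (dil c l τ)⁻¹)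
      (nhdsWithin (0 : ℝ) (Set.Ioi 0)) (nhds z) := by
    rw [Units.isEmbedding_embedProduct.tendsto_nhds_iff]
    refine Filter.Tendsto.prodMk_nhds ?_ ?_
    · refine (tendsto_dil_conj hc h1).congr fun τ => ?_
      simp
    · refine (MulOpposite.continuous_op.tendsto _).comp
        ((tendsto_dil_conj hc h2).congr fun τ => ?_)
      simp [mul_inv_rev, mul_assoc]
  exact isClosed_G.mem_of_tendsto hlim
    (.of_forall fun τ => mul_mem (mul_mem (dil_mem_G τ) hg) (inv_mem (dil_mem_G τ)))

/-- A unipotent element of the automorphism group of the cone is in `exp 𝔫̄_l`. -/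
lemma mem_NBar_of_sub_one_mem_shift (hV : IsSimple V) (hc : IsJordanFrame c) {u : GLV V}
    (hu : u ∈ GLcone V) (h : (u : V →L[ℝ] V) - 1 ∈ shift c l 1) : u ∈ NBar c l := by
  have hcs := hc.isCSOI
  have hu0 : (u : V →L[ℝ] V) ∈ shift c l 0 := by
    have := Submodule.add_mem _ (shift_mono (Nat.zero_le 1) h) (one_mem_shift (l := l) hcs)
    rwa [sub_add_cancel] at this
  -- Successive approximation: `exp Y` agrees with `u` below degree `p + 1`. As degrees are at most
  -- `2l`, the case `p = 2l` is exact.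
  have key : ∀ p : ℕ, ∃ Y ∈ nBar c l,
      NormedSpace.exp (-Y) * (u : V →L[ℝ] V) - 1 ∈ shift c l (p + 1) := by
    intro p
    induction p with
    | zero => exact ⟨0, Submodule.zero_mem _, by simpa using h⟩
    | succ p ih =>
      obtain ⟨Y, hY, hYu⟩ := ih
      set v : GLV V := expU (-Y) * u with hv
      have hvc : (v : V →L[ℝ] V) = NormedSpace.exp (-Y) * (u : V →L[ℝ] V) := rfl
      rw [← hvc] at hYu
      have hvG : v ∈ GLcone V :=
        mul_mem (expU_mem_GLcone ((strAlg V).neg_mem (nBar_le_strAlg hY))) hu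
      set X := comp c l (p + 1) ((v : V →L[ℝ] V) - 1)
      have hXs : X ∈ shift c l (p + 1) := comp_mem_shift hcs _ _
      -- The leading term is a tangent vector to the group: it is the limit of `(g_τ - 1) / τ^{p+1}`
      -- for the conjugates `g_τ` of `v` by the grading.
      have hX : IsStr X := by
        refine isStr_of_tendsto hV (l := nhdsWithin (0 : ℝ) (Set.Ioi 0))
          (g := fun τ => dil c l τ * v * (dil c l τ)⁻¹) (ε := fun τ => τ ^ (p + 1))
          (.of_forall fun τ => mul_mem (mul_mem (G_le (dil_mem_G τ)) hvG)
            (inv_mem (G_le (dil_mem_G τ)))) ?_ ?_ ((tendsto_dil_conj hcs hYu).congr fun τ => ?_)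
        · have h0 : Filter.Tendsto (fun τ : ℝ => τ ^ (p + 1)) (nhds 0) (nhds (0 ^ (p + 1))) :=
            (continuous_pow _).tendsto 0
          rw [zero_pow (Nat.succ_ne_zero p)] at h0
          exact h0.mono_left nhdsWithin_le_nhds
        · filter_upwards [self_mem_nhdsWithin] with τ hτ
          exact (pow_pos (show 0 < τ from hτ) _).ne'
        · rw [mul_sub, sub_mul, mul_one, Units.mul_inv]
          rfl
      have hXn : X ∈ nBar c l := mem_nBar hc hX (shift_mono (by omega) hXs)
      refine ⟨Y + X, Submodule.add_mem _ hY hXn, ?_⟩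
      -- Up to degree `p + 1` included, `exp(-Y - X)` is `exp(-Y) - X`, so replacing `Y` by `Y + X`
      -- removes the leading term.
      have h1 := exp_add_sub_mem_shift hcs (by omega : 1 ≤ p + 1)
        (Submodule.neg_mem _ (nBar_le_shift hcs hY)) (Submodule.neg_mem _ hXs)
      have h2 := mul_mem_shift hcs h1 hu0
      have h3 := mul_mem_shift hcs hXs h
      have h4 := sub_comp_mem_shift hcs hYu
      have h5 := Submodule.sub_mem _ (Submodule.add_mem _ h4 h2) h3
      convert h5 using 1
      rw [neg_add, hvc]
      change _ = _ - X + _ - _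
      noncomm_ring
  obtain ⟨Y, hY, hYu⟩ := key (2 * l)
  refine ⟨Y, hY, ?_⟩
  have h1 := sub_eq_zero.1 (eq_zero_of_mem_shift hcs (by omega) hYu)
  have h2 := congrArg (fun A => NormedSpace.exp Y * A) h1
  simpa only [← mul_assoc, exp_mul_exp_neg, one_mul, mul_one] using h2

/-! ### The centraliser of `𝔞_l` -/

section CSOI

variable {ι : Type*} [Fintype ι] {u : ι → V}

/-- On the component of type `(i, j)` the two sides act by `((μ_i + μ_j)/2)²` and `(μ_i² + μ_j²)/2`,
which differ by `(μ_i - μ_j)²/4`. -/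
lemma IsCSOI.offdiag_eq_zero (hu : IsCSOI u) {μ : ι → ℝ} {x : V}
    (h : jmul (∑ k, μ k • u k) (jmul (∑ k, μ k • u k) x) =
      jmul (jmul (∑ k, μ k • u k) (∑ k, μ k • u k)) x) {i j : ι} (hij : μ i ≠ μ j) :
    jmul (u i) (jmul (u j) x) = 0 := by
  classical
  have hne : i ≠ j := fun h => hij (h ▸ rfl)
  set v := jmul (u i) (jmul (u j) x) with hv
  have hL : ∀ ξ : ι → ℝ, jmul (∑ k, ξ k • u k) v = ((ξ i + ξ j) / 2) • v := fun ξ => by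
    have h1 : ∀ k, jmul (u k) v = ((if k = i then 1 / 2 else 0) + (if k = j then 1 / 2 else 0) : ℝ) •
        v := fun k => by
      by_cases hki : k = i
      · subst hki
        rw [hv, hu.jmul_jmul_half hne, if_pos rfl, if_neg hne, add_zero]
      · by_cases hkj : k = j
        · subst hkj
          rw [hv, hu.jmul_jmul_half' hne, if_pos rfl, if_neg hki, zero_add]
        · rw [hv, hu.jmul_jmul_zero hne hki hkj, if_neg hki, if_neg hkj, add_zero, zero_smul]
    simp only [map_sum, LinearMap.sum_apply, map_smul, LinearMap.smul_apply, h1, smul_smul,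
      ← Finset.sum_smul, mul_add, mul_ite, mul_zero, Finset.sum_add_distrib, Finset.sum_ite_eq',
      Finset.mem_univ, if_true]
    congr 1
    ring
  have hcomm : ∀ (ξ : ι → ℝ) (y : V), jmul (u i) (jmul (u j) (jmul (∑ k, ξ k • u k) y)) =
      jmul (∑ k, ξ k • u k) (jmul (u i) (jmul (u j) y)) := fun ξ y => by
    have hc : ∀ m, Commute (L (u m)) (L (∑ k, ξ k • u k)) := fun m => by
      rw [map_sum]
      exact Commute.sum_right _ _ _ fun k _ => by
        rw [map_smul]; exact (hu.commute m k).smul_right _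
    rw [jmul_left_comm_of_commute (hc j), jmul_left_comm_of_commute (hc i)]
  have h1 := congrArg (fun y => jmul (u i) (jmul (u j) y)) h
  simp only [hcomm, ← hv, hL, map_smul, hu.sum_jmul_sum] at h1
  rw [smul_smul, ← sub_eq_zero, ← sub_smul] at h1
  refine (smul_eq_zero.1 h1).resolve_left fun h2 => hij ?_
  have h3 : (μ i - μ j) ^ 2 = 0 := by linear_combination -4 * h2
  exact sub_eq_zero.1 (pow_eq_zero_iff two_ne_zero |>.1 h3)

/-- All mixed components of `x` at `i` vanish, so `x` is in `V(u_i, 1) + V(u_i, 0)`, whose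
multiplications commute with `L(u_i)`. -/
lemma IsCSOI.commute_of_jmul_jmul (hu : IsCSOI u) {μ : ι → ℝ} {x : V}
    (h : jmul (∑ k, μ k • u k) (jmul (∑ k, μ k • u k) x) =
      jmul (jmul (∑ k, μ k • u k) (∑ k, μ k • u k)) x) {i : ι} (hi : ∀ j, j ≠ i → μ i ≠ μ j) :
    Commute (L (u i)) (L x) := by
  classical
  have h1 : jmul (u i) (jmul (u i) x) = jmul (u i) x := by
    have h2 : jmul (u i) (jmul (∑ k, u k) x) = jmul (u i) x := by rw [hu.sum, e_jmul]
    rw [map_sum, LinearMap.sum_apply, map_sum, Finset.sum_eq_single i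
      (fun j _ hj => hu.offdiag_eq_zero h (hi j hj)) (fun h => absurd (Finset.mem_univ i) h)] at h2
    exact h2
  have h2 := (commute_L_of_one h1 (hu.idem i)).add_right
    (commute_L_of_zero (by rw [map_sub, h1, sub_self] : jmul (u i) (x - jmul (u i) x) = 0)
      (hu.idem i))
  rwa [← map_add, add_sub_cancel] at h2

lemma IsCSOI.exp_sum (hu : IsCSOI u) (ξ : ι → ℝ) :
    NormedSpace.exp (L (∑ k, ξ k • u k)) e = ∑ k, Real.exp (ξ k) • u k := by
  conv_lhs => rw [← hu.sum, map_sum]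
  refine Finset.sum_congr rfl fun k _ => exp_apply_eigenvector ?_
  rw [L_apply, jmul_comm, hu.jmul_sum]

/-- Since `k` fixes `e`, it fixes every polynomial in `∑ μ_m u_m`; the product of the factors `μ -
μ_j` over `j ≠ i` isolates `u_i`. -/
lemma IsCSOI.apply_eq (hu : IsCSOI u) {k : V →L[ℝ] V} {μ : ι → ℝ}
    (hk : Commute k (L (∑ m, μ m • u m))) (he : k e = e) {i : ι} (hi : ∀ j, j ≠ i → μ i ≠ μ j) :
    k (u i) = u i := by
  classical
  have key : ∀ s : Finset ι, k (∑ m, (∏ j ∈ s, (μ m - μ j)) • u m) =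
      ∑ m, (∏ j ∈ s, (μ m - μ j)) • u m := by
    intro s
    induction s using Finset.induction_on with
    | empty => simp [hu.sum, he]
    | insert a s ha ih =>
      have h1 : ∑ m, (∏ j ∈ insert a s, (μ m - μ j)) • u m =
          L (∑ m, μ m • u m) (∑ m, (∏ j ∈ s, (μ m - μ j)) • u m) -
            μ a • ∑ m, (∏ j ∈ s, (μ m - μ j)) • u m := by
        rw [L_apply, hu.sum_jmul_sum, Finset.smul_sum, ← Finset.sum_sub_distrib]
        refine Finset.sum_congr rfl fun m _ => ?_
        rw [Finset.prod_insert ha, smul_smul, ← sub_smul, sub_mul]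
      rw [h1, map_sub, map_smul, ih, ← mul_apply_eq_comp, hk.eq, mul_apply_eq_comp, ih]
  have h1 : ∑ m, (∏ j ∈ Finset.univ.erase i, (μ m - μ j)) • u m =
      (∏ j ∈ Finset.univ.erase i, (μ i - μ j)) • u i := by
    refine Finset.sum_eq_single i (fun m _ hm => ?_) (fun h => absurd (Finset.mem_univ i) h)
    rw [Finset.prod_eq_zero (Finset.mem_erase.2 ⟨hm, Finset.mem_univ m⟩) (sub_self _), zero_smul]
  have h2 := key (Finset.univ.erase i)
  rw [h1, map_smul] at h2
  refine smul_right_injective V (Finset.prod_ne_zero_iff.2 fun j hj => ?_) h2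
  exact sub_ne_zero.2 (hi j (Finset.mem_erase.1 hj).1)

end CSOI

lemma wt_ne {i j : Fin r} (hi : (i : ℕ) < l) (hj : j ≠ i) : (wt l i : ℝ) ≠ wt l j := by
  have : (j : ℕ) ≠ i := fun h => hj (Fin.ext h)
  norm_cast
  simp only [wt]
  omega

lemma commute_gradOp_iff {X : V →L[ℝ] V} :
    Commute (gradOp c l) X ↔ Commute (L (gradEl c l)) X :=
  ⟨fun h => by
    have := h.smul_left (1 / 2 : ℝ)
    rwa [gradOp, smul_smul, show (1 / 2 : ℝ) * 2 = 1 by norm_num, one_smul] at this,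
    fun h => h.smul_left _⟩

lemma P_apply_e (y : V) : P y e = jmul y y := by
  rw [P_apply, jmul_e, jmul_e]; module

/-- Polar decomposition in the centraliser of `𝔞_l`. -/
lemma exists_polar_of_commute (hV : IsSimple V) (hc : IsCSOI c) {z : GLV V} (hz : z ∈ GLcone V)
    (h : Commute (gradOp c l) (z : V →L[ℝ] V)) : ∃ (x : V) (k : GLV V), k ∈ GLcone V ∧
      (k : V →L[ℝ] V) e = e ∧ z = expU (L x) * k ∧
      ∀ i : Fin r, (i : ℕ) < l → Commute (L (c i)) (L x) ∧ (k : V →L[ℝ] V) (c i) = c i := by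
  obtain ⟨x, k, hk, hke, rfl⟩ := exists_polar hz
  refine ⟨x, k, hk, hke, rfl, ?_⟩
  set h₀ := gradEl c l with hh₀
  set z : GLV V := expU (L x) * k with hzdef
  rw [commute_gradOp_iff] at h
  obtain ⟨s, u, hu, hx, -⟩ := exists_spectral x
  set y := (z : V →L[ℝ] V) e with hy
  have hyx : y = ∑ i : s, Real.exp i • u i := by
    rw [hy, hzdef, Units.val_mul, mul_apply_eq_comp, hke, hx]
    exact hu.exp_sum _
  have hadj : Commute (L h₀) (ContinuousLinearMap.adjoint (z : V →L[ℝ] V)) := by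
    have h1 := congrArg ContinuousLinearMap.adjoint h.eq
    rw [adjoint_mul, adjoint_mul, adjoint_L] at h1
    exact h1.symm
  -- For `y = z e` one has `P(y) = z z*`, which commutes with `L(h₀)` because `z` and `z*` do.
  -- Evaluated at `e`, this is `y (y h₀) = y² h₀`, so the spectral idempotents of `y`, which are
  -- also those of `x`, operator-commute with `h₀`.
  have hP : Commute (L h₀) (P y) := by
    rw [hy, P_GLcone hV hz, P_e, mul_one]
    exact h.mul_right hadj
  have hrel : jmul y (jmul y h₀) = jmul (jmul y y) h₀ := by
    have h1 := congrArg (fun A : V →L[ℝ] V => A e) hP.eq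
    simp only [mul_apply_eq_comp, L_apply, jmul_e, P_apply_e] at h1
    rw [P_apply, jmul_comm h₀] at h1
    linear_combination (norm := module) -(1 / 2 : ℝ) • h1
  rw [hyx] at hrel
  have hcu : ∀ i, Commute (L (u i)) (L h₀) := fun i =>
    hu.commute_of_jmul_jmul hrel fun j hj => by
      rw [Ne, Real.exp_eq_exp]
      exact fun h => hj (Subtype.ext h.symm)
  have hxh : Commute (L x) (L h₀) := by
    rw [hx, map_sum]
    exact Commute.sum_left _ _ _ fun i _ => by rw [map_smul]; exact (hcu i).smul_left _
  have hkh : Commute (L h₀) (k : V →L[ℝ] V) := by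
    have h1 : (k : V →L[ℝ] V) = NormedSpace.exp (-L x) * (z : V →L[ℝ] V) := by
      rw [hzdef, Units.val_mul, ← mul_assoc]
      change _ = NormedSpace.exp (-L x) * NormedSpace.exp (L x) * _
      rw [exp_neg_mul_exp, one_mul]
    rw [h1]
    exact (hxh.symm.neg_right.exp_right).mul_right h
  intro i hi
  refine ⟨?_, hc.apply_eq hkh.symm hke fun j hj => wt_ne hi hj⟩
  -- The same criterion with the roles of `x` and `h₀` exchanged; a weight with `i < l` differs from
  -- all the others.
  refine hc.commute_of_jmul_jmul (μ := fun k => (wt l k : ℝ)) ?_ fun j hj => wt_ne hi hj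
  have h1 := congrArg (fun A : V →L[ℝ] V => A h₀) hxh.eq
  simp only [mul_apply_eq_comp, L_apply] at h1
  change jmul h₀ (jmul h₀ x) = jmul (jmul h₀ h₀) x
  rw [jmul_comm h₀ x, ← h1, jmul_comm]

lemma commute_gradOp_of_commute {X : V →L[ℝ] V}
    (h : ∀ i : Fin r, (i : ℕ) < l → Commute (L (c i)) X) : Commute (gradOp c l) X := by
  rw [gradOp_eq]
  refine Commute.sum_left _ _ _ fun i _ => ?_
  by_cases hi : (i : ℕ) < l
  · exact (h i hi).smul_left _
  · rw [wt, Nat.sub_eq_zero_of_le (not_lt.1 hi)]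
    simp

lemma conj_eq_iff {g : GLV V} {X : V →L[ℝ] V} :
    (g : V →L[ℝ] V) * X * ((g⁻¹ : GLV V) : V →L[ℝ] V) = X ↔ Commute X (g : V →L[ℝ] V) := by
  rw [Units.mul_inv_eq_iff_eq_mul]
  exact ⟨fun h => h.symm, fun h => h.eq.symm⟩

lemma mem_centr_span {H : Set (GLV V)} {S : Set (V →L[ℝ] V)} {g : GLV V} :
    g ∈ centr H (Submodule.span ℝ S : Set (V →L[ℝ] V)) ↔
      g ∈ H ∧ ∀ X ∈ S, Commute X (g : V →L[ℝ] V) := by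
  refine and_congr_right fun _ => ⟨fun h X hX => conj_eq_iff.1 (h X (Submodule.subset_span hX)),
    fun h X hX => conj_eq_iff.2 ?_⟩
  induction hX using Submodule.span_induction with
  | mem X hX => exact h X hX
  | zero => exact Commute.zero_left _
  | add X Y _ _ hX hY => exact hX.add_left hY
  | smul a X _ hX => exact hX.smul_left a

lemma mem_ZA_iff {g : GLV V} : g ∈ ZA c l ↔
    g ∈ G V ∧ ∀ i : Fin r, (i : ℕ) < l → Commute (L (c i)) (g : V →L[ℝ] V) := by
  rw [ZA, aSub, mem_centr_span]
  refine and_congr_right fun _ => ?_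
  simp only [Set.forall_mem_range, Subtype.forall]

/-- The polar factors of an element commuting with `D` are controlled separately: `x`
operator-commutes with each `c_i`, `i ≤ l`, and `k` fixes it, so both commute with `L(c_i)`. -/
lemma mem_ZA_iff_gradOp (hV : IsSimple V) (hc : IsCSOI c) {g : GLV V} : g ∈ ZA c l ↔
    g ∈ G V ∧ Commute (gradOp c l) (g : V →L[ℝ] V) := by
  rw [mem_ZA_iff]
  refine ⟨fun h => ⟨h.1, commute_gradOp_of_commute h.2⟩, fun ⟨hg, h⟩ => ⟨hg, fun i hi => ?_⟩⟩
  obtain ⟨x, k, hk, hke, rfl, hi'⟩ := exists_polar_of_commute hV hc (G_le hg) h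
  obtain ⟨h1, h2⟩ := hi' i hi
  have h3 := (isAut_of_mem hk hke).mul_L (c i)
  rw [h2] at h3
  exact h1.exp_right.mul_right h3.symm

lemma mem_G'_iff (hV : IsSimple V) (hc : IsJordanFrame c) {g : GLV V} :
    g ∈ G' V ↔ g ∈ G V ∧ |(g : V →L[ℝ] V).det| = 1 := by
  refine and_congr_right fun hg => ?_
  have hr : (r : ℝ) / Module.finrank ℝ V ≠ 0 :=
    (div_pos (by exact_mod_cast hc.pos hV) (finrank_pos_of_isSimple hV)).ne'
  rw [jdet_apply_e hV hc (G_le hg), ← Real.rpow_left_inj (abs_nonneg _) zero_le_one hr,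
    Real.one_rpow]

lemma Q'_subset (hV : IsSimple V) (hc : IsJordanFrame c) (hlr : l < r) {g : GLV V}
    (hg : g ∈ Q' c l) : g ∈ Q c l := by
  obtain ⟨⟨hgG, -⟩, hq⟩ := hg
  rw [qSub'_eq hV hc hlr] at hq
  have hcs := hc.isCSOI
  have h1 : ∀ X ∈ qStr c l, (g : V →L[ℝ] V) * X * ((g⁻¹ : GLV V) : V →L[ℝ] V) ∈ qStr c l :=
    fun X hX => (hq X).1 hX
  have h2 : ∀ X ∈ qStr c l, ((g⁻¹ : GLV V) : V →L[ℝ] V) * X * (g : V →L[ℝ] V) ∈ qStr c l :=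
    fun X hX => (hq _).2 (by rwa [conj_conj_inv])
  have f1 := mem_shift_zero_of_conj hV hc hlr fun X hX => conj_mem_nBar hV hc h1 h2 hX
  have f2 := mem_shift_zero_of_conj hV hc hlr fun X hX =>
    conj_mem_nBar (g := g⁻¹) hV hc (by simpa using h2) (by simpa using h1) hX
  obtain ⟨z, hz, hzc⟩ := exists_comp_zero_mem_G hcs hgG f1 f2
  have hzcomm : Commute (gradOp c l) (z : V →L[ℝ] V) := by
    rw [hzc]; exact commute_comp_zero hcs _
  have hzinv : Commute (gradOp c l) ((z⁻¹ : GLV V) : V →L[ℝ] V) := hzcomm.units_inv_right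
  refine ⟨z, (mem_ZA_iff_gradOp hV hcs).2 ⟨hz, hzcomm⟩, z⁻¹ * g,
    mem_NBar_of_sub_one_mem_shift hV hc (G_le (mul_mem (inv_mem hz) hgG)) ?_, by group⟩
  have h3 := mul_mem_shift hcs (mem_shift_of_commute hcs hzinv) (sub_comp_mem_shift hcs f1)
  rwa [← hzc, mul_sub, Units.inv_mul, ← Units.val_mul] at h3

lemma NBar_spec (hc : IsCSOI c) {n : GLV V} (hn : n ∈ NBar c l) :
    n ∈ G V ∧ (n : V →L[ℝ] V) - 1 ∈ shift c l 1 ∧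
      ((n⁻¹ : GLV V) : V →L[ℝ] V) ∈ shift c l 0 := by
  obtain ⟨X, hX, hn⟩ := hn
  obtain rfl : n = expU X := Units.ext hn
  refine ⟨expU_mem_G (nBar_le_strAlg hX), exp_sub_one_mem_shift hc (nBar_le_shift hc hX), ?_⟩
  exact exp_mem_shift hc (Submodule.neg_mem _ (shift_mono (Nat.zero_le 1) (nBar_le_shift hc hX)))

lemma mem_shift_zero_of_sub_one (hc : IsCSOI c) {X : V →L[ℝ] V} (h : X - 1 ∈ shift c l 1) :
    X ∈ shift c l 0 := by
  have := Submodule.add_mem _ (shift_mono (Nat.zero_le 1) h) (one_mem_shift (l := l) hc)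
  rwa [sub_add_cancel] at this

lemma conj_mem_qStr (hV : IsSimple V) (hc : IsCSOI c) {g : GLV V} (hg : g ∈ GLcone V)
    (h1 : (g : V →L[ℝ] V) ∈ shift c l 0) (h2 : ((g⁻¹ : GLV V) : V →L[ℝ] V) ∈ shift c l 0)
    {X : V →L[ℝ] V} (hX : X ∈ qStr c l) :
    (g : V →L[ℝ] V) * X * ((g⁻¹ : GLV V) : V →L[ℝ] V) ∈ qStr c l :=
  ⟨⟨IsStr.conj hV hg hX.1.1, LinearMap.mem_ker.2 (by rw [tr_conj]; exact hX.1.2)⟩,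
    mul_mem_shift hc (mul_mem_shift hc h1 hX.2) h2⟩

/-- `Q'_l = Q_l ∩ G'`. -/
lemma mem_Q'_iff (hV : IsSimple V) (hc : IsJordanFrame c) (hlr : l < r) {g : GLV V} :
    g ∈ Q' c l ↔ g ∈ Q c l ∧ g ∈ G' V := by
  have hcs := hc.isCSOI
  refine ⟨fun h => ⟨Q'_subset hV hc hlr h, h.1⟩, fun ⟨⟨z, hz, n, hn, hg⟩, hG⟩ => ⟨hG, fun X => ?_⟩⟩
  rw [qSub'_eq hV hc hlr]
  obtain ⟨hz1, hz2⟩ := (mem_ZA_iff_gradOp hV hcs).1 hz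
  obtain ⟨hn1, hn2, hn3⟩ := NBar_spec hcs hn
  have f1 : (g : V →L[ℝ] V) ∈ shift c l 0 := by
    rw [hg, Units.val_mul]
    exact mul_mem_shift hcs (mem_shift_of_commute hcs hz2) (mem_shift_zero_of_sub_one hcs hn2)
  have f2 : ((g⁻¹ : GLV V) : V →L[ℝ] V) ∈ shift c l 0 := by
    rw [hg, mul_inv_rev, Units.val_mul]
    exact mul_mem_shift hcs hn3 (mem_shift_of_commute hcs hz2.units_inv_right)
  have hgG := G_le hG.1
  refine ⟨fun hX => conj_mem_qStr hV hcs hgG f1 f2 hX, fun hX => ?_⟩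
  have := conj_mem_qStr (g := g⁻¹) hV hcs (inv_mem hgG) f2 (by simpa using f1) hX
  simpa [mul_assoc] using this

/-! ### The characters of `Q_l` and `Q'_l` -/

lemma diagCoeff_add (X Y : V →L[ℝ] V) (j : Fin r) :
    diagCoeff c (X + Y) j = diagCoeff c X j + diagCoeff c Y j := by
  simp only [diagCoeff, add_apply, inner_add_right, add_div]

lemma diagCoeff_of_eigen (hc : IsJordanFrame c) {X : V →L[ℝ] V} {j : Fin r} {a : ℝ}
    (h : X (c j) = a • c j) : diagCoeff c X j = a := by
  rw [diagCoeff, h, inner_smul_right, mul_div_cancel_right₀ _ (hc.inner_pos j).ne']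

/-- The factor `n` alters `c_j` only in higher degree, which the diagonal coefficient does not see.
Hence `log a(q)` can be read off from `q`, whichever factorisation `logA` has chosen. -/
lemma diagCoeff_mul_exp_mul (hc : IsJordanFrame c) {m X n : V →L[ℝ] V} {j : Fin r} {a : ℝ}
    (hm : Commute (gradOp c l) m) (hmj : m (c j) = c j) (hX : Commute (gradOp c l) X)
    (hXj : X (c j) = a • c j) (hn : n - 1 ∈ shift c l 1) :
    diagCoeff c (m * NormedSpace.exp X * n) j = Real.exp a := by
  have hcs := hc.isCSOI
  have h1 : m * NormedSpace.exp X * n = m * NormedSpace.exp X +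
      m * NormedSpace.exp X * (n - 1) := by noncomm_ring
  have h2 := mul_mem_shift hcs (mem_shift_of_commute hcs (hm.mul_right hX.exp_right)) hn
  rw [h1, diagCoeff_add, diagCoeff_eq_zero hcs h2, add_zero]
  refine diagCoeff_of_eigen hc ?_
  rw [mul_apply_eq_comp, exp_apply_eigenvector hXj, map_smul, hmj]

lemma hVec_apply_frame (hc : IsCSOI c) {i : Fin r} (hi : (i : ℕ) < l) (j : Fin r) :
    hVec c l j (c i) = if j = i then c i else 0 := by
  rw [hVec, sub_apply, smul_apply, L_apply, L_apply, jmul_sub_eSum hc hi, smul_zero, sub_zero]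
  split_ifs with h
  · rw [h, hc.idem]
  · exact hc.orth j i h

lemma sum_smul_apply_frame {A : Fin r → V →L[ℝ] V}
    (hA : ∀ i j : Fin r, (i : ℕ) < l → A j (c i) = if j = i then c i else 0)
    (a : {j : Fin r // (j : ℕ) < l} → ℝ) {i : Fin r} (hi : (i : ℕ) < l) :
    (∑ j, a j • A j) (c i) = a ⟨i, hi⟩ • c i := by
  rw [sum_apply, Finset.sum_eq_single ⟨i, hi⟩]
  · rw [smul_apply, hA i _ hi, if_pos rfl]
  · intro j _ hj
    rw [smul_apply, hA i _ hi, if_neg fun h => hj (Subtype.ext h), smul_zero]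
  · exact fun h => absurd (Finset.mem_univ _) h

lemma L_apply_frame (hc : IsCSOI c) (i j : Fin r) : L (c j) (c i) = if j = i then c i else 0 := by
  rw [L_apply, hc.jmul_eq]
  split_ifs with h
  · rw [h]
  · rfl

lemma exists_eq_sum_aVec (X : aSub c l) : ∃ a : {j : Fin r // (j : ℕ) < l} → ℝ,
    X = ∑ j, a j • aVec c l j := by
  obtain ⟨a, ha⟩ := (Submodule.mem_span_range_iff_exists_fun ℝ).1 X.2
  exact ⟨a, Subtype.ext (by rw [← ha]; simp [aVec])⟩

lemma exists_eq_sum_aVec' (X : aSub' c l) : ∃ a : {j : Fin r // (j : ℕ) < l} → ℝ,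
    X = ∑ j, a j • aVec' c l j := by
  obtain ⟨a, ha⟩ := (Submodule.mem_span_range_iff_exists_fun ℝ).1 X.2
  exact ⟨a, Subtype.ext (by rw [← ha]; simp [aVec'])⟩

lemma coe_sum_aVec (a : {j : Fin r // (j : ℕ) < l} → ℝ) :
    ((∑ j, a j • aVec c l j : aSub c l) : V →L[ℝ] V) = ∑ j, a j • L (c j) := by simp [aVec]

lemma coe_sum_aVec' (a : {j : Fin r // (j : ℕ) < l} → ℝ) :
    ((∑ j, a j • aVec' c l j : aSub' c l) : V →L[ℝ] V) = ∑ j, a j • hVec c l j := by simp [aVec']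

lemma commute_gradOp_sum {A : Fin r → V →L[ℝ] V} (hA : ∀ j, Commute (gradOp c l) (A j))
    (a : {j : Fin r // (j : ℕ) < l} → ℝ) : Commute (gradOp c l) (∑ j, a j • A j) :=
  Commute.sum_right _ _ _ fun j _ => (hA j).smul_right _

lemma logA_eq (hc : IsJordanFrame c) {q : GLV V} (h : ∃ X : aSub c l, ∃ m ∈ M c l,
      ∃ n ∈ NBar c l, (q : V →L[ℝ] V) = m * NormedSpace.exp (X : V →L[ℝ] V) * n) :
    logA (M c l) (aSub c l) (NBar c l) q =
      ∑ j : {j : Fin r // (j : ℕ) < l}, Real.log (diagCoeff c q j) • aVec c l j := by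
  have hcs := hc.isCSOI
  have hX : logA (M c l) (aSub c l) (NBar c l) q = h.choose := dif_pos h
  rw [hX]
  obtain ⟨m, hm, n, hn, hq⟩ := h.choose_spec
  obtain ⟨a, ha⟩ := exists_eq_sum_aVec h.choose
  rw [ha] at hq ⊢
  refine Finset.sum_congr rfl fun j _ => ?_
  rw [coe_sum_aVec] at hq
  rw [hq, diagCoeff_mul_exp_mul (l := l) (a := a j) hc
    (commute_gradOp_of_commute (mem_ZA_iff.1 hm.1).2) (hm.2 j j.2)
    (commute_gradOp_sum (commute_gradOp_L hcs) a)
    (sum_smul_apply_frame (fun i j _ => L_apply_frame hcs i j) a j.2)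
    (NBar_spec hcs hn).2.1, Real.log_exp]

lemma hVec_eq_L (j : Fin r) : hVec c l j = L (c j - ((r : ℝ) - l)⁻¹ • (e - eSum c l)) := by
  rw [hVec, map_sub L (c j), map_smul]

lemma K_apply_eSum {k : V →L[ℝ] V} (h : ∀ i : Fin r, (i : ℕ) < l → k (c i) = c i) :
    k (eSum c l) = eSum c l := by
  rw [eSum, map_sum]
  exact Finset.sum_congr rfl fun i _ => h i i.2

/-- An automorphism commutes with `𝔞'_l` if and only if it fixes `c_1, …, c_l`. -/
lemma mem_centr_aSub'_iff (hc : IsCSOI c) (hlr : l < r) {k : GLV V} (hk : k ∈ K V) :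
    k ∈ centr (K V) (aSub' c l) ↔ ∀ i : Fin r, (i : ℕ) < l → (k : V →L[ℝ] V) (c i) = c i := by
  have haut := isAut_of_mem (G_le hk.1) hk.2
  rw [aSub', mem_centr_span]
  simp only [hk, true_and, Set.forall_mem_range, Subtype.forall]
  constructor
  · intro h i hi
    have hd : (0 : ℝ) < (r : ℝ) - l := sub_pos.2 (by exact_mod_cast hlr)
    -- In `∑ wt_j h_j` the idempotents after the first `l` receive the common coefficient `-s ≤ 0`,
    -- so the positive weights remain separated from it and from each other.
    set s : ℝ := ((r : ℝ) - l)⁻¹ * ∑ j : {j : Fin r // (j : ℕ) < l}, (wt l (j : Fin r) : ℝ)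
    have hs : 0 ≤ s := by positivity
    have h1 : ∑ j : {j : Fin r // (j : ℕ) < l}, (wt l (j : Fin r) : ℝ) • hVec c l j =
        L (∑ j : Fin r, (if (j : ℕ) < l then (wt l j : ℝ) else -s) • c j) := by
      have h2 : ∑ j : {j : Fin r // (j : ℕ) < l}, (wt l (j : Fin r) : ℝ) • L (c j) =
          ∑ j : Fin r, if (j : ℕ) < l then (wt l j : ℝ) • L (c j) else 0 := by
        rw [← Finset.sum_filter]
        exact (Finset.sum_subtype (p := fun j : Fin r => (j : ℕ) < l) _ (by simp)
          fun j => (wt l j : ℝ) • L (c j)).symm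
      simp only [hVec, smul_sub, Finset.sum_sub_distrib, h2]
      rw [← Finset.sum_smul, smul_smul, mul_comm (∑ j, _), L_sub_eSum hc, Finset.smul_sum,
        ← Finset.sum_sub_distrib, map_sum]
      refine Finset.sum_congr rfl fun j _ => ?_
      by_cases hj : (j : ℕ) < l
      · simp [hj]
      · simp [hj, not_lt.1 hj, s]
    refine hc.apply_eq (μ := fun j : Fin r => if (j : ℕ) < l then (wt l j : ℝ) else -s) ?_ hk.2 ?_
    · rw [← h1]
      exact Commute.sum_right _ _ _ fun j _ => (h j j.2).symm.smul_right _
    · intro j hj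
      simp only [if_pos hi]
      split_ifs with hjl
      · exact wt_ne hi hj
      · have : 0 < wt l i := by simp only [wt]; omega
        have : (0 : ℝ) < wt l i := by exact_mod_cast this
        linarith
  · intro h j hj
    have h1 := haut.mul_L (c j - ((r : ℝ) - l)⁻¹ • (e - eSum c l))
    rw [map_sub (k : V →L[ℝ] V), map_smul (k : V →L[ℝ] V), map_sub (k : V →L[ℝ] V), h j hj, hk.2,
      K_apply_eSum h] at h1
    rw [hVec_eq_L]
    exact h1.symm

lemma commute_gradOp_of_aut {k : GLV V} (hk : IsAut (k : V →L[ℝ] V))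
    (h : ∀ i : Fin r, (i : ℕ) < l → (k : V →L[ℝ] V) (c i) = c i) :
    Commute (gradOp c l) (k : V →L[ℝ] V) := by
  refine commute_gradOp_of_commute fun i hi => ?_
  have h1 := hk.mul_L (c i)
  rw [h i hi] at h1
  exact h1.symm

lemma logA'_eq (hV : IsSimple V) (hc : IsJordanFrame c) (hlr : l < r) {q : GLV V}
    (h : ∃ X : aSub' c l, ∃ m ∈ M' c l,
      ∃ n ∈ NBar c l, (q : V →L[ℝ] V) = m * NormedSpace.exp (X : V →L[ℝ] V) * n) :
    logA (M' c l) (aSub' c l) (NBar c l) q =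
      ∑ j : {j : Fin r // (j : ℕ) < l}, Real.log (diagCoeff c q j) • aVec' c l j := by
  have hcs := hc.isCSOI
  have hX : logA (M' c l) (aSub' c l) (NBar c l) q = h.choose := dif_pos h
  rw [hX]
  obtain ⟨_, ⟨k, hk, m, ⟨Y, ⟨hY, -⟩, hm⟩, rfl⟩, n, hn, hq⟩ := h.choose_spec
  obtain ⟨a, ha⟩ := exists_eq_sum_aVec' h.choose
  rw [ha] at hq ⊢
  refine Finset.sum_congr rfl fun j _ => ?_
  rw [coe_sum_aVec'] at hq
  have hk1 := (mem_centr_aSub'_iff hcs hlr hk.1).1 hk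
  have hY1 := mSub'_le hV hc hlr hY
  rw [hq, diagCoeff_mul_exp_mul (l := l) (a := a j) hc ?_ ?_
    (commute_gradOp_sum (commute_gradOp_hVec hcs) a)
    (sum_smul_apply_frame (fun i j hi => hVec_apply_frame hcs hi j) a j.2)
    (NBar_spec hcs hn).2.1, Real.log_exp]
  · rw [Units.val_mul, hm]
    exact (commute_gradOp_of_aut (isAut_of_mem (G_le hk.1.1) hk.1.2) hk1).mul_right
      hY1.2.2.1.exp_right
  · rw [Units.val_mul, mul_apply_eq_comp, hm, exp_apply_fixed (hY1.2.2.2 j j.2), hk1 j j.2]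

lemma exists_eigen_of_commute (hc : IsJordanFrame c) {x : V} {i : Fin r}
    (h : Commute (L (c i)) (L x)) : ∃ a : ℝ, jmul x (c i) = a • c i := by
  refine (hc.1 i).exists_smul ?_
  rw [jmul_left_comm_of_commute h, hc.isCSOI.idem]

/-- Elements of `Z_G(𝔞_l)` act on `c_1, …, c_l` by positive scalars. -/
lemma exists_eigen_ZA (hV : IsSimple V) (hc : IsJordanFrame c) {z : GLV V} (hz : z ∈ ZA c l) :
    ∃ ξ : {j : Fin r // (j : ℕ) < l} → ℝ,
    ∀ j : {j : Fin r // (j : ℕ) < l}, (z : V →L[ℝ] V) (c j) = Real.exp (ξ j) • c j := by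
  obtain ⟨hz1, hz2⟩ := (mem_ZA_iff_gradOp hV hc.isCSOI).1 hz
  obtain ⟨x, k, -, -, rfl, h⟩ := exists_polar_of_commute hV hc.isCSOI (G_le hz1) hz2
  choose ξ hξ using fun j : {j : Fin r // (j : ℕ) < l} =>
    exists_eigen_of_commute hc (h j j.2).1
  refine ⟨ξ, fun j => ?_⟩
  rw [Units.val_mul, mul_apply_eq_comp, (h j j.2).2]
  exact exp_apply_eigenvector (hξ j)

/-- If `z c_j = exp(ξ_j) c_j`, then `z exp(-∑ ξ_j L(c_j))` fixes `c_1, …, c_l` and still centralises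
`𝔞_l`. -/
lemma exists_decomposition_Q (hV : IsSimple V) (hc : IsJordanFrame c) {q : GLV V}
    (hq : q ∈ Q c l) : ∃ X : aSub c l, ∃ m ∈ M c l,
      ∃ n ∈ NBar c l, (q : V →L[ℝ] V) = m * NormedSpace.exp (X : V →L[ℝ] V) * n := by
  have hcs := hc.isCSOI
  obtain ⟨z, hz, n, hn, rfl⟩ := hq
  obtain ⟨ξ, hξ⟩ := exists_eigen_ZA hV hc hz
  set X : aSub c l := ∑ j, ξ j • aVec c l j
  have hX : (X : V →L[ℝ] V) = ∑ j, ξ j • L (c j) := coe_sum_aVec ξ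
  have hXs : IsStr (X : V →L[ℝ] V) := by
    rw [hX]
    exact (strAlg V).sum_mem fun j _ => (strAlg V).smul_mem _ (isStr_L _)
  have hXc : ∀ i, Commute (L (c i)) (X : V →L[ℝ] V) := fun i => by
    rw [hX]
    exact Commute.sum_right _ _ _ fun j _ => (hcs.commute i j).smul_right _
  refine ⟨X, z * expU (-(X : V →L[ℝ] V)), ⟨mem_ZA_iff.2 ⟨mul_mem hz.1
    (expU_mem_G ((strAlg V).neg_mem hXs)), fun i hi => ?_⟩, fun j hj => ?_⟩, n, hn, ?_⟩
  · exact ((mem_ZA_iff.1 hz).2 i hi).mul_right (hXc i).neg_right.exp_right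
  · have h1 : (-(X : V →L[ℝ] V)) (c j) = (-ξ ⟨j, hj⟩) • c j := by
      rw [neg_apply, hX, sum_smul_apply_frame (fun i j _ => L_apply_frame hcs i j) ξ hj, neg_smul]
    rw [Units.val_mul, mul_apply_eq_comp]
    change (z : V →L[ℝ] V) (NormedSpace.exp (-(X : V →L[ℝ] V)) (c j)) = _
    rw [exp_apply_eigenvector h1, map_smul, hξ ⟨j, hj⟩, smul_smul, ← Real.exp_add, neg_add_cancel,
      Real.exp_zero, one_smul]
  · rw [Units.val_mul, Units.val_mul, mul_assoc (z : V →L[ℝ] V)]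
    change _ = _ * (NormedSpace.exp (-(X : V →L[ℝ] V)) * _) * _
    rw [exp_neg_mul_exp, mul_one]

lemma comp_zero_of_sub_one (hc : IsCSOI c) {X : V →L[ℝ] V} (h : X - 1 ∈ shift c l 1) :
    comp c l 0 X = 1 := by
  rw [← comp_zero_one (l := l) hc]
  refine Finset.sum_congr rfl fun t _ => Finset.sum_congr rfl fun s _ => ?_
  split_ifs with hst
  · have := h s t (by omega)
    rwa [mul_sub, sub_mul, sub_eq_zero] at this
  · rfl

/-- Unipotent elements have determinant one. -/
lemma det_of_sub_one_mem_shift (hc : IsCSOI c) {n : V →L[ℝ] V} (h : n - 1 ∈ shift c l 1) :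
    n.det = 1 := by
  -- Conjugates of `n` by the grading tend to the identity, and the determinant is constant along
  -- them.
  have h1 := tendsto_dil_conj hc (mem_shift_zero_of_sub_one hc h)
  rw [comp_zero_of_sub_one hc h] at h1
  have h2 := (ContinuousLinearMap.continuous_det.tendsto _).comp h1
  have h3 : (1 : V →L[ℝ] V).det = 1 := LinearMap.det_id
  rw [h3] at h2
  refine tendsto_nhds_unique (tendsto_const_nhds.congr fun τ => ?_) h2
  have h4 : (dil c l τ : V →L[ℝ] V).det * ((dil c l τ)⁻¹ : GLV V).val.det = 1 := by
    rw [← det_mul', Units.mul_inv, h3]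
  simp only [Function.comp_apply, pow_zero, inv_one, one_smul, det_mul']
  linear_combination -n.det * h4

/-- As for `Q_l`, now dividing by `exp(∑ ξ_j h_j)`, which has determinant one. The quotient `m`
fixes `c_1, …, c_l` and has `|det m| = 1`; in its polar decomposition `exp(L(y)) k` the element `y`
then annihilates `c_1, …, c_l` and has trace zero, so both factors are of the kind that occurs in
`M'_l`. -/
lemma exists_decomposition_Q' (hV : IsSimple V) (hc : IsJordanFrame c) (hlr : l < r) {q : GLV V}
    (hq : q ∈ Q c l) (hqG : q ∈ G' V) : ∃ X : aSub' c l, ∃ m ∈ M' c l,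
      ∃ n ∈ NBar c l, (q : V →L[ℝ] V) = m * NormedSpace.exp (X : V →L[ℝ] V) * n := by
  have hcs := hc.isCSOI
  obtain ⟨z, hz, n, hn, rfl⟩ := hq
  obtain ⟨ξ, hξ⟩ := exists_eigen_ZA hV hc hz
  set X : aSub' c l := ∑ j, ξ j • aVec' c l j
  have hX : (X : V →L[ℝ] V) = ∑ j, ξ j • hVec c l j := coe_sum_aVec' ξ
  have hXs : IsStr (X : V →L[ℝ] V) := by
    rw [hX]
    exact (strAlg V).sum_mem fun j _ => (strAlg V).smul_mem _ (isStr_hVec _)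
  set m : GLV V := z * expU (-(X : V →L[ℝ] V)) with hmdef
  have hmc : (m : V →L[ℝ] V) = z * NormedSpace.exp (-(X : V →L[ℝ] V)) := rfl
  have hmG : m ∈ G V := mul_mem hz.1 (expU_mem_G ((strAlg V).neg_mem hXs))
  have hmcomm : Commute (gradOp c l) (m : V →L[ℝ] V) := by
    refine ((mem_ZA_iff_gradOp hV hcs).1 hz).2.mul_right (Commute.exp_right (Commute.neg_right ?_))
    rw [hX]
    exact commute_gradOp_sum (commute_gradOp_hVec hcs) ξ
  have hmj : ∀ j : Fin r, (j : ℕ) < l → (m : V →L[ℝ] V) (c j) = c j := fun j hj => by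
    have h1 : (-(X : V →L[ℝ] V)) (c j) = (-ξ ⟨j, hj⟩) • c j := by
      rw [neg_apply, hX, sum_smul_apply_frame (fun i j hi => hVec_apply_frame hcs hi j) ξ hj,
        neg_smul]
    rw [hmc, mul_apply_eq_comp, exp_apply_eigenvector h1, map_smul, hξ ⟨j, hj⟩, smul_smul,
      ← Real.exp_add, neg_add_cancel, Real.exp_zero, one_smul]
  have hqm : ((z * n : GLV V) : V →L[ℝ] V) = m * NormedSpace.exp (X : V →L[ℝ] V) * n := by
    rw [hmc, mul_assoc (z : V →L[ℝ] V), exp_neg_mul_exp, mul_one, Units.val_mul]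
  refine ⟨X, m, ?_, n, hn, hqm⟩
  have hdetX : (NormedSpace.exp (X : V →L[ℝ] V)).det = 1 := by
    have h1 : (X : V →L[ℝ] V) = L (∑ j, ξ j • (c j - ((r : ℝ) - l)⁻¹ • (e - eSum c l))) := by
      rw [hX, map_sum]
      exact Finset.sum_congr rfl fun j _ => by rw [hVec_eq_L, map_smul]
    have h2 : tr V (X : V →L[ℝ] V) = 0 := by
      rw [hX, map_sum]
      exact Finset.sum_eq_zero fun j _ => by rw [map_smul, tr_hVec hV hc hlr, smul_zero]
    rw [h1, det_exp_L, ← h1, h2, Real.exp_zero]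
  have hdetm : |(m : V →L[ℝ] V).det| = 1 := by
    have h1 := ((mem_G'_iff hV hc).1 hqG).2
    rwa [hqm, det_mul', det_mul', hdetX, det_of_sub_one_mem_shift hcs (NBar_spec hcs hn).2.1,
      mul_one, mul_one] at h1
  obtain ⟨y, k, hk, hke, hm, hyk⟩ := exists_polar_of_commute hV hcs (G_le hmG) hmcomm
  have haut := isAut_of_mem hk hke
  have hkinv : ((k⁻¹ : GLV V) : V →L[ℝ] V) e = e := by
    conv_lhs => rw [← hke, unit_inv_apply]
  have hautinv := isAut_of_mem (inv_mem hk) hkinv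
  have hkG : k ∈ G V := by
    have h1 : k = (expU (L y))⁻¹ * m := by rw [hm]; group
    rw [h1]
    exact mul_mem (inv_mem (expU_mem_G (isStr_L y))) hmG
  have hyc : ∀ i : Fin r, (i : ℕ) < l → jmul y (c i) = 0 := fun i hi => by
    obtain ⟨a, ha⟩ := exists_eigen_of_commute hc (hyk i hi).1
    have h1 := hmj i hi
    rw [hm, Units.val_mul, mul_apply_eq_comp, (hyk i hi).2] at h1
    change NormedSpace.exp (L y) (c i) = c i at h1
    rw [exp_apply_eigenvector (X := L y) ha] at h1
    have h2 : (Real.exp a - 1) • c i = 0 := by rw [sub_smul, h1, one_smul, sub_self]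
    have h3 := (smul_eq_zero.1 h2).resolve_right (hc.1 i).1
    rw [sub_eq_zero, Real.exp_eq_one_iff] at h3
    rw [ha, h3, zero_smul]
  have htr : tr V (L y) = 0 := by
    rw [hm, Units.val_mul, det_mul', abs_mul, haut.abs_det hV, mul_one] at hdetm
    change |(NormedSpace.exp (L y)).det| = 1 at hdetm
    rwa [det_exp_L, Real.abs_exp, Real.exp_eq_one_iff] at hdetm
  -- In `M'_l` the compact factor stands on the left, so `exp(L(y)) k` is rewritten as `k exp(L(w))`
  -- with `w = k⁻¹ y`.
  set w := ((k⁻¹ : GLV V) : V →L[ℝ] V) y with hw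
  have hLw : (k : V →L[ℝ] V) * L w = L y * k := by
    rw [haut.mul_L, hw, unit_apply_inv]
  have htrw : tr V (L w) = 0 := by
    rw [← tr_conj k, hLw, Units.mul_inv_cancel_right, htr]
  have hwc : ∀ i : Fin r, (i : ℕ) < l → jmul w (c i) = 0 := fun i hi => by
    have h1 : ((k⁻¹ : GLV V) : V →L[ℝ] V) (c i) = c i := by
      conv_lhs => rw [← (hyk i hi).2, unit_inv_apply]
    rw [hw]
    conv_lhs => rw [← h1, ← hautinv, hyc i hi, map_zero]
  refine ⟨k, (mem_centr_aSub'_iff hcs hlr ⟨hkG, hke⟩).2 fun i hi => (hyk i hi).2, expU (L w),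
    ⟨L w, ⟨mStr_le_mSub' hV hc hlr ⟨isStr_L w, htrw, ?_, hwc⟩, w, ?_, rfl⟩, rfl⟩, ?_⟩
  · exact commute_gradOp_of_commute fun i hi =>
      commute_L_of_zero (by rw [jmul_comm, hwc i hi]) (hcs.idem i)
  · have h1 := tr_L_eq_jtr hV hc w
    rw [htrw, mul_zero] at h1
    exact (mul_eq_zero.1 h1.symm).resolve_left (finrank_pos_of_isSimple hV).ne'
  · rw [hm]
    ext1
    have h2 : L y = (k : V →L[ℝ] V) * L w * ((k⁻¹ : GLV V) : V →L[ℝ] V) := by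
      rw [hLw, Units.mul_inv_cancel_right]
    change NormedSpace.exp (L y) * _ = _ * NormedSpace.exp (L w)
    let : NormedAlgebra ℚ (V →L[ℝ] V) := NormedAlgebra.restrictScalars ℚ ℝ _
    rw [h2, NormedSpace.exp_units_conj, Units.inv_mul_cancel_right]

/-! ### Scalars and the decomposition `G = G' × ℝ₊` -/

variable (V) in
/-- The multiplication by a positive scalar. -/
def scalar (ζ : PosReal) : GLV V := expU (Real.log ζ • L (e : V))

lemma coe_scalar (ζ : PosReal) : (scalar V ζ : V →L[ℝ] V) = (ζ : ℝ) • (1 : V →L[ℝ] V) := by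
  ext v
  change NormedSpace.exp (Real.log ζ • L (e : V)) v = _
  rw [exp_apply_eigenvector (a := Real.log ζ) (by rw [L_e]; rfl), Real.exp_log ζ.2]
  rfl

lemma scalar_mem_G (ζ : PosReal) : scalar V ζ ∈ G V :=
  expU_mem_G ((strAlg V).smul_mem _ (isStr_L _))

lemma scalar_mul (ζ η : PosReal) : scalar V (ζ * η) = scalar V ζ * scalar V η := by
  ext1
  rw [Units.val_mul, coe_scalar, coe_scalar, coe_scalar, smul_mul_smul_comm, one_mul]
  rfl

lemma scalar_one : scalar V 1 = 1 := by
  ext1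
  rw [coe_scalar]
  exact one_smul _ _

lemma scalar_comm (ζ : PosReal) (g : GLV V) : scalar V ζ * g = g * scalar V ζ := by
  ext1
  rw [Units.val_mul, Units.val_mul, coe_scalar, smul_mul_assoc, mul_smul_comm, one_mul, mul_one]

lemma continuous_scalar : Continuous (scalar V) := by
  have h : Continuous fun ζ : PosReal => Real.log ζ :=
    continuous_subtype_val.log fun ζ => ζ.2.ne'
  exact (continuous_expU (L (e : V))).comp h

/-- The operator determinant of a scalar is `ζ ^ n`, and the exponent `r/n` turns it into `ζ ^ r`.
-/
lemma detChar_scalar (hV : IsSimple V) (ζ : PosReal) :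
    detChar r ⟨scalar V ζ, scalar_mem_G ζ⟩ = ζ ^ r := by
  have hn := (finrank_pos_of_isSimple hV).ne'
  ext1
  change |(NormedSpace.exp (Real.log ζ • L (e : V)) : V →L[ℝ] V).det| ^ _ = (ζ : ℝ) ^ r
  rw [← map_smul, det_exp_L, Real.abs_exp, map_smul, map_smul, L_e, tr_one, smul_eq_mul,
    ← Real.exp_mul, ← Real.rpow_natCast, Real.rpow_def_of_pos ζ.2]
  congr 1
  field_simp

/-- The `r`-th root of a positive number. -/
def root (r : ℕ) : PosReal →ₜ* PosReal where
  toFun ζ := ⟨(ζ : ℝ) ^ ((r : ℝ)⁻¹), Real.rpow_pos_of_pos ζ.2 _⟩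
  map_one' := Subtype.ext (Real.one_rpow _)
  map_mul' a b := Subtype.ext (Real.mul_rpow a.2.le b.2.le)
  continuous_toFun := Continuous.subtype_mk
    (continuous_subtype_val.rpow_const fun ζ => .inl ζ.2.ne') _

lemma root_pow (hr : 0 < r) (ζ : PosReal) : root r ζ ^ r = ζ := by
  ext1
  change ((ζ : ℝ) ^ ((r : ℝ)⁻¹)) ^ r = ζ
  rw [← Real.rpow_natCast, ← Real.rpow_mul ζ.2.le, inv_mul_cancel₀ (by positivity), Real.rpow_one]

lemma pow_root (hr : 0 < r) (ζ : PosReal) : root r (ζ ^ r) = ζ := by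
  rw [map_pow, root_pow hr]

lemma mem_kerG {δ : G V →ₜ* PosReal} {g : GLV V} :
    g ∈ kerG δ ↔ ∃ h : g ∈ G V, δ ⟨g, h⟩ = 1 := by
  simp [kerG, Subgroup.mem_map, MonoidHom.mem_ker]

lemma kerG_le {δ : G V →ₜ* PosReal} {g : GLV V} (hg : g ∈ kerG δ) : g ∈ G V := (mem_kerG.1 hg).1

lemma mem_kerG_iff_mem_G' (hV : IsSimple V) (hc : IsJordanFrame c) {g : GLV V} :
    g ∈ kerG (detChar (V := V) r) ↔ g ∈ G' V := by
  rw [mem_kerG]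
  constructor
  · rintro ⟨h, h1⟩
    exact ⟨h, by rw [← detChar_eq hV hc ⟨g, h⟩, h1]; rfl⟩
  · rintro ⟨h, h1⟩
    exact ⟨h, Subtype.ext ((detChar_eq hV hc ⟨g, h⟩).trans h1)⟩

/-- The positive scalar component of an element of `G`. -/
def scale (r : ℕ) (g : G V) : PosReal := root r (detChar r g)

lemma continuous_scale : Continuous (scale (V := V) r) :=
  (root r).continuous_toFun.comp (detChar r).continuous_toFun

lemma scale_mul (a b : G V) : scale r (a * b) = scale r a * scale r b := by
  simp only [scale, map_mul]

lemma scale_scalar (hV : IsSimple V) (hr : 0 < r) (ζ : PosReal) :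
    scale r ⟨scalar V ζ, scalar_mem_G ζ⟩ = ζ := by
  rw [scale, detChar_scalar hV, pow_root hr]

lemma scale_kerG {g : GLV V} (hg : g ∈ kerG (detChar (V := V) r)) :
    scale r (⟨g, kerG_le hg⟩ : G V) = 1 := by
  obtain ⟨h, h1⟩ := mem_kerG.1 hg
  rw [scale, h1, map_one]

lemma detChar_eq_scale_pow (hr : 0 < r) (g : G V) : detChar r g = scale r g ^ r := by
  rw [scale, root_pow hr]

lemma mul_scalar_inv_mem (hV : IsSimple V) (hr : 0 < r) (g : G V) :
    (g : GLV V) * (scalar V (scale r g))⁻¹ ∈ kerG (detChar (V := V) r) := by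
  refine mem_kerG.2 ⟨mul_mem g.2 (inv_mem (scalar_mem_G _)), ?_⟩
  have h1 : detChar r (g * (⟨scalar V (scale r g), scalar_mem_G _⟩ : G V)⁻¹) = 1 := by
    rw [map_mul, map_inv, detChar_scalar hV, ← detChar_eq_scale_pow hr, mul_inv_cancel]
  exact h1

/-- The component in `G'` of an element of `G`. -/
def kerPart (hV : IsSimple V) (hr : 0 < r) (g : G V) : kerG (detChar (V := V) r) :=
  ⟨(g : GLV V) * (scalar V (scale r g))⁻¹, mul_scalar_inv_mem hV hr g⟩

lemma continuous_kerPart (hV : IsSimple V) (hr : 0 < r) : Continuous (kerPart (V := V) hV hr) :=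
  (continuous_subtype_val.mul (continuous_scalar.comp continuous_scale).inv).subtype_mk _

/-- The product of an element of `G'` and a scalar. -/
def mulScalar (p : kerG (detChar (V := V) r) × PosReal) : G V :=
  ⟨(p.1 : GLV V) * scalar V p.2, mul_mem (kerG_le p.1.2) (scalar_mem_G _)⟩

lemma continuous_mulScalar : Continuous (mulScalar (V := V) (r := r)) :=
  ((continuous_subtype_val.comp continuous_fst).mul
    (continuous_scalar.comp continuous_snd)).subtype_mk _

lemma scale_mulScalar (hV : IsSimple V) (hr : 0 < r) (p : kerG (detChar (V := V) r) × PosReal) :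
    scale r (mulScalar p) = p.2 := by
  have h1 : mulScalar p = (⟨p.1, kerG_le p.1.2⟩ : G V) * ⟨scalar V p.2, scalar_mem_G _⟩ := rfl
  rw [h1, scale_mul, scale_kerG p.1.2, one_mul, scale_scalar hV hr]

lemma kerPart_mulScalar (hV : IsSimple V) (hr : 0 < r) (p : kerG (detChar (V := V) r) × PosReal) :
    kerPart hV hr (mulScalar p) = p.1 := by
  apply Subtype.ext
  simp only [kerPart, scale_mulScalar hV hr]
  exact mul_inv_cancel_right _ _

lemma mulScalar_kerPart (hV : IsSimple V) (hr : 0 < r) (g : G V) :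
    mulScalar (kerPart hV hr g, scale r g) = g :=
  Subtype.ext (inv_mul_cancel_right _ _)

lemma mulScalar_mul (p q : kerG (detChar (V := V) r) × PosReal) :
    mulScalar (p * q) = mulScalar p * mulScalar q := by
  apply Subtype.ext
  have h1 : (p.1 : GLV V) * q.1 * scalar V (p.2 * q.2) =
      p.1 * scalar V p.2 * (q.1 * scalar V q.2) := by
    rw [scalar_mul, mul_assoc, mul_assoc, ← mul_assoc (scalar V p.2) (q.1 : GLV V),
      scalar_comm p.2 (q.1 : GLV V), mul_assoc (q.1 : GLV V)]
  exact h1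

/-- The decomposition `G = G' × ℝ₊`. -/
def decomp (hV : IsSimple V) (hr : 0 < r) :
    (kerG (detChar (V := V) r) × PosReal) ≃ₜ* G V where
  toFun := mulScalar
  invFun g := (kerPart hV hr g, scale r g)
  left_inv p := Prod.ext (kerPart_mulScalar hV hr p) (scale_mulScalar hV hr p)
  right_inv := mulScalar_kerPart hV hr
  map_mul' := mulScalar_mul
  continuous_toFun := continuous_mulScalar
  continuous_invFun := (continuous_kerPart hV hr).prodMk continuous_scale

/-! ### The duals of `𝔞_l` and `𝔞'_l` -/

/-- Serves for both the `L(c_j)` and the `h_j`: on `c_1, …, c_l` the two families act in the same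
diagonal way. -/
lemma linearIndependent_of_apply_frame (hc : IsJordanFrame c) {A : Fin r → V →L[ℝ] V}
    (hA : ∀ i j : Fin r, (i : ℕ) < l → A j (c i) = if j = i then c i else 0) :
    LinearIndependent ℝ fun j : {j : Fin r // (j : ℕ) < l} => A j := by
  rw [Fintype.linearIndependent_iff]
  intro a ha i
  have h1 := sum_smul_apply_frame hA a i.2
  rw [ha] at h1
  exact (smul_eq_zero.1 h1.symm).resolve_right (hc.1 i).1

/-- The isomorphism `ν ↦ ν̃`. -/
def dualEquiv (hc : IsJordanFrame c) (l : ℕ) : (aSub c l →ₗ[ℝ] ℂ) ≃ₗ[ℂ] (aSub' c l →ₗ[ℝ] ℂ) :=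
  LinearEquiv.congrLeft ℂ ℂ ((Module.Basis.span (linearIndependent_of_apply_frame (l := l) hc
      (A := fun j => L (c j)) fun i j _ => L_apply_frame hc.isCSOI i j)).equiv
    (Module.Basis.span (linearIndependent_of_apply_frame (l := l) hc
      (A := hVec c l) fun _ j hi => hVec_apply_frame hc.isCSOI hi j)) (Equiv.refl _))

lemma dualEquiv_apply (hc : IsJordanFrame c) (ν : aSub c l →ₗ[ℝ] ℂ)
    (j : {j : Fin r // (j : ℕ) < l}) : dualEquiv hc l ν (aVec' c l j) = ν (aVec c l j) := by
  set b := Module.Basis.span (linearIndependent_of_apply_frame (l := l) hc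
      (A := fun j => L (c j)) fun i j _ => L_apply_frame hc.isCSOI i j) with hb
  set b' := Module.Basis.span (linearIndependent_of_apply_frame (l := l) hc
      (A := hVec c l) fun _ j hi => hVec_apply_frame hc.isCSOI hi j) with hb'
  have h1 : aVec c l j = b j := Subtype.ext (by
    rw [hb, Module.Basis.span_apply]; rfl)
  have h2 : aVec' c l j = b' j := Subtype.ext (by
    rw [hb', Module.Basis.span_apply]; rfl)
  rw [h1, h2]
  change ν ((b.equiv b' (Equiv.refl _)).symm (b' j)) = _
  rw [Module.Basis.equiv_symm, Module.Basis.equiv_apply]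
  rfl

/-! ### Comparison of the characters -/

lemma expChar_eq (hV : IsSimple V) (hc : IsJordanFrame c) (ν : aSub c l →ₗ[ℝ] ℂ) {q : GLV V}
    (hq : q ∈ Q c l) : expChar (M c l) (aSub c l) (NBar c l) ν q =
      Complex.exp (∑ j : {j : Fin r // (j : ℕ) < l},
        Real.log (diagCoeff c q j) * ν (aVec c l j)) := by
  rw [expChar, logA_eq hc (exists_decomposition_Q hV hc hq), map_sum]
  simp only [map_smul, Complex.real_smul]

lemma expChar'_eq (hV : IsSimple V) (hc : IsJordanFrame c) (hlr : l < r)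
    (ν : aSub c l →ₗ[ℝ] ℂ) {q : GLV V} (hq : q ∈ Q' c l) :
    expChar (M' c l) (aSub' c l) (NBar c l) (dualEquiv hc l ν) q =
      expChar (M c l) (aSub c l) (NBar c l) ν q := by
  obtain ⟨h1, h2⟩ := (mem_Q'_iff hV hc hlr).1 hq
  rw [expChar_eq hV hc ν h1, expChar,
    logA'_eq hV hc hlr (exists_decomposition_Q' hV hc hlr h1 h2), map_sum]
  simp only [map_smul, Complex.real_smul, dualEquiv_apply]

lemma scalar_mul_mem_Q (ζ : PosReal) {q : GLV V} (hq : q ∈ Q c l) : scalar V ζ * q ∈ Q c l := by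
  obtain ⟨z, hz, n, hn, rfl⟩ := hq
  obtain ⟨hz1, hz2⟩ := mem_ZA_iff.1 hz
  refine ⟨scalar V ζ * z, mem_ZA_iff.2 ⟨mul_mem (scalar_mem_G ζ) hz1, fun i hi => ?_⟩, n, hn,
    (mul_assoc _ _ _).symm⟩
  rw [Units.val_mul, coe_scalar, smul_mul_assoc, one_mul]
  exact (hz2 i hi).smul_right _

lemma powChar_eq (s : ℂ) (ζ : PosReal) : powChar s ζ = Complex.exp (Real.log ζ * s) := by
  change ((ζ : ℝ) : ℂ) ^ s = _
  rw [Complex.cpow_def_of_ne_zero (by exact_mod_cast ζ.2.ne'), Complex.ofReal_log ζ.2.le]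

lemma diagCoeff_pos (hV : IsSimple V) (hc : IsJordanFrame c) {q : GLV V} (hq : q ∈ Q c l)
    (j : {j : Fin r // (j : ℕ) < l}) : 0 < diagCoeff c q j := by
  obtain ⟨z, hz, n, hn, rfl⟩ := hq
  obtain ⟨ξ, hξ⟩ := exists_eigen_ZA hV hc hz
  have hz2 := ((mem_ZA_iff_gradOp hV hc.isCSOI).1 hz).2
  have h1 : ((z * n : GLV V) : V →L[ℝ] V) = z + z * ((n : V →L[ℝ] V) - 1) := by
    rw [Units.val_mul]; noncomm_ring
  rw [h1, diagCoeff_add, diagCoeff_eq_zero hc.isCSOI (mul_mem_shift hc.isCSOI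
    (mem_shift_of_commute hc.isCSOI hz2) (NBar_spec hc.isCSOI hn).2.1), add_zero,
    diagCoeff_of_eigen hc (hξ j)]
  exact Real.exp_pos _

/-- A scalar multiplies each of the diagonal coefficients by `ζ`, so each `ν_j` contributes a factor
`ζ ^ ν_j`. -/
lemma expChar_scalar_mul (hV : IsSimple V) (hc : IsJordanFrame c) (ν : aSub c l →ₗ[ℝ] ℂ)
    (ζ : PosReal) {q : GLV V} (hq : q ∈ Q c l) :
    expChar (M c l) (aSub c l) (NBar c l) ν (scalar V ζ * q) =
      powChar (∑ j, ν (aVec c l j)) ζ * expChar (M c l) (aSub c l) (NBar c l) ν q := by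
  rw [expChar_eq hV hc ν (scalar_mul_mem_Q ζ hq), expChar_eq hV hc ν hq, powChar_eq,
    ← Complex.exp_add, Finset.mul_sum, ← Finset.sum_add_distrib]
  congr 1
  refine Finset.sum_congr rfl fun j _ => ?_
  have h1 : diagCoeff c ((scalar V ζ * q : GLV V) : V →L[ℝ] V) j = ζ * diagCoeff c q j := by
    rw [Units.val_mul, coe_scalar, smul_mul_assoc, one_mul, diagCoeff, diagCoeff, smul_apply,
      inner_smul_right, mul_div_assoc]
  rw [h1, Real.log_mul ζ.2.ne' (diagCoeff_pos hV hc hq j).ne']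
  push_cast
  ring

/-! ### Restriction of induced representations to `G'` -/

instance : LocallyCompactSpace (G V) := by
  have : ProperSpace (V →L[ℝ] V) := FiniteDimensional.proper ℝ _
  have : LocallyCompactSpace (GLV V) := Units.isOpenEmbedding_val.locallyCompactSpace
  exact isClosed_G.isClosedEmbedding_subtypeVal.locallyCompactSpace

lemma mem_Q_of_scalar (ζ : PosReal) : scalar V ζ ∈ Q c l := by
  have h1 : (1 : GLV V) ∈ Q c l := ⟨1, mem_ZA_iff.2 ⟨one_mem _, fun _ _ => Commute.one_right _⟩, 1,
    ⟨0, Submodule.zero_mem _, by simp⟩, (one_mul 1).symm⟩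
  have h2 := scalar_mul_mem_Q ζ h1
  rwa [mul_one] at h2

/-- The inclusion of `G'` in `G`. -/
def kerIncl (r : ℕ) : C(kerG (detChar (V := V) r), G V) :=
  ⟨fun g => ⟨g, kerG_le g.2⟩, continuous_subtype_val.subtype_mk _⟩

lemma continuous_powChar (s : ℂ) : Continuous (powChar s) := by
  have h : ∀ ζ : PosReal, powChar s ζ = Complex.exp (Real.log ζ * s) := powChar_eq s
  refine Continuous.congr (f := fun ζ : PosReal => Complex.exp (Real.log ζ * s)) ?_
    fun ζ => (h ζ).symm
  have h1 : Continuous fun ζ : PosReal => Real.log ζ :=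
    continuous_subtype_val.log fun ζ => ζ.2.ne'
  exact ((Complex.continuous_ofReal.comp h1).mul continuous_const).cexp

lemma powChar_ne_zero (s : ℂ) (ζ : PosReal) : powChar s ζ ≠ 0 := by
  rw [powChar_eq]; exact Complex.exp_ne_zero _

/-- The space of `Ind_{Q_l}^G (1 ⊗ e^ν ⊗ 1)`. -/
abbrev IndSpace (ν : aSub c l →ₗ[ℝ] ℂ) :=
  equivFun (G V) (Q c l) (expChar (M c l) (aSub c l) (NBar c l) ν)

/-- The space of `Ind_{Q'_l}^{G'} (1 ⊗ e^ν̃ ⊗ 1)`. -/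
abbrev IndSpace' (hc : IsJordanFrame c) (ν : aSub c l →ₗ[ℝ] ℂ) :=
  equivFun (kerG (detChar (V := V) r)) (Q' c l)
    (expChar (M' c l) (aSub' c l) (NBar c l) (dualEquiv hc l ν))

/-- The exponent by which the scalars act on `Ind_{Q_l}^G (1 ⊗ e^ν ⊗ 1)`. -/
def weight (ν : aSub c l →ₗ[ℝ] ℂ) : ℂ := ∑ j, ν (aVec c l j)

lemma expChar_one (hV : IsSimple V) (hc : IsJordanFrame c) (ν : aSub c l →ₗ[ℝ] ℂ) :
    expChar (M c l) (aSub c l) (NBar c l) ν 1 = 1 := by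
  have h1 : (1 : GLV V) ∈ Q c l := by
    have := mem_Q_of_scalar (c := c) (l := l) 1
    rwa [scalar_one] at this
  rw [expChar_eq hV hc ν h1, Finset.sum_eq_zero, Complex.exp_zero]
  intro j _
  rw [diagCoeff_of_eigen hc (a := 1) (by simp), Real.log_one, Complex.ofReal_zero, zero_mul]

lemma expChar_scalar (hV : IsSimple V) (hc : IsJordanFrame c) (ν : aSub c l →ₗ[ℝ] ℂ)
    (ζ : PosReal) :
    expChar (M c l) (aSub c l) (NBar c l) ν (scalar V ζ) = powChar (weight ν) ζ := by
  have h1 : (1 : GLV V) ∈ Q c l := by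
    have := mem_Q_of_scalar (c := c) (l := l) 1
    rwa [scalar_one] at this
  have h2 := expChar_scalar_mul hV hc ν ζ h1
  rwa [mul_one, expChar_one hV hc, mul_one] at h2

/-- Equivariance under the scalars, which lie in `Q_l`; thus `f` is determined on `G` by its values
on `G'`. -/
lemma apply_mulScalar (hV : IsSimple V) (hc : IsJordanFrame c) {ν : aSub c l →ₗ[ℝ] ℂ}
    (f : IndSpace ν) (p : kerG (detChar (V := V) r) × PosReal) :
    f.1 (mulScalar p) = (powChar (weight ν) p.2)⁻¹ * f.1 (kerIncl r p.1) := by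
  rw [← expChar_scalar hV hc]
  exact f.2 (kerIncl r p.1) ⟨scalar V p.2, scalar_mem_G _⟩ (mem_Q_of_scalar _)

/-- Restriction of functions from `G` to `G'`. -/
def restrict (hV : IsSimple V) (hc : IsJordanFrame c) (hlr : l < r) (ν : aSub c l →ₗ[ℝ] ℂ) :
    IndSpace ν →L[ℂ] IndSpace' hc ν where
  toFun f := ⟨f.1.comp (kerIncl r), fun g q hq => by
    have hq' := (mem_Q'_iff hV hc hlr).1 hq
    rw [expChar'_eq hV hc hlr ν hq]
    exact f.2 (kerIncl r g) (kerIncl r q) hq'.1⟩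
  map_add' _ _ := rfl
  map_smul' _ _ := rfl
  cont := Continuous.subtype_mk
    ((ContinuousMap.continuous_precomp (kerIncl r)).comp continuous_subtype_val) _

lemma kerPart_mul (hV : IsSimple V) (hr : 0 < r) (g q : G V) :
    kerPart hV hr (g * q) = kerPart hV hr g * kerPart hV hr q := by
  have h1 := congrArg Prod.fst (map_mul (decomp (V := V) hV hr).symm g q)
  exact h1

lemma kerPart_mem_Q' (hV : IsSimple V) (hc : IsJordanFrame c) (hlr : l < r) (hr : 0 < r) {q : G V}
    (hq : (q : GLV V) ∈ Q c l) : (kerPart hV hr q : GLV V) ∈ Q' c l := by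
  refine (mem_Q'_iff hV hc hlr).2 ⟨?_, (mem_kerG_iff_mem_G' hV hc).1 (kerPart hV hr q).2⟩
  have h1 : (kerPart hV hr q : GLV V) = scalar V (scale r q)⁻¹ * q := by
    have h2 : scalar V (scale r q)⁻¹ = (scalar V (scale r q))⁻¹ := by
      rw [eq_inv_iff_mul_eq_one, ← scalar_mul, inv_mul_cancel, scalar_one]
    rw [scalar_comm, h2]
    rfl
  rw [h1]
  exact scalar_mul_mem_Q _ hq

lemma expChar_kerPart (hV : IsSimple V) (hc : IsJordanFrame c) (hlr : l < r) (hr : 0 < r)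
    (ν : aSub c l →ₗ[ℝ] ℂ) {q : G V} (hq : (q : GLV V) ∈ Q c l) :
    expChar (M c l) (aSub c l) (NBar c l) ν q = powChar (weight ν) (scale r q) *
      expChar (M' c l) (aSub' c l) (NBar c l) (dualEquiv hc l ν) (kerPart hV hr q) := by
  have h1 := kerPart_mem_Q' hV hc hlr hr hq
  have h2 : (q : GLV V) = scalar V (scale r q) * (kerPart hV hr q : GLV V) := by
    rw [scalar_comm]
    exact (congrArg Subtype.val (mulScalar_kerPart hV hr q)).symm
  rw [expChar'_eq hV hc hlr ν h1]
  conv_lhs => rw [h2, expChar_scalar_mul hV hc ν _ ((mem_Q'_iff hV hc hlr).1 h1).1]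
  rfl

/-- Extension of functions from `G'` to `G`. -/
def extend (hV : IsSimple V) (hc : IsJordanFrame c) (hlr : l < r) (hr : 0 < r)
    (ν : aSub c l →ₗ[ℝ] ℂ) : IndSpace' hc ν →L[ℂ] IndSpace ν where
  toFun F := ⟨⟨fun g => (powChar (weight ν) (scale r g))⁻¹, ((continuous_powChar _).comp
      continuous_scale).inv₀ fun _ => powChar_ne_zero _ _⟩ *
      F.1.comp ⟨kerPart hV hr, continuous_kerPart hV hr⟩, fun g q hq => by
    simp only [ContinuousMap.mul_apply, ContinuousMap.coe_mk, ContinuousMap.comp_apply,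
      scale_mul, kerPart_mul, map_mul]
    rw [F.2 _ _ (kerPart_mem_Q' hV hc hlr hr hq), expChar_kerPart hV hc hlr hr ν hq, mul_inv,
      mul_inv]
    ring⟩
  map_add' F₁ F₂ := by
    ext g
    simp [mul_add]
  map_smul' z F := by
    ext g
    simp [mul_left_comm]
  cont := Continuous.subtype_mk (continuous_const.mul
    ((ContinuousMap.continuous_precomp _).comp continuous_subtype_val)) _

/-- The isomorphism given by restriction to `G'`. -/
def restrictEquiv (hV : IsSimple V) (hc : IsJordanFrame c) (hlr : l < r) (ν : aSub c l →ₗ[ℝ] ℂ) :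
    IndSpace ν ≃L[ℂ] IndSpace' hc ν :=
  ContinuousLinearEquiv.equivOfInverse (restrict hV hc hlr ν)
    (extend hV hc hlr (hc.pos hV) ν)
    (fun f => by
      ext g
      have h1 := apply_mulScalar hV hc f (kerPart hV (hc.pos hV) g, scale r g)
      rw [mulScalar_kerPart] at h1
      exact h1.symm)
    (fun F => by
      ext g
      have h1 : kerIncl r g = mulScalar (g, 1) := Subtype.ext (by
        change (g : GLV V) = g * scalar V 1
        rw [scalar_one, mul_one])
      have h2 : ((extend hV hc hlr (hc.pos hV) ν) F).1 (kerIncl r g) =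
          (powChar (weight ν) (scale r (kerIncl r g)))⁻¹ *
            F.1 (kerPart hV (hc.pos hV) (kerIncl r g)) := rfl
      rw [h1, kerPart_mulScalar, scale_mulScalar hV (hc.pos hV), map_one, inv_one, one_mul,
        ← h1] at h2
      exact h2)

lemma powChar_pow (s : ℂ) (ζ : PosReal) (n : ℕ) : powChar s (ζ ^ n) = powChar (n * s) ζ := by
  rw [map_pow, powChar_eq, powChar_eq, ← Complex.exp_nat_mul]
  congr 1
  ring

lemma powChar_add (s t : ℂ) (ζ : PosReal) : powChar (s + t) ζ = powChar s ζ * powChar t ζ := by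
  rw [powChar_eq, powChar_eq, powChar_eq, ← Complex.exp_add]
  congr 1
  ring

lemma powChar_inv (s : ℂ) (ζ : PosReal) : (powChar s ζ⁻¹)⁻¹ = powChar s ζ :=
  inv_eq_of_mul_eq_one_left (by rw [← map_mul, mul_inv_cancel, map_one])

/-- For `g = ζ g'` the scalar `ζ⁻¹` in `g⁻¹ x` comes out of `f` as `ζ ^ (∑ ν_j)`, and the twist by
`Δ` contributes the `r`-th power of `ζ ^ (-ld/4)`; together they form `m_ν(ζ)`. -/
lemma restrictEquiv_equivariant (hV : IsSimple V) (hc : IsJordanFrame c) (hlr : l < r)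
    (ν : aSub c l →ₗ[ℝ] ℂ) (g : G V) (f : IndSpace ν) :
    restrictEquiv hV hc hlr ν (twist (indG c l ν)
        ((powChar (-((l : ℂ) * degree c / 4))).comp
          ((detChar r : G V →ₜ* PosReal) : G V →* PosReal)) g f) =
      twist ((indG' c l (kerG (detChar r)) (dualEquiv hc l ν)).comp
          (MonoidHom.fst (kerG (detChar r)) PosReal))
        ((mChar c l ν).comp (MonoidHom.snd (kerG (detChar r)) PosReal))
        ((decomp hV (hc.pos hV)).symm g) (restrictEquiv hV hc hlr ν f) := by
  have hr := hc.pos hV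
  ext x
  set g' := kerPart hV hr g with hg'
  set ζ := scale r g with hζ
  change powChar (-((l : ℂ) * degree c / 4)) (detChar r g) * f.1 (g⁻¹ * kerIncl r x) =
    mChar c l ν ζ * f.1 (kerIncl r (g'⁻¹ * x))
  have h1 : g⁻¹ * kerIncl r x = mulScalar (g'⁻¹ * x, ζ⁻¹) := by
    rw [← mulScalar_kerPart hV hr (g⁻¹ * kerIncl r x)]
    have hx : kerIncl r x = mulScalar (x, 1) := Subtype.ext (by
      change (x : GLV V) = x * scalar V 1
      rw [scalar_one, mul_one])
    have h2 : (decomp hV hr).symm (g⁻¹ * mulScalar (x, 1)) = (g'⁻¹ * x, ζ⁻¹) := by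
      rw [map_mul, map_inv]
      have h3 : (decomp hV hr).symm (mulScalar (x, 1)) = (x, 1) :=
        (decomp (V := V) hV hr).symm_apply_apply (x, 1)
      rw [h3]
      refine Prod.ext rfl ?_
      exact mul_one _
    rw [hx]
    exact congrArg mulScalar h2
  rw [h1, apply_mulScalar hV hc, powChar_inv, detChar_eq_scale_pow hr, powChar_pow, mChar, powChar_add,
    ← mul_assoc, show (r : ℂ) * -((l : ℂ) * degree c / 4) = -((r : ℂ) * l * degree c / 4) by ring]
  rfl

end

end EuclideanJordanAlgebra

theorem propositionP {V : Type*} [NormedAddCommGroup V] [InnerProductSpace ℝ V]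
    [FiniteDimensional ℝ V] [EuclideanJordanAlgebra V] (hV : EuclideanJordanAlgebra.IsSimple V)
    {r : ℕ} (c : Fin r → V) (hc : IsJordanFrame c) (l : ℕ) (hl : 1 ≤ l) (hlr : l < r) :
    -- the determinant defines a character of `G`, with kernel `G' = kerG δ`
    ∃ δ : G V →ₜ* PosReal,
      (∀ g : G V, (δ g : ℝ) = jdet (((g : GLV V) : V →L[ℝ] V) e)) ∧
    -- the decomposition `G = G' × ℝ₊`
    ∃ φ : (kerG δ × PosReal) ≃ₜ* G V,
      (∀ p, ((φ p : GLV V) : V →L[ℝ] V) = (p.2 : ℝ) • ((p.1 : GLV V) : V →L[ℝ] V)) ∧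
    -- the isomorphism `ν ↦ ν̃` given by the dual bases
    ∃ E : (aSub c l →ₗ[ℝ] ℂ) ≃ₗ[ℂ] (aSub' c l →ₗ[ℝ] ℂ),
      (∀ ν j, E ν (aVec' c l j) = ν (aVec c l j)) ∧
    -- the isomorphism of representations of `G`
    ∀ ν : aSub c l →ₗ[ℝ] ℂ,
      ∃ T : equivFun (G V) (Q c l) (expChar (M c l) (aSub c l) (NBar c l) ν) ≃L[ℂ]
          equivFun (kerG δ) (Q' c l) (expChar (M' c l) (aSub' c l) (NBar c l) (E ν)),
        ∀ (g : G V) f,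
          T (twist (indG c l ν)
              ((powChar (-((l : ℂ) * degree c / 4))).comp (δ : G V →* PosReal)) g f) =
            twist ((indG' c l (kerG δ) (E ν)).comp (MonoidHom.fst (kerG δ) PosReal))
              ((mChar c l ν).comp (MonoidHom.snd (kerG δ) PosReal)) (φ.symm g) (T f) := by
  refine ⟨detChar r, detChar_eq hV hc, decomp hV (hc.pos hV), fun p => ?_, dualEquiv hc l,
    dualEquiv_apply hc, fun ν => ⟨restrictEquiv hV hc hlr ν, restrictEquiv_equivariant hV hc hlr ν⟩⟩
  change ((p.1 : GLV V) : V →L[ℝ] V) * (scalar V p.2 : V →L[ℝ] V) = _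
  rw [coe_scalar, mul_smul_comm, mul_one]
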